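/- Setting. Let $N\in\mathbb N$, $1<p<N$, $p\ne 2$, $q\in(p-1,p)$, $\vartheta>0$, and let $\Omega\subset\mathbb R^N$ be a bounded domain with $0\in\Omega$. Let $A:(0,\infty)\to(0,\infty)$ be of class $C^1$, with $t\mapsto tA(t)$ increasing, and such that, for some constants $c_1,c_2>0$, $K_0\ge 1$: $|A(|\xi|)\xi|\le c_1|\xi|^{p-1}$ whenever $|\xi|\ge K_0$; $[A(|\xi|)\xi-A(|\xi'|)\xi']\cdot(\xi-\xi')\ge c_2(|\xi|+|\xi'|)^{p-2}|\xi-\xi'|^2$ for all $\xi,\xi'\in\mathbb R^N$ (with $A(|\xi|)\xi:=0$ for $\xi=0$); and $$-1<m_A:=\inf_{t>0}\frac{tA'(t)}{A(t)}\le M_A:=\sup_{t>0}\frac{tA'(t)}{A(t)}<\infty .$$ Let $B:[0,\infty)\to[0,\infty)$ be of class $C^1$ with $B(0)=0$, $B(t)\ge\sigma t^p$ for some $\sigma>0$, and $B'(t)\le\hat C\,tA(t)$ for all $t>0$, where $\hat C>0$. Let $f\in W^{1,\infty}(\Omega)$ (continuous representative) and put $h(x,s)=\vartheta s^q/|x|^p+f(x)$.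 Let $u\in W^{1,p}_0(\Omega)$ be a weak solution of $-\mathrm{div}(A(|\nabla u|)\nabla u)+B(|\nabla u|)=h(x,u)$ in $\Omega$, with $u>0$ in $\Omega\setminus\{0\}$, that is, $$\int_\Omega A(|\nabla u|)\nabla u\cdot\nabla\varphi\,dx+\int_\Omega B(|\nabla u|)\varphi\,dx=\vartheta\int_\Omega\frac{u^q}{|x|^p}\varphi\,dx+\int_\Omega f\varphi\,dx\qquad\forall\varphi\in W_0^{1,p}(\Omega)\cap L^\infty(\Omega).$$ Assume $u\in C^{1,a}_{loc}(\Omega\setminus\{0\})\cap C^2(\Omega\setminus(Z_u\cup\{0\}))$ for some $a\in(0,1)$, where $Z_u=\{x\in\Omega\setminus\{0\}:\nabla u(x)=0\}$. Let $r\in(0,1)$, let $\gamma<N-2$ if $N\ge3$ and $\gamma=0$ if $N=2$, and set $\alpha=\frac{p-1}{p-2}$ if $p>2$, $\alpha=\frac{m_A+1}{m_A}$ if $1<p<2$. For an open set $V$ with $\overline V$ compact in $\Omega\setminus\{0\}$, say that $(L,c,K)$ are bounds for $u$ on $V$ if $c>0$, $|\nabla u|\le L$ and $h(x,u(x))\ge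 c$ on $V$, and $x\mapsto h(x,u(x))$ is Lipschitz on $V$ with constant $K$. (i) Suppose $B_{2\rho}(x_0)\subset\Omega\setminus\{0\}$ and $f>0$ in $B_{2\rho}(x_0)$, and let $\rho<R<2\rho$. Then $|Z_u\cap B_\rho(x_0)|=0$ (so that the integrand below is defined almost everywhere), bounds for $u$ on $B_R(x_0)$ exist, and for all bounds $(L,c,K)$ on $B_R(x_0)$ $$\int_{B_\rho(x_0)}\frac{1}{A(|\nabla u|)^{\alpha r}}\,\frac{1}{|x-y|^{\gamma}}\,dx\le\mathcal C\qquad\text{for every }y\in B_\rho(x_0),$$ where $\mathcal C$ depends only on $N,p,r,\gamma,c_2,\hat C,m_A,M_A,A(1),x_0,\rho,R,L,c,K$. (ii) Suppose $\Omega$ has smooth boundary and $f\ge0$ in $\Omega$. Let $\tilde\Omega\Subset V\Subset\Omega\setminus\{0\}$ with $V$ open. Then $|Z_u\cap\tilde\Omega|=0$, bounds for $u$ on $V$ exist, and for all bounds $(L,c,K)$ on $V$ $$\int_{\tilde\Omega}\frac{1}{A(|\nabla u|)^{\alpha r}}\,\frac{1}{|x-y|^{\gamma}}\,dx\le\mathcal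 C\qquad\text{for every }y\in\tilde\Omega,$$ where $\mathcal C$ depends only on $N,p,r,\gamma,c_2,\hat C,m_A,M_A,A(1),\tilde\Omega,V,L,c,K$. -/

import Mathlib

open MeasureTheory Set Filter Topology
open scoped ContDiff NNReal ENNReal

/-- Structural assumptions on `A : (0,∞) → (0,∞)` (values of `A` outside `(0,∞)` are irrelevant).
`mA`, `MA` are the infimum and the supremum of `t A'(t) / A(t)` over `t > 0`. -/
structure AdmissibleA (N : ℕ) (p c₂ mA MA : ℝ) (A : ℝ → ℝ) : Prop where
  pos : ∀ t, 0 < t → 0 < A t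
  contDiffOn : ContDiffOn ℝ 1 A (Ioi 0)
  mono : MonotoneOn (fun t => t * A t) (Ioi 0)
  growth : ∃ c₁ K : ℝ, 0 < c₁ ∧ 1 ≤ K ∧ ∀ ξ : EuclideanSpace ℝ (Fin N), K ≤ ‖ξ‖ →
    ‖A ‖ξ‖ • ξ‖ ≤ c₁ * ‖ξ‖ ^ (p - 1)
  c₂_pos : 0 < c₂
  monotone_vec : ∀ ξ ξ' : EuclideanSpace ℝ (Fin N),
    c₂ * (‖ξ‖ + ‖ξ'‖) ^ (p - 2) * ‖ξ - ξ'‖ ^ 2 ≤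
      inner ℝ (A ‖ξ‖ • ξ - A ‖ξ'‖ • ξ') (ξ - ξ')
  isGLB : IsGLB ((fun t => t * deriv A t / A t) '' Ioi 0) mA
  isLUB : IsLUB ((fun t => t * deriv A t / A t) '' Ioi 0) MA
  neg_one_lt : -1 < mA

/-- Structural assumptions on `B : [0,∞) → [0,∞)`. -/
structure AdmissibleB (p Chat : ℝ) (A B : ℝ → ℝ) : Prop where
  nonneg : ∀ t, 0 ≤ t → 0 ≤ B t
  contDiffOn : ContDiffOn ℝ 1 B (Ici 0)
  zero : B 0 = 0
  lower : ∃ σ : ℝ, 0 < σ ∧ ∀ t, 0 ≤ t → σ * t ^ p ≤ B t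
  Chat_pos : 0 < Chat
  deriv_le : ∀ t, 0 < t → deriv B t ≤ Chat * t * A t

/-- Smooth test functions with compact support in `Ω`. -/
def IsTestFunction {N : ℕ} (Ω : Set (EuclideanSpace ℝ (Fin N)))
    (φ : EuclideanSpace ℝ (Fin N) → ℝ) : Prop :=
  ContDiff ℝ ∞ φ ∧ HasCompactSupport φ ∧ tsupport φ ⊆ Ω

/-- `v ∈ W₀^{1,p}(Ω)` with weak gradient `G`: the pair `(v, G)` is the limit in `L^p(Ω)` of pairs
`(φₙ, ∇φₙ)` with `φₙ ∈ C_c^∞(Ω)`. -/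
def MemW0 {N : ℕ} (Ω : Set (EuclideanSpace ℝ (Fin N))) (p : ℝ)
    (v : EuclideanSpace ℝ (Fin N) → ℝ)
    (G : EuclideanSpace ℝ (Fin N) → EuclideanSpace ℝ (Fin N)) : Prop :=
  MemLp v (ENNReal.ofReal p) (volume.restrict Ω) ∧
  MemLp G (ENNReal.ofReal p) (volume.restrict Ω) ∧
  ∃ φ : ℕ → EuclideanSpace ℝ (Fin N) → ℝ, (∀ n, IsTestFunction Ω (φ n)) ∧
    Tendsto (fun n => eLpNorm (fun x => φ n x - v x) (ENNReal.ofReal p) (volume.restrict Ω))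
      atTop (𝓝 0) ∧
    Tendsto (fun n => eLpNorm (fun x => gradient (φ n) x - G x) (ENNReal.ofReal p)
      (volume.restrict Ω)) atTop (𝓝 0)

/-- `f ∈ W^{1,∞}(Ω)`: `f` and its weak gradient are essentially bounded on `Ω`. As usual `f` denotes
the continuous representative, so that its pointwise values make sense. -/
def MemW1Infty {N : ℕ} (Ω : Set (EuclideanSpace ℝ (Fin N)))
    (f : EuclideanSpace ℝ (Fin N) → ℝ) : Prop :=
  ContinuousOn f Ω ∧ MemLp f ⊤ (volume.restrict Ω) ∧
  ∃ G : EuclideanSpace ℝ (Fin N) → EuclideanSpace ℝ (Fin N), MemLp G ⊤ (volume.restrict Ω) ∧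
    ∀ φ, IsTestFunction Ω φ → ∫ x in Ω, f x • gradient φ x = - ∫ x in Ω, φ x • G x

/-- The boundary of `Ω` is smooth: near each boundary point, `Ω` is the sublevel set `{g < 0}` of
a smooth function `g` without critical points. -/
def HasSmoothBoundary {N : ℕ} (Ω : Set (EuclideanSpace ℝ (Fin N))) : Prop :=
  ∀ x ∈ frontier Ω, ∃ U : Set (EuclideanSpace ℝ (Fin N)), IsOpen U ∧ x ∈ U ∧
    ∃ g : EuclideanSpace ℝ (Fin N) → ℝ, ContDiffOn ℝ ∞ g U ∧ (∀ z ∈ U, fderiv ℝ g z ≠ 0) ∧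
      Ω ∩ U = {z ∈ U | g z < 0}

/-- A bounded domain of `ℝ^N` containing the origin. -/
def IsBoundedDomain {N : ℕ} (Ω : Set (EuclideanSpace ℝ (Fin N))) : Prop :=
  IsOpen Ω ∧ IsConnected Ω ∧ Bornology.IsBounded Ω ∧ 0 ∈ Ω

/-- The right-hand side `h(x, s) = ϑ s^q / |x|^p + f(x)`. -/
noncomputable def rhs {N : ℕ} (p q ϑ : ℝ) (f : EuclideanSpace ℝ (Fin N) → ℝ)
    (x : EuclideanSpace ℝ (Fin N)) (s : ℝ) : ℝ :=
  ϑ * (s ^ q / ‖x‖ ^ p) + f x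

/-- `u ∈ W₀^{1,p}(Ω)` is a positive weak solution of `-div(A(|∇u|)∇u) + B(|∇u|) = h(x,u)` in `Ω`,
`u = 0` on `∂Ω`. (`u` will be of class `C¹` away from the origin, so its weak gradient is the
classical one almost everywhere; no value is prescribed at the origin.) -/
structure IsWeakSolution {N : ℕ} (Ω : Set (EuclideanSpace ℝ (Fin N))) (p q ϑ : ℝ) (A B : ℝ → ℝ)
    (f u : EuclideanSpace ℝ (Fin N) → ℝ) : Prop where
  memW0 : MemW0 Ω p u (gradient u)
  pos : ∀ x ∈ Ω \ {0}, 0 < u x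
  weak : ∀ (φ : EuclideanSpace ℝ (Fin N) → ℝ)
    (G : EuclideanSpace ℝ (Fin N) → EuclideanSpace ℝ (Fin N)),
    MemW0 Ω p φ G → MemLp φ ⊤ (volume.restrict Ω) →
    (∫ x in Ω, A ‖gradient u x‖ * inner ℝ (gradient u x) (G x)) +
        ∫ x in Ω, B ‖gradient u x‖ * φ x =
      ϑ * (∫ x in Ω, u x ^ q / ‖x‖ ^ p * φ x) + ∫ x in Ω, f x * φ x

/-- The critical set `Z_u` of `u` in `Ω \ {0}`. -/
def critSet {N : ℕ} (Ω : Set (EuclideanSpace ℝ (Fin N))) (u : EuclideanSpace ℝ (Fin N) → ℝ) :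
    Set (EuclideanSpace ℝ (Fin N)) :=
  {x ∈ Ω \ {0} | gradient u x = 0}

/-- `u ∈ C^{1,a}_loc(Ω \ {0})` for some `a ∈ (0,1)`, and `u ∈ C²(Ω \ (Z_u ∪ {0}))`. -/
def HasSolutionRegularity {N : ℕ} (Ω : Set (EuclideanSpace ℝ (Fin N)))
    (u : EuclideanSpace ℝ (Fin N) → ℝ) : Prop :=
  ContDiffOn ℝ 1 u (Ω \ {0}) ∧
  (∃ a : ℝ≥0, 0 < a ∧ a < 1 ∧ ∀ K : Set (EuclideanSpace ℝ (Fin N)), IsCompact K → K ⊆ Ω \ {0} →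
    ∃ C : ℝ≥0, HolderOnWith C a (gradient u) K) ∧
  ContDiffOn ℝ 2 u (Ω \ (critSet Ω u ∪ {0}))

/-- All the data of the problem and a solution `u` of the required regularity, where the operator
has the structural constants `c₂`, `Chat`, `mA`, `MA` and the normalization `A 1 = a₁`. -/
structure IsRegularSolution (N : ℕ) (p c₂ Chat mA MA a₁ : ℝ) (A B : ℝ → ℝ) (q ϑ : ℝ)
    (Ω : Set (EuclideanSpace ℝ (Fin N))) (f u : EuclideanSpace ℝ (Fin N) → ℝ) : Prop where
  admissibleA : AdmissibleA N p c₂ mA MA A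
  normalization : A 1 = a₁
  admissibleB : AdmissibleB p Chat A B
  q_mem : q ∈ Ioo (p - 1) p
  ϑ_pos : 0 < ϑ
  domain : IsBoundedDomain Ω
  memW1Infty : MemW1Infty Ω f
  solution : IsWeakSolution Ω p q ϑ A B f u
  regular : HasSolutionRegularity Ω u

/-- The exponent `α`: `(p-1)/(p-2)` if `p > 2` and `(m_A+1)/m_A` if `1 < p < 2`. -/
noncomputable def weightExp (p mA : ℝ) : ℝ :=
  if 2 < p then (p - 1) / (p - 2) else (mA + 1) / mA

/-- The quantities through which the solution enters the constants, on a set `V`: `L` bounds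
`|∇u|`, and `c > 0` and `K` are a lower bound and a Lipschitz constant for `x ↦ h(x, u(x))`. -/
def BoundsOn {N : ℕ} (V : Set (EuclideanSpace ℝ (Fin N))) (p q ϑ : ℝ)
    (f u : EuclideanSpace ℝ (Fin N) → ℝ) (L c K : ℝ) : Prop :=
  0 < c ∧ (∀ x ∈ V, ‖gradient u x‖ ≤ L) ∧ (∀ x ∈ V, c ≤ rhs p q ϑ f x (u x)) ∧
  ∀ x ∈ V, ∀ z ∈ V, |rhs p q ϑ f x (u x) - rhs p q ϑ f z (u z)| ≤ K * ‖x - z‖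

/-- `S ⋐ T`: the closure of `S` is compact and contained in `T`. -/
def CompactlyIn {N : ℕ} (S T : Set (EuclideanSpace ℝ (Fin N))) : Prop :=
  IsCompact (closure S) ∧ closure S ⊆ T

/-- `∫_S A(|∇u|)^{-s} |x - y|^{-γ} dx`, as a value in `[0, ∞]`. -/
noncomputable def weightIntegral {N : ℕ} (S : Set (EuclideanSpace ℝ (Fin N))) (A : ℝ → ℝ)
    (u : EuclideanSpace ℝ (Fin N) → ℝ) (s γ : ℝ) (y : EuclideanSpace ℝ (Fin N)) : ℝ≥0∞ :=
  ∫⁻ x in S, ENNReal.ofReal (1 / A ‖gradient u x‖ ^ s * (1 / ‖x - y‖ ^ γ))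

/-! ### Weak divergence equations: test functions, differentiation of the equation, Lipschitz
right-hand sides. -/

section WeakDivergence

variable {E : Type*} [NormedAddCommGroup E] [InnerProductSpace ℝ E] [FiniteDimensional ℝ E]
  [MeasurableSpace E] [BorelSpace E]

/-! The whole argument is carried out for the stress field σ = A(|∇u|)∇u instead of u. It solves
-div σ + B(|∇u|) = h, is continuous away from the origin and C¹ where it does not vanish, and
A(|∇u|)^(-αr) ≤ C|σ|^(-r) (`AdmissibleA.exists_weight_le`). So it suffices to bound ∫
|σ|^(-r)|x-y|^(-γ).

Algebra: with X the Hessian of u and n the direction of ∇u, Dσ = a(X + κ n⊗Xn), where a = A(|∇u|)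
and κ = tA'/A lies in [m_A, M_A] with m_A > -1. Splitting X into blocks along n and orthogonal to n
shows that tr((Dσ)²) - r n·(Dσ)²n controls |Dσ|² when r < 1 (`stress_derivative_coercive`).

Second order estimate: testing the equation differentiated in direction b i against ψ|σ|^(-r)σ_i and
summing over i produces exactly this quadratic form, hence ∫ ψ|σ|^(-r)|Dσ|² ≤ C∫(ψ+Θ) whenever |∇ψ|²
≤ ψΘ (`IsStressField.second_order_estimate`). The term B is never differentiated: B ≤ C|σ| lets
Young's inequality absorb it. The Lipschitz bound on h handles the other source term.

Negative powers: testing the equation itself against ψ|σ|^(-r) and using h ≥ c > 0 gives c∫ψ|σ|^(-r)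
on the good side; the gradient term is at most of order ψ|σ|^(-r)|Dσ|, which Young's inequality
reduces to the second order estimate (`IsStressField.neg_power_estimate`).

Both tests need truncations near σ = 0, where σ may fail to be differentiable. Taking ψ =
η²|x-y|^(-γ), regularized at y, makes Θ of order |x-y|^(-γ-2), integrable since γ + 2 < N; for γ = 0
the singular part of Θ is absent. Fatou's lemma removes the regularizations and keeps the value ∞ on
{σ = 0}, so the critical set is null. Bounds L, c, K exist by compactness, once f in W^{1,∞} is
known to be locally Lipschitz. -/

/-- A function continuous on an open set and vanishing off a compact subset is integrable. -/
theorem continuous_of_eq_zero_off {X Y : Type*} [TopologicalSpace X] [TopologicalSpace Y] [Zero Y]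
    {W K : Set X} {f : X → Y} (hW : IsOpen W) (hf : ContinuousOn f W) (hK : IsClosed K)
    (hKW : K ⊆ W) (h0 : ∀ x ∉ K, f x = 0) : Continuous f := by
  refine hf.continuous_of_tsupport_subset hW (subset_trans ?_ hKW)
  refine closure_minimal (fun x hx => ?_) hK
  by_contra hxK
  exact hx (h0 x hxK)

theorem integrable_of_eq_zero_off {F : Type*} [NormedAddCommGroup F]
    {W K : Set E} {f : E → F} (hW : IsOpen W) (hf : ContinuousOn f W) (hK : IsCompact K)
    (hKW : K ⊆ W) (h0 : ∀ x ∉ K, f x = 0) : Integrable f := by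
  refine (continuous_of_eq_zero_off hW hf hK.isClosed hKW h0).integrable_of_hasCompactSupport ?_
  exact HasCompactSupport.intro hK h0

omit [FiniteDimensional ℝ E] [MeasurableSpace E] [BorelSpace E] in
theorem fderiv_eq_zero_of_notMem_tsupport {F : Type*} [NormedAddCommGroup F] [NormedSpace ℝ F]
    {φ : E → F} {x : E} (hx : x ∉ tsupport φ) : fderiv ℝ φ x = 0 := by
  by_contra h
  exact hx (support_fderiv_subset ℝ h)

/-- Compactly supported `C¹` functions are `C¹`-limits of test functions with supports in a fixed
compact set. -/
theorem exists_contDiff_approx {W : Set E} (hW : IsOpen W) {φ : E → ℝ} (hφ : ContDiff ℝ 1 φ)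
    (hc : HasCompactSupport φ) (hs : tsupport φ ⊆ W) :
    ∃ K : Set E, IsCompact K ∧ K ⊆ W ∧ tsupport φ ⊆ K ∧ ∀ ε > 0, ∃ ψ : E → ℝ, ContDiff ℝ ∞ ψ ∧
      tsupport ψ ⊆ K ∧
      (∀ x, |ψ x - φ x| ≤ ε) ∧ ∀ x, ‖fderiv ℝ ψ x - fderiv ℝ φ x‖ ≤ ε := by
  obtain ⟨δ, hδ, hδW⟩ := hc.isCompact.exists_cthickening_subset_open hW hs
  refine ⟨Metric.cthickening δ (tsupport φ), hc.isCompact.cthickening, hδW,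
    Metric.self_subset_cthickening _, fun ε hε => ?_⟩
  have hu0 : UniformContinuous φ := hφ.continuous.uniformContinuous_of_tendsto_cocompact
    (hc.is_zero_at_infty)
  have hD : Continuous (fderiv ℝ φ) := hφ.continuous_fderiv one_ne_zero
  have hu1 : UniformContinuous (fderiv ℝ φ) := hD.uniformContinuous_of_tendsto_cocompact
    ((hc.fderiv ℝ).is_zero_at_infty)
  obtain ⟨d0, hd0, h0⟩ := Metric.uniformContinuous_iff.1 hu0 ε hε
  obtain ⟨d1, hd1, h1⟩ := Metric.uniformContinuous_iff.1 hu1 ε hε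
  set R := min δ (min d0 d1) with hR
  have hRpos : 0 < R := lt_min hδ (lt_min hd0 hd1)
  let b : ContDiffBump (0 : E) := ⟨R / 2, R, by positivity, by linarith⟩
  have hbl : LocallyIntegrable (b.normed volume) (volume : Measure E) :=
    (b.continuous_normed (μ := (volume : Measure E))).locallyIntegrable
  let ψ : E → ℝ := convolution (b.normed volume) φ (ContinuousLinearMap.lsmul ℝ ℝ) volume
  -- The derivative is put on φ, so Dψ is the mollification of Dφ and inherits closeness from the
  -- uniform continuity of Dφ.
  have hder : ∀ x, HasFDerivAt ψ
      ((convolution (b.normed volume) (fderiv ℝ φ) (ContinuousLinearMap.lsmul ℝ ℝ) volume) x) x := by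
    intro x
    have := hc.hasFDerivAt_convolution_right (ContinuousLinearMap.lsmul ℝ ℝ) hbl hφ x
    refine this.congr_fderiv ?_
    simp only [convolution]
    refine integral_congr_ae (Eventually.of_forall fun t => ?_)
    ext v
    simp
  refine ⟨ψ, ?_, ?_, fun x => ?_, fun x => ?_⟩
  · exact b.hasCompactSupport_normed.contDiff_convolution_left _ b.contDiff_normed
      hφ.continuous.locallyIntegrable
  · refine closure_minimal ?_ Metric.isClosed_cthickening
    refine (support_convolution_subset _).trans ?_
    rintro _ ⟨y, hy, z, hz, rfl⟩
    rw [b.support_normed_eq] at hy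
    refine Metric.mem_cthickening_of_dist_le _ z _ _ (subset_tsupport _ hz) ?_
    have : ‖y‖ < R := by simpa using hy
    simpa using this.le.trans (min_le_left _ _)
  · have := b.dist_normed_convolution_le (μ := volume) (x₀ := x) (g := φ) (ε := ε)
      hφ.continuous.aestronglyMeasurable (fun y hy =>
        (h0 (lt_of_lt_of_le hy ((min_le_right _ _).trans (min_le_left _ _)))).le)
    simpa [Real.dist_eq] using this
  · rw [(hder x).fderiv, ← dist_eq_norm]
    exact b.dist_normed_convolution_le (μ := volume) (x₀ := x) (g := fderiv ℝ φ) (ε := ε)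
      hD.aestronglyMeasurable (fun y hy =>
        (h1 (lt_of_lt_of_le hy ((min_le_right _ _).trans (min_le_right _ _)))).le)

/-- `-div σ = g` in `W`, in the sense of distributions. -/
def IsWeakDivEq (W : Set E) (σ : E → E) (g : E → ℝ) : Prop :=
  ∀ φ : E → ℝ, ContDiff ℝ ∞ φ → HasCompactSupport φ → tsupport φ ⊆ W →
    ∫ x, fderiv ℝ φ x (σ x) = ∫ x, g x * φ x

theorem IsWeakDivEq.mono {W U : Set E} {σ : E → E} {g : E → ℝ} (h : IsWeakDivEq W σ g)
    (hU : U ⊆ W) : IsWeakDivEq U σ g :=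
  fun φ h1 h2 h3 => h φ h1 h2 (h3.trans hU)

/-- Identities which are continuous for the `C¹` topology pass from smooth to `C¹` test functions. -/
theorem integral_identity_of_contDiff_one {W : Set E} (hW : IsOpen W)
    {T : E → E} (hT : ContinuousOn T W) {k : E → ℝ} (hk : ContinuousOn k W)
    (h : ∀ φ : E → ℝ, ContDiff ℝ ∞ φ → HasCompactSupport φ → tsupport φ ⊆ W →
      ∫ x, fderiv ℝ φ x (T x) = ∫ x, k x * φ x)
    {φ : E → ℝ} (hφ : ContDiff ℝ 1 φ) (hc : HasCompactSupport φ) (hs : tsupport φ ⊆ W) :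
    ∫ x, fderiv ℝ φ x (T x) = ∫ x, k x * φ x := by
  obtain ⟨K, hK, hKW, hφK, happ⟩ := exists_contDiff_approx hW hφ hc hs
  have hI : ∀ ψ : E → ℝ, ContDiff ℝ 1 ψ → tsupport ψ ⊆ K →
      Integrable (fun x => fderiv ℝ ψ x (T x)) ∧ Integrable (fun x => k x * ψ x) := by
    intro ψ hψ hψK
    constructor
    · refine integrable_of_eq_zero_off hW ?_ hK hKW ?_
      · exact (hψ.continuous_fderiv one_ne_zero).continuousOn.clm_apply hT
      · intro x hx
        simp [fderiv_eq_zero_of_notMem_tsupport (fun h => hx (hψK h))]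
    · refine integrable_of_eq_zero_off hW (hk.mul hψ.continuous.continuousOn) hK hKW ?_
      intro x hx
      simp [image_eq_zero_of_notMem_tsupport (fun h => hx (hψK h))]
  have hTi : IntegrableOn (fun x => ‖T x‖) K := (hT.mono hKW).norm.integrableOn_compact hK
  have hki : IntegrableOn (fun x => |k x|) K := (hk.mono hKW).abs.integrableOn_compact hK
  set M := (∫ x in K, ‖T x‖) + ∫ x in K, |k x| with hM
  have hM0 : 0 ≤ M := add_nonneg (integral_nonneg fun _ => norm_nonneg _)
    (integral_nonneg fun _ => abs_nonneg _)
  have key : ∀ ε > 0, |(∫ x, fderiv ℝ φ x (T x)) - ∫ x, k x * φ x| ≤ ε * M := by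
    intro ε hε
    obtain ⟨ψ, hψ, hψK, h0, h1⟩ := happ ε hε
    have hψ1 : ContDiff ℝ 1 ψ := hψ.of_le (by exact_mod_cast le_top)
    have e := h ψ hψ (hK.of_isClosed_subset (isClosed_tsupport _) hψK) (hψK.trans hKW)
    obtain ⟨a1, a2⟩ := hI ψ hψ1 hψK
    obtain ⟨b1, b2⟩ := hI φ hφ hφK
    have e1 : |(∫ x, fderiv ℝ φ x (T x)) - ∫ x, fderiv ℝ ψ x (T x)| ≤ ε * ∫ x in K, ‖T x‖ := by
      rw [← integral_sub b1 a1, ← integral_const_mul, ← Real.norm_eq_abs]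
      rw [← setIntegral_eq_integral_of_forall_compl_eq_zero (s := K)]
      · refine norm_integral_le_of_norm_le (hTi.const_mul ε) (Eventually.of_forall fun x => ?_)
        rw [← sub_apply]
        refine (ContinuousLinearMap.le_opNorm _ _).trans ?_
        gcongr
        rw [norm_sub_rev]; exact h1 x
      · intro x hx
        simp [fderiv_eq_zero_of_notMem_tsupport (fun h => hx (hψK h)),
          fderiv_eq_zero_of_notMem_tsupport (fun h => hx (hφK h))]
    have e2 : |(∫ x, k x * φ x) - ∫ x, k x * ψ x| ≤ ε * ∫ x in K, |k x| := by
      rw [← integral_sub b2 a2, ← integral_const_mul, ← Real.norm_eq_abs]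
      rw [← setIntegral_eq_integral_of_forall_compl_eq_zero (s := K)]
      · refine norm_integral_le_of_norm_le (hki.const_mul ε) (Eventually.of_forall fun x => ?_)
        rw [← mul_sub, norm_mul, Real.norm_eq_abs, Real.norm_eq_abs, mul_comm]
        gcongr
        rw [abs_sub_comm]; exact h0 x
      · intro x hx
        simp [image_eq_zero_of_notMem_tsupport (fun h => hx (hψK h)),
          image_eq_zero_of_notMem_tsupport (fun h => hx (hφK h))]
    rw [hM, mul_add]
    rw [abs_le] at *
    constructor <;> linarith [e1.1, e1.2, e2.1, e2.2]
  have : |(∫ x, fderiv ℝ φ x (T x)) - ∫ x, k x * φ x| ≤ 0 := by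
    by_contra! hlt
    -- With this ε the error ε * M is at most half of the quantity being bounded; M + 1 avoids
    -- dividing by zero.
    have := key _ (show 0 < |(∫ x, fderiv ℝ φ x (T x)) - ∫ x, k x * φ x| / (2 * (M + 1)) by
      positivity)
    rw [div_mul_eq_mul_div, le_div_iff₀ (by positivity)] at this
    nlinarith
  exact sub_eq_zero.1 (abs_nonpos_iff.1 this)

theorem IsWeakDivEq.contDiff_one {W : Set E} (hW : IsOpen W) {σ : E → E} {g : E → ℝ}
    (hσ : ContinuousOn σ W) (hg : ContinuousOn g W) (h : IsWeakDivEq W σ g)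
    {φ : E → ℝ} (hφ : ContDiff ℝ 1 φ) (hc : HasCompactSupport φ) (hs : tsupport φ ⊆ W) :
    ∫ x, fderiv ℝ φ x (σ x) = ∫ x, g x * φ x :=
  integral_identity_of_contDiff_one hW hσ hg h hφ hc hs

theorem integral_fderiv_apply_eq_zero {k : E → ℝ} (hk : ContDiff ℝ 1 k) (hc : HasCompactSupport k)
    (e : E) : ∫ x, fderiv ℝ k x e = 0 := by
  have h1 : Integrable (fun x => fderiv ℝ k x e) := by
    refine Continuous.integrable_of_hasCompactSupport ?_ (hc.fderiv_apply ℝ e)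
    exact (hk.continuous_fderiv one_ne_zero).clm_apply continuous_const
  have := integral_mul_fderiv_eq_neg_fderiv_mul_of_integrable (μ := (volume : Measure E))
    (f := fun _ => (1 : ℝ)) (g := k) (v := e) (by simp) (by simpa using h1)
    (by simpa using hk.continuous.integrable_of_hasCompactSupport hc)
    (fun _ _ => differentiableAt_const _) (fun x _ => hk.differentiable one_ne_zero x)
  simpa using this

/-- Use ∂ₑφ as a test function. The function Dφ(σ) is C¹ with compact support, so its derivative
along e integrates to zero; expanding it and using symmetry of D²φ moves the derivative from φ to σ.
No second derivative of σ and no derivative of g is needed. -/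
theorem IsWeakDivEq.differentiated {U : Set E} (hU : IsOpen U) {σ : E → E} {g : E → ℝ}
    (hσ : ContDiffOn ℝ 1 σ U) (hg : ContinuousOn g U) (h : IsWeakDivEq U σ g) (e : E)
    {φ : E → ℝ} (hφ : ContDiff ℝ 1 φ) (hc : HasCompactSupport φ) (hs : tsupport φ ⊆ U) :
    ∫ x, fderiv ℝ φ x (fderiv ℝ σ x e + g x • e) = 0 := by
  have hDσ : ContinuousOn (fun x => fderiv ℝ σ x e) U :=
    (hσ.continuousOn_fderiv_of_isOpen hU le_rfl).clm_apply continuousOn_const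
  have hge : ContinuousOn (fun x => g x • e) U := hg.smul continuousOn_const
  have := integral_identity_of_contDiff_one hU (T := fun x => fderiv ℝ σ x e + g x • e)
    (hDσ.add hge) (k := fun _ => 0) continuousOn_const ?_ hφ hc hs
  · simpa using this
  clear hφ hc hs φ
  intro φ hφ hc hs
  have hD : ContDiff ℝ ∞ (fderiv ℝ φ) := hφ.fderiv_right (by simp)
  have hDe : ContDiff ℝ ∞ (fun x => fderiv ℝ φ x e) := hD.clm_apply contDiff_const
  have hφe : tsupport (fun x => fderiv ℝ φ x e) ⊆ tsupport φ := by
    refine closure_minimal (fun x hx => ?_) (isClosed_tsupport _)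
    by_contra hxn
    exact hx (by simp [fderiv_eq_zero_of_notMem_tsupport hxn])
  have hweak := h _ hDe (hc.fderiv_apply ℝ e) (hφe.trans hs)
  have hoff : ∀ x ∉ tsupport φ, fderiv ℝ (fderiv ℝ φ) x = 0 := fun x hx =>
    fderiv_eq_zero_of_notMem_tsupport (fun hx' => hx (tsupport_fderiv_subset ℝ hx'))
  have hk1 : ContDiff ℝ 1 (fun x => fderiv ℝ φ x (σ x)) := by
    rw [contDiff_iff_contDiffAt]
    intro x
    by_cases hx : x ∈ U
    · exact ((hD.of_le (by exact_mod_cast le_top)).contDiffAt).clm_apply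
        (hσ.contDiffAt (hU.mem_nhds hx))
    · have : (fun x => fderiv ℝ φ x (σ x)) =ᶠ[𝓝 x] fun _ => 0 := by
        have : (tsupport φ)ᶜ ∈ 𝓝 x := (isClosed_tsupport _).isOpen_compl.mem_nhds
          (fun h' => hx (hs h'))
        filter_upwards [this] with y hy
        simp [fderiv_eq_zero_of_notMem_tsupport hy]
      exact contDiffAt_const.congr_of_eventuallyEq this
  have hk2 : HasCompactSupport (fun x => fderiv ℝ φ x (σ x)) := by
    refine HasCompactSupport.intro hc.isCompact fun x hx => ?_
    simp [fderiv_eq_zero_of_notMem_tsupport hx]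
  have hzero := integral_fderiv_apply_eq_zero hk1 hk2 e
  have hpt : ∀ x, fderiv ℝ (fun x => fderiv ℝ φ x (σ x)) x e =
      fderiv ℝ (fun x => fderiv ℝ φ x e) x (σ x) + fderiv ℝ φ x (fderiv ℝ σ x e) := by
    intro x
    have hDd : DifferentiableAt ℝ (fderiv ℝ φ) x := hD.differentiable (by simp) x
    have h2 : fderiv ℝ (fun x => fderiv ℝ φ x e) x (σ x) = fderiv ℝ (fderiv ℝ φ) x (σ x) e := by
      rw [fderiv_clm_apply hDd (differentiableAt_const _)]
      simp
    rw [h2]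
    by_cases hx : x ∈ U
    · have hσd : DifferentiableAt ℝ σ x :=
        (hσ.contDiffAt (hU.mem_nhds hx)).differentiableAt one_ne_zero
      rw [fderiv_clm_apply hDd hσd]
      have hsymm : IsSymmSndFDerivAt ℝ φ x :=
        hφ.contDiffAt.isSymmSndFDerivAt (by
          rw [minSmoothness_of_isRCLikeNormedField]
          exact ENat.LEInfty.out)
      simp [hsymm.eq (σ x) e, add_comm]
    · have hx' : x ∉ tsupport φ := fun h' => hx (hs h')
      have hx2 : x ∉ tsupport (fun x => fderiv ℝ φ x (σ x)) := by
        intro h'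
        refine hx' (closure_minimal (fun y hy => ?_) (isClosed_tsupport _) h')
        by_contra hyn
        exact hy (by simp [fderiv_eq_zero_of_notMem_tsupport hyn])
      simp [hoff x hx', fderiv_eq_zero_of_notMem_tsupport hx',
        fderiv_eq_zero_of_notMem_tsupport hx2]
  have i1 : Integrable (fun x => fderiv ℝ (fun x => fderiv ℝ φ x e) x (σ x)) := by
    refine integrable_of_eq_zero_off hU ?_ hc.isCompact hs ?_
    · exact (hDe.continuous_fderiv (by simp)).continuousOn.clm_apply hσ.continuousOn
    · intro x hx
      simp [fderiv_eq_zero_of_notMem_tsupport (fun h => hx (hφe h))]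
  have i2 : Integrable (fun x => fderiv ℝ φ x (fderiv ℝ σ x e)) := by
    refine integrable_of_eq_zero_off hU ?_ hc.isCompact hs ?_
    · exact (hφ.continuous_fderiv (by simp)).continuousOn.clm_apply hDσ
    · intro x hx
      simp [fderiv_eq_zero_of_notMem_tsupport hx]
  have i3 : Integrable (fun x => fderiv ℝ φ x (g x • e)) := by
    refine integrable_of_eq_zero_off hU ?_ hc.isCompact hs ?_
    · exact (hφ.continuous_fderiv (by simp)).continuousOn.clm_apply hge
    · intro x hx
      simp [fderiv_eq_zero_of_notMem_tsupport hx]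
  simp_rw [hpt] at hzero
  rw [integral_add i1 i2, hweak] at hzero
  simp only [map_add, zero_mul, integral_zero]
  rw [integral_add i2 i3]
  simp only [map_smul, smul_eq_mul]
  linarith

/-- Integration by parts against a function which is Lipschitz on an open set. -/
theorem abs_integral_mul_fderiv_le {V : Set E} {h : E → ℝ} {K : ℝ}
    (hh : ∀ x ∈ V, ∀ z ∈ V, |h x - h z| ≤ K * ‖x - z‖) (hK : 0 ≤ K)
    {φ : E → ℝ} (hφ : ContDiff ℝ 1 φ) (hc : HasCompactSupport φ) (hs : tsupport φ ⊆ V) (e : E) :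
    |∫ x, h x * fderiv ℝ φ x e| ≤ K * ‖e‖ * ∫ x, |φ x| := by
  have hL : LipschitzOnWith ⟨K, hK⟩ h V := LipschitzOnWith.of_dist_le_mul fun x hx z hz => by
    rw [Real.dist_eq, dist_eq_norm]; exact hh x hx z hz
  -- Only the values of h on V enter, so h may be replaced by a globally Lipschitz extension with
  -- the same constant, whose line derivatives exist almost everywhere.
  obtain ⟨k, hk, hkV⟩ := hL.extend_real
  obtain ⟨D, hD⟩ := hφ.lipschitzWith_of_hasCompactSupport hc one_ne_zero
  have e1 : ∫ x, h x * fderiv ℝ φ x e = ∫ x, lineDeriv ℝ φ x (-(-e)) * k x := by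
    refine integral_congr_ae (Eventually.of_forall fun x => ?_)
    have hd : DifferentiableAt ℝ φ x := hφ.differentiable one_ne_zero x
    simp only [neg_neg]
    rw [hd.lineDeriv_eq_fderiv, mul_comm]
    by_cases hx : x ∈ tsupport φ
    · rw [hkV (hs hx)]
    · simp [fderiv_eq_zero_of_notMem_tsupport hx]
  rw [e1, ← hk.integral_lineDeriv_mul_eq hD hc, ← Real.norm_eq_abs, ← integral_const_mul]
  refine norm_integral_le_of_norm_le ?_ (Eventually.of_forall fun x => ?_)
  · exact (hφ.continuous.integrable_of_hasCompactSupport hc).abs.const_mul _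
  · rw [norm_mul, Real.norm_eq_abs (φ x)]
    gcongr
    have := norm_lineDeriv_le_of_lipschitz ℝ hk (x₀ := x) (v := -e)
    rw [norm_neg] at this
    exact this

end WeakDivergence

/-! ### Truncations of the powers of |σ| near σ = 0. -/

section Truncation

/-- The ratio `(s - ε)₊ / s`. -/
noncomputable def truncRatio (ε s : ℝ) : ℝ := max (s - ε) 0 / s

/-- A truncation of `s ^ (-r)` which vanishes for `s ≤ ε`. -/
noncomputable def truncPow (r ε s : ℝ) : ℝ := s ^ (-r) * truncRatio ε s ^ 2

/-- A regularization of `s` which is constant for `s ≤ ε`. -/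
noncomputable def regAbs (ε s : ℝ) : ℝ := ε + s * truncRatio ε s ^ 2

theorem truncRatio_nonneg {ε s : ℝ} (hs : 0 ≤ s) : 0 ≤ truncRatio ε s :=
  div_nonneg (le_max_right _ _) hs

theorem truncRatio_le_one {ε s : ℝ} (hε : 0 < ε) (hs : 0 ≤ s) : truncRatio ε s ≤ 1 :=
  div_le_one_of_le₀ (max_le (by linarith) hs) hs

theorem truncRatio_eq_zero {ε s : ℝ} (hs : s ≤ ε) : truncRatio ε s = 0 := by
  simp [truncRatio, max_eq_right (sub_nonpos.2 hs)]

theorem truncPow_eq_zero {r ε s : ℝ} (hs : s ≤ ε) : truncPow r ε s = 0 := by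
  simp [truncPow, truncRatio_eq_zero hs]

theorem regAbs_eq {ε s : ℝ} (hs : s ≤ ε) : regAbs ε s = ε := by
  simp [regAbs, truncRatio_eq_zero hs]

theorem truncPow_nonneg {r ε s : ℝ} (hs : 0 ≤ s) : 0 ≤ truncPow r ε s := by
  unfold truncPow; positivity

theorem le_regAbs {ε s : ℝ} (hs : 0 ≤ s) : ε ≤ regAbs ε s := by
  unfold regAbs; nlinarith [mul_nonneg hs (sq_nonneg (truncRatio ε s))]

/-- For s > ε the difference is ((s-ε)² + ε²)/(2s). This lower bound makes negative powers of the
regularization comparable to those of s, uniformly in ε. -/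
theorem half_le_regAbs {ε s : ℝ} (hε : 0 < ε) : s / 2 ≤ regAbs ε s := by
  rcases le_or_gt s ε with h | h
  · rw [regAbs_eq h]; linarith
  · have hs : 0 < s := hε.trans h
    unfold regAbs truncRatio
    rw [max_eq_left (by linarith), div_pow, ← sub_nonneg]
    have : ε + s * ((s - ε) ^ 2 / s ^ 2) - s / 2 = ((s - ε) ^ 2 + ε ^ 2) / (2 * s) := by
      field_simp; ring
    rw [this]; positivity

/-- Squaring smooths the kink of the positive part; this is why the truncation ratio enters both
truncations squared. -/
theorem hasDerivAt_max_sq (x : ℝ) :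
    HasDerivAt (fun y : ℝ => max y 0 ^ 2) (2 * max x 0) x := by
  rcases lt_trichotomy x 0 with h | h | h
  · rw [max_eq_right h.le]
    refine ((hasDerivAt_const x (0 : ℝ)).congr_of_eventuallyEq ?_).congr_deriv (by simp)
    filter_upwards [Iio_mem_nhds h] with y hy
    simp [max_eq_right (le_of_lt (mem_Iio.1 hy))]
  · subst h
    rw [hasDerivAt_iff_isLittleO]
    simp only [max_self, sub_zero]
    refine Asymptotics.IsBigO.trans_isLittleO (g := fun y : ℝ => y ^ 2) ?_ ?_
    · refine Asymptotics.isBigO_of_le _ fun y => ?_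
      have : max y 0 ^ 2 ≤ y ^ 2 := by
        rcases le_total y 0 with h | h <;> simp [h, sq_nonneg]
      simpa [abs_of_nonneg] using this
    · exact Asymptotics.isLittleO_pow_id one_lt_two
  · rw [max_eq_left h.le]
    refine ((hasDerivAt_pow 2 x).congr_of_eventuallyEq ?_).congr_deriv (by simp)
    filter_upwards [Ioi_mem_nhds h] with y hy
    simp [max_eq_left (le_of_lt (mem_Ioi.1 hy))]

theorem contDiff_max_sq : ContDiff ℝ 1 (fun y : ℝ => max y 0 ^ 2) := by
  rw [contDiff_one_iff_deriv]
  refine ⟨fun x => (hasDerivAt_max_sq x).differentiableAt, ?_⟩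
  have : deriv (fun y : ℝ => max y 0 ^ 2) = fun x => 2 * max x 0 :=
    funext fun x => (hasDerivAt_max_sq x).deriv
  rw [this]; fun_prop

theorem truncRatio_sq (ε s : ℝ) : truncRatio ε s ^ 2 = max (s - ε) 0 ^ 2 / s ^ 2 := by
  rw [truncRatio, div_pow]

theorem contDiffAt_truncRatio_sq {ε s : ℝ} (hs : s ≠ 0) :
    ContDiffAt ℝ 1 (fun s => truncRatio ε s ^ 2) s := by
  simp_rw [truncRatio_sq]
  have h1 : ContDiff ℝ 1 (fun s : ℝ => max (s - ε) 0 ^ 2) :=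
    contDiff_max_sq.comp (contDiff_id.sub contDiff_const)
  exact h1.contDiffAt.div (contDiffAt_id.pow 2) (pow_ne_zero 2 hs)

theorem contDiffAt_truncPow {r ε s : ℝ} (hs : s ≠ 0) : ContDiffAt ℝ 1 (truncPow r ε) s :=
  (Real.contDiffAt_rpow_const_of_ne hs).mul (contDiffAt_truncRatio_sq hs)

theorem contDiffAt_regAbs {ε s : ℝ} (hs : s ≠ 0) : ContDiffAt ℝ 1 (regAbs ε) s :=
  contDiffAt_const.add (contDiffAt_id.mul (contDiffAt_truncRatio_sq hs))

theorem hasDerivAt_truncRatio_sq {ε s : ℝ} (hs : 0 < s) :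
    HasDerivAt (fun s => truncRatio ε s ^ 2)
      ((2 * truncRatio ε s - 2 * truncRatio ε s ^ 2) / s) s := by
  simp_rw [truncRatio_sq]
  have h1 : HasDerivAt (fun s : ℝ => max (s - ε) 0 ^ 2) (2 * max (s - ε) 0) s := by
    exact ((hasDerivAt_max_sq (s - ε)).comp s ((hasDerivAt_id s).sub_const ε)).congr_deriv
      (mul_one _)
  refine (h1.div (hasDerivAt_pow 2 s) (by positivity)).congr_deriv ?_
  unfold truncRatio
  field_simp
  ring

theorem hasDerivAt_truncPow {r ε s : ℝ} (hs : 0 < s) :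
    HasDerivAt (truncPow r ε)
      (s ^ (-r) * (2 * truncRatio ε s - (r + 2) * truncRatio ε s ^ 2) / s) s := by
  have h1 := Real.hasDerivAt_rpow_const (x := s) (p := -r) (Or.inl hs.ne')
  refine (h1.mul (hasDerivAt_truncRatio_sq (ε := ε) hs)).congr_deriv ?_
  rw [Real.rpow_sub_one hs.ne']
  field_simp
  ring

/-- The derivative carries a factor v = `truncRatio ε s`. After Young's inequality it becomes the v²
present in `truncPow`, so the two truncations are compatible. -/
theorem hasDerivAt_regAbs {ε s : ℝ} (hs : 0 < s) :
    HasDerivAt (regAbs ε) (2 * truncRatio ε s - truncRatio ε s ^ 2) s := by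
  refine (((hasDerivAt_id s).mul (hasDerivAt_truncRatio_sq (ε := ε) hs)).const_add
    ε).congr_deriv ?_
  simp only [id]
  field_simp
  ring

theorem hasDerivAt_regAbs_rpow {r ε s : ℝ} (hε : 0 < ε) (hs : 0 < s) :
    HasDerivAt (fun s => regAbs ε s ^ (-r))
      (-r * regAbs ε s ^ (-r) * (2 * truncRatio ε s - truncRatio ε s ^ 2) / regAbs ε s) s := by
  have hS : 0 < regAbs ε s := hε.trans_le (le_regAbs hs.le)
  refine ((hasDerivAt_regAbs (ε := ε) hs).rpow_const (p := -r) (Or.inl hS.ne')).congr_deriv ?_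
  rw [Real.rpow_sub_one hS.ne']
  field_simp

theorem regAbs_rpow_le {r ε s : ℝ} (hr0 : 0 < r) (hr1 : r < 1) (hε : 0 < ε) (hs : 0 < s) :
    regAbs ε s ^ (-r) ≤ 2 * s ^ (-r) := by
  calc regAbs ε s ^ (-r) ≤ (s / 2) ^ (-r) :=
        Real.rpow_le_rpow_of_nonpos (by positivity) (half_le_regAbs hε) (by linarith)
    _ = 2 ^ r * s ^ (-r) := by
        rw [Real.div_rpow hs.le (by norm_num), Real.rpow_neg (by norm_num : (0:ℝ) ≤ 2)]
        field_simp
    _ ≤ 2 * s ^ (-r) := by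
        gcongr
        calc (2 : ℝ) ^ r ≤ 2 ^ (1 : ℝ) := Real.rpow_le_rpow_of_exponent_le (by norm_num) hr1.le
          _ = 2 := Real.rpow_one 2

end Truncation

/-! ### The pointwise Young inequalities. -/

section PointwiseInequalities

/-- The pointwise lower bound behind the second order estimate. -/
theorem second_order_pointwise {r c₀ c₁ M M' n ψ Θ G s v a B τ d t t₂ y g₁ g₂ z : ℝ}
    (hr0 : 0 < r) (hr1 : r < 1) (hc₀ : 0 < c₀) (hc₁ : 0 < c₁) (hn : 0 ≤ n)
    (hψ : 0 ≤ ψ) (hΘ : 0 ≤ Θ) (hG : 0 ≤ G) (hGψ : G ^ 2 ≤ ψ * Θ) (hs : 0 ≤ s)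
    (hv0 : 0 ≤ v) (hv1 : v ≤ 1) (ha : 0 ≤ a) (hB : 0 ≤ B)
    (hdτ : d ≤ τ) (h1 : c₀ * τ ^ 2 ≤ t₂ - r * y) (h2 : c₁ * d ^ 2 ≤ y)
    (ht : |t| ≤ n * τ) (hg₁ : |g₁| ≤ G * τ) (hg₂ : |g₂| ≤ G) (hz : |z| ≤ d)
    (hM : a * s ^ 2 ≤ M) (hM' : a * B ^ 2 ≤ M') :
    c₀ / 2 * (ψ * (a * v ^ 2) * τ ^ 2)
        - (M * (1 / c₀ + 1) + M' * ((n + 1) ^ 2 / c₀ + 1 / c₁ + 1)) * (ψ + Θ) ≤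
      (ψ * (a * v ^ 2) * t₂ + ψ * (a * (2 * v - (r + 2) * v ^ 2)) * y + a * v ^ 2 * s * g₁)
        - B * (ψ * (a * v ^ 2) * t + a * v ^ 2 * s * g₂
          + ψ * (a * (2 * v - (r + 2) * v ^ 2)) * z) := by
  have hv2 : v ^ 2 ≤ 1 := pow_le_one₀ hv0 hv1
  have hq0 : 0 ≤ a * v ^ 2 := by positivity
  have hqa : a * v ^ 2 ≤ a := mul_le_of_le_one_right ha hv2
  set q := a * v ^ 2 with hq
  set e := a * (2 * v * (1 - v)) with he
  have he0 : 0 ≤ e := by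
    have : 0 ≤ 1 - v := by linarith
    positivity
  have hea : e ≤ a := by
    have : 2 * v * (1 - v) ≤ 1 := by nlinarith only [sq_nonneg (v - 1 / 2)]
    exact mul_le_of_le_one_right ha this
  -- Splits s times the derivative of the truncated power into -rq, as for the pure power, and the
  -- cutoff error e ≥ 0. As e is only linear in v near v = 0, terms with e cannot be absorbed by
  -- qτ²; they are absorbed by e·y, using c₁d² ≤ y.
  have hqe : a * (2 * v - (r + 2) * v ^ 2) = -r * q + e := by rw [hq, he]; ring
  have hM0 : 0 ≤ M := le_trans (by positivity) hM
  have hM0' : 0 ≤ M' := le_trans (by positivity) hM'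
  have hqs : q * s ^ 2 ≤ M := le_trans (by gcongr) hM
  have hqB : q * B ^ 2 ≤ M' := le_trans (by gcongr) hM'
  have heB : e * B ^ 2 ≤ M' := le_trans (by gcongr) hM'
  have hd0 : 0 ≤ d := (abs_nonneg _).trans hz
  rw [hqe]
  -- the two coercive terms
  have i1 : ψ * q * (c₀ * τ ^ 2) ≤ ψ * q * (t₂ - r * y) := by gcongr
  have i2 : ψ * e * (c₁ * d ^ 2) ≤ ψ * e * y := by gcongr
  -- the error terms
  have i3 : -(c₀ / 4 * (ψ * q * τ ^ 2) + M / c₀ * Θ) ≤ q * s * g₁ := by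
    have h := (abs_le.1 hg₁).1
    have h3 : q * s * (G * τ) ≤ c₀ / 4 * (ψ * q * τ ^ 2) + M / c₀ * Θ := by
      have k1 : q * (s ^ 2 * G ^ 2) ≤ M * (ψ * Θ) := by
        calc q * (s ^ 2 * G ^ 2) = (q * s ^ 2) * G ^ 2 := by ring
          _ ≤ M * (ψ * Θ) := by gcongr
      -- Young's inequality divides by ψ; where ψ = 0, the bound G² ≤ ψΘ forces G = 0.
      rcases hψ.eq_or_lt with h0 | h0
      · have : G = 0 := by
          have : G ^ 2 ≤ 0 := by rw [← h0] at hGψ; simpa using hGψ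
          nlinarith only [this, hG]
        rw [this, ← h0]
        have : 0 ≤ M / c₀ * Θ := by positivity
        simpa using this
      · have k2 : q * s * (G * τ) ≤ c₀ / 4 * (ψ * q * τ ^ 2) + q * (s ^ 2 * G ^ 2) / (c₀ * ψ) := by
          have : c₀ / 4 * (ψ * q * τ ^ 2) + q * (s ^ 2 * G ^ 2) / (c₀ * ψ) - q * s * (G * τ)
              = q * (c₀ * ψ * τ / 2 - s * G) ^ 2 / (c₀ * ψ) := by
            field_simp; ring
          have h' : 0 ≤ q * (c₀ * ψ * τ / 2 - s * G) ^ 2 / (c₀ * ψ) := by positivity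
          linarith only [this, h']
        have k3 : q * (s ^ 2 * G ^ 2) / (c₀ * ψ) ≤ M / c₀ * Θ := by
          rw [div_le_iff₀ (by positivity)]
          calc _ ≤ _ := k1
            _ = _ := by field_simp
        linarith only [k2, k3]
    have h4 : q * s * (-(G * τ)) ≤ q * s * g₁ := by gcongr
    linarith only [h3, h4]
  have i4 : B * (ψ * q * t + ψ * (-r * q) * z)
      ≤ c₀ / 4 * (ψ * q * τ ^ 2) + M' * ((n + 1) ^ 2 / c₀) * ψ := by
    have k1 : t + -r * z ≤ (n + 1) * τ := by
      have := (abs_le.1 ht).2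
      have h' := abs_le.1 hz
      have h5 : r * -z ≤ 1 * d := (mul_le_mul_of_nonneg_left (by linarith only [h'.1] : -z ≤ d) hr0.le).trans
        (mul_le_mul_of_nonneg_right hr1.le hd0)
      linarith only [this, h5, hdτ]
    have k2 : B * (ψ * q * t + ψ * (-r * q) * z) ≤ ψ * (q * B * ((n + 1) * τ)) := by
      calc _ = ψ * (q * B * (t + -r * z)) := by ring
        _ ≤ _ := by gcongr
    have k3 : q * B * ((n + 1) * τ) ≤ c₀ / 4 * (q * τ ^ 2) + (q * B ^ 2) * ((n + 1) ^ 2 / c₀) := by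
      have : c₀ / 4 * (q * τ ^ 2) + (q * B ^ 2) * ((n + 1) ^ 2 / c₀) - q * B * ((n + 1) * τ)
          = q * (c₀ * τ / 2 - B * (n + 1)) ^ 2 / c₀ := by
        field_simp; ring
      have h' : 0 ≤ q * (c₀ * τ / 2 - B * (n + 1)) ^ 2 / c₀ := by positivity
      linarith only [this, h']
    have k4 : (q * B ^ 2) * ((n + 1) ^ 2 / c₀) ≤ M' * ((n + 1) ^ 2 / c₀) := by gcongr
    calc _ ≤ _ := k2
      _ ≤ ψ * (c₀ / 4 * (q * τ ^ 2) + M' * ((n + 1) ^ 2 / c₀)) := by gcongr; linarith only [k3, k4]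
      _ = _ := by ring
  have i5 : B * (q * s * g₂) ≤ M' * ψ + M * Θ := by
    have k1 : B * (q * s * g₂) ≤ q * B * s * G := by
      calc B * (q * s * g₂) = q * B * s * g₂ := by ring
        _ ≤ _ := by gcongr; exact (abs_le.1 hg₂).2
    have k2 : (q * B * s * G) ≤ M' * ψ + M * Θ := by
      refine abs_le_of_sq_le_sq' ?_ (by positivity) |>.2
      calc (q * B * s * G) ^ 2 = (q * B ^ 2) * (q * s ^ 2) * G ^ 2 := by ring
        _ ≤ M' * M * (ψ * Θ) := by gcongr
        _ ≤ (M' * ψ + M * Θ) ^ 2 := by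
          have : (M' * ψ + M * Θ) ^ 2 - M' * M * (ψ * Θ)
              = (M' * ψ) ^ 2 + (M * Θ) ^ 2 + M' * M * (ψ * Θ) := by ring
          have h' : 0 ≤ (M' * ψ) ^ 2 + (M * Θ) ^ 2 + M' * M * (ψ * Θ) := by positivity
          linarith only [this, h']
    linarith only [k1, k2]
  have i6 : B * (ψ * e * z) ≤ ψ * e * (c₁ * d ^ 2) + M' / c₁ * ψ := by
    have k1 : B * (ψ * e * z) ≤ ψ * (e * B * d) := by
      calc B * (ψ * e * z) = ψ * (e * B * z) := by ring
        _ ≤ _ := by gcongr; exact (abs_le.1 hz).2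
    have k2 : e * B * d ≤ e * (c₁ * d ^ 2) + e * B ^ 2 / c₁ := by
      have : e * (c₁ * d ^ 2) + e * B ^ 2 / c₁ - e * B * d
          = e * ((c₁ * d - B / 2) ^ 2 + 3 / 4 * B ^ 2) / c₁ := by
        field_simp; ring
      have h' : 0 ≤ e * ((c₁ * d - B / 2) ^ 2 + 3 / 4 * B ^ 2) / c₁ := by positivity
      linarith only [this, h']
    have k3 : e * B ^ 2 / c₁ ≤ M' / c₁ := by gcongr
    calc _ ≤ _ := k1
      _ ≤ ψ * (e * (c₁ * d ^ 2) + M' / c₁) := by gcongr; linarith only [k2, k3]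
      _ = _ := by ring
  -- The errors `i3` and `i4` each use a quarter of c₀, leaving c₀/2. The nonnegative terms here and
  -- below only fill the constant up to a common multiple of ψ + Θ.
  have i7 : 0 ≤ M * ψ * (1 / c₀ + 1) := by positivity
  have i8 : 0 ≤ M' * Θ * ((n + 1) ^ 2 / c₀ + 1 / c₁ + 1) := by positivity
  have e1 : M / c₀ * Θ = M * Θ * (1 / c₀) := by ring
  have e2 : M' / c₁ * ψ = M' * ψ * (1 / c₁) := by ring
  rw [e1] at i3
  rw [e2] at i6
  linarith only [i1, i2, i3, i4, i5, i6, i7, i8]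

end PointwiseInequalities

/-! ### Integral estimates for an abstract stress field. -/

section StressField

variable {E : Type*} [NormedAddCommGroup E] [InnerProductSpace ℝ E] [FiniteDimensional ℝ E]
  [MeasurableSpace E] [BorelSpace E] {ι : Type*} [Fintype ι]

/-- The direction `σ / |σ|` of a vector field. -/
noncomputable def unitDir (σ : E → E) (x : E) : E := ‖σ x‖⁻¹ • σ x

/-- A vector field `σ` on `V` with `-div σ + B = h`, whose derivative satisfies the coercivity
inequalities which make weighted second order estimates possible. -/
structure IsStressField (V : Set E) (b : OrthonormalBasis ι ℝ E) (r c₀ b₀ m c K : ℝ)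
    (σ : E → E) (B h : E → ℝ) : Prop where
  isOpen : IsOpen V
  continuousOn : ContinuousOn σ V
  contDiffOn : ContDiffOn ℝ 1 σ {x ∈ V | σ x ≠ 0}
  coercive : ∀ x ∈ V, σ x ≠ 0 → c₀ * ‖fderiv ℝ σ x‖ ^ 2 ≤
    ∑ i, inner ℝ (b i) (fderiv ℝ σ x (fderiv ℝ σ x (b i)))
      - r * inner ℝ (unitDir σ x) (fderiv ℝ σ x (fderiv ℝ σ x (unitDir σ x)))
  normal : ∀ x ∈ V, σ x ≠ 0 → inner ℝ (unitDir σ x) (fderiv ℝ σ x (unitDir σ x)) ^ 2 ≤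
    inner ℝ (unitDir σ x) (fderiv ℝ σ x (fderiv ℝ σ x (unitDir σ x)))
  norm_le : ∀ x ∈ V, ‖σ x‖ ≤ m
  continuousOn_B : ContinuousOn B V
  B_nonneg : ∀ x ∈ V, 0 ≤ B x
  B_le : ∀ x ∈ V, B x ≤ b₀ * ‖σ x‖
  continuousOn_h : ContinuousOn h V
  le_h : ∀ x ∈ V, c ≤ h x
  h_lipschitz : ∀ x ∈ V, ∀ z ∈ V, |h x - h z| ≤ K * ‖x - z‖
  weak : IsWeakDivEq V σ (fun x => h x - B x)

/-- `ψ ≥ 0` is a compactly supported `C¹` cutoff in `V` with `|∇ψ|² ≤ ψ Θ`. -/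
structure IsCutoff (V : Set E) (ψ Θ : E → ℝ) : Prop where
  contDiff : ContDiff ℝ 1 ψ
  compact : HasCompactSupport ψ
  subset : tsupport ψ ⊆ V
  nonneg : ∀ x, 0 ≤ ψ x
  nonneg' : ∀ x, 0 ≤ Θ x
  integrable : Integrable Θ
  sq_le : ∀ x, ‖fderiv ℝ ψ x‖ ^ 2 ≤ ψ x * Θ x

omit [FiniteDimensional ℝ E] [MeasurableSpace E] [BorelSpace E] in
theorem hasFDerivAt_norm_comp {σ : E → E} {x : E} (hσ : DifferentiableAt ℝ σ x) (h0 : σ x ≠ 0) :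
    HasFDerivAt (fun y => ‖σ y‖) ((innerSL ℝ (unitDir σ x)).comp (fderiv ℝ σ x)) x := by
  have h1 := (hσ.hasFDerivAt.norm_sq).sqrt (by positivity)
  have h2 : (fun y => √(‖σ y‖ ^ 2)) = fun y => ‖σ y‖ := by
    funext y; exact Real.sqrt_sq (norm_nonneg _)
  rw [h2] at h1
  refine h1.congr_fderiv ?_
  ext v
  have h3 : ‖σ x‖ ≠ 0 := norm_ne_zero_iff.2 h0
  simp [unitDir, Real.sqrt_sq (norm_nonneg _)]
  field_simp

omit [FiniteDimensional ℝ E] [MeasurableSpace E] [BorelSpace E] in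
theorem norm_unitDir {σ : E → E} {x : E} (h0 : σ x ≠ 0) : ‖unitDir σ x‖ = 1 := by
  have h3 : ‖σ x‖ ≠ 0 := norm_ne_zero_iff.2 h0
  simp [unitDir, norm_smul, h3]

omit [FiniteDimensional ℝ E] [MeasurableSpace E] [BorelSpace E] in
theorem norm_smul_unitDir {σ : E → E} {x : E} (h0 : σ x ≠ 0) : ‖σ x‖ • unitDir σ x = σ x := by
  have h3 : ‖σ x‖ ≠ 0 := norm_ne_zero_iff.2 h0
  simp [unitDir, smul_smul, h3]

omit [FiniteDimensional ℝ E] [MeasurableSpace E] [BorelSpace E] in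
theorem abs_sum_inner_le (b : OrthonormalBasis ι ℝ E) (T : E →L[ℝ] E) :
    |∑ i, inner ℝ (b i) (T (b i))| ≤ Fintype.card ι * ‖T‖ := by
  refine (Finset.abs_sum_le_sum_abs _ _).trans ?_
  have : ∀ i ∈ Finset.univ, |inner ℝ (b i) (T (b i))| ≤ ‖T‖ := by
    intro i _
    refine (abs_real_inner_le_norm _ _).trans ?_
    have := T.le_opNorm (b i)
    simpa using this
  simpa using Finset.sum_le_sum this

namespace IsStressField

variable {V : Set E} {b : OrthonormalBasis ι ℝ E} {r c₀ b₀ m c K : ℝ} {σ : E → E} {B h ψ Θ : E → ℝ}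

theorem isOpen_regular (H : IsStressField V b r c₀ b₀ m c K σ B h) :
    IsOpen {x ∈ V | σ x ≠ 0} :=
  H.continuousOn.isOpen_inter_preimage H.isOpen isOpen_ne

/-- All truncated test functions live on this set. For ε > 0 it stays away from the zeros of σ, so σ
is C¹ near it and every integrand involving Dσ is integrable. -/
theorem isCompact_support (H : IsStressField V b r c₀ b₀ m c K σ B h) (hψ : IsCutoff V ψ Θ)
    (ε : ℝ) : IsCompact {x ∈ tsupport ψ | ε ≤ ‖σ x‖} := by
  refine hψ.compact.isCompact.of_isClosed_subset ?_ (sep_subset _ _)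
  exact (H.continuousOn.mono hψ.subset).norm.preimage_isClosed_of_isClosed
    (isClosed_tsupport _) isClosed_Ici

theorem support_subset_regular (hψ : IsCutoff V ψ Θ) {ε : ℝ} (hε : 0 < ε) :
    {x ∈ tsupport ψ | ε ≤ ‖σ x‖} ⊆ {x ∈ V | σ x ≠ 0} := fun x hx =>
  ⟨hψ.subset hx.1, fun h0 => by have := hx.2; simp [h0] at this; linarith⟩

omit [InnerProductSpace ℝ E] [FiniteDimensional ℝ E] [MeasurableSpace E] [BorelSpace E] in
theorem truncPow_eq_zero_off {r ε : ℝ} {x : E} (hx : x ∉ {x ∈ tsupport ψ | ε ≤ ‖σ x‖}) :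
    ψ x * truncPow r ε ‖σ x‖ = 0 := by
  by_cases h1 : x ∈ tsupport ψ
  · have : ‖σ x‖ < ε := by
      by_contra! h2
      exact hx ⟨h1, h2⟩
    rw [truncPow_eq_zero this.le, mul_zero]
  · rw [image_eq_zero_of_notMem_tsupport h1, zero_mul]

theorem contDiffOn_truncPow (H : IsStressField V b r c₀ b₀ m c K σ B h) (hψ : IsCutoff V ψ Θ)
    (ε : ℝ) : ContDiffOn ℝ 1 (fun x => ψ x * truncPow r ε ‖σ x‖) {x ∈ V | σ x ≠ 0} := by
  intro x hx
  have h1 : ContDiffAt ℝ 1 σ x := H.contDiffOn.contDiffAt (H.isOpen_regular.mem_nhds hx)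
  have h2 : ContDiffAt ℝ 1 (fun y => ‖σ y‖) x := h1.norm ℝ hx.2
  exact (hψ.contDiff.contDiffAt.mul
    ((contDiffAt_truncPow (norm_ne_zero_iff.2 hx.2)).comp x h2)).contDiffWithinAt

/-- The truncation vanishes where |σ| ≤ ε, so the product is C¹ across the zeros of σ although σ
itself need not be differentiable there. -/
theorem contDiff_component (H : IsStressField V b r c₀ b₀ m c K σ B h) (hψ : IsCutoff V ψ Θ)
    {ε : ℝ} (hε : 0 < ε) (i : ι) :
    ContDiff ℝ 1 (fun x => ψ x * truncPow r ε ‖σ x‖ * inner ℝ (b i) (σ x)) ∧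
    tsupport (fun x => ψ x * truncPow r ε ‖σ x‖ * inner ℝ (b i) (σ x)) ⊆
      {x ∈ tsupport ψ | ε ≤ ‖σ x‖} := by
  have hS := H.isCompact_support hψ ε
  have hSU := support_subset_regular (σ := σ) hψ hε
  have hts : tsupport (fun x => ψ x * truncPow r ε ‖σ x‖ * inner ℝ (b i) (σ x)) ⊆
      {x ∈ tsupport ψ | ε ≤ ‖σ x‖} := by
    refine closure_minimal (fun x hx => ?_) hS.isClosed
    by_contra hxS
    exact hx (by simp only [truncPow_eq_zero_off hxS, zero_mul])
  refine ⟨contDiff_iff_contDiffAt.2 fun x => ?_, hts⟩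
  by_cases hx : x ∈ {x ∈ V | σ x ≠ 0}
  · have hn := H.isOpen_regular.mem_nhds hx
    exact ((H.contDiffOn_truncPow hψ ε).contDiffAt hn).mul
      (contDiffAt_const.inner ℝ (H.contDiffOn.contDiffAt hn))
  · have hn := hS.isClosed.isOpen_compl.mem_nhds (fun h' => hx (hSU h'))
    refine (contDiffAt_const (c := (0 : ℝ))).congr_of_eventuallyEq ?_
    filter_upwards [hn] with y hy
    rw [truncPow_eq_zero_off hy, zero_mul]

/-- Every σ_i is written as |σ| n_i with n the unit direction, so that the powers of |σ| produced by
differentiating the truncation cancel. -/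
theorem fderiv_component (H : IsStressField V b r c₀ b₀ m c K σ B h) (hψ : IsCutoff V ψ Θ)
    (ε : ℝ) (i : ι) {x : E} (hxV : x ∈ V) (hx0 : σ x ≠ 0) (w : E) :
    fderiv ℝ (fun x => ψ x * truncPow r ε ‖σ x‖ * inner ℝ (b i) (σ x)) x w =
      ψ x * truncPow r ε ‖σ x‖ * inner ℝ (b i) (fderiv ℝ σ x w)
      + (truncPow r ε ‖σ x‖ * ‖σ x‖ * fderiv ℝ ψ x w + ψ x * (‖σ x‖ ^ (-r) *
        (2 * truncRatio ε ‖σ x‖ - (r + 2) * truncRatio ε ‖σ x‖ ^ 2))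
          * inner ℝ (unitDir σ x) (fderiv ℝ σ x w)) * inner ℝ (b i) (unitDir σ x) := by
  have hσd : DifferentiableAt ℝ σ x :=
    (H.contDiffOn.contDiffAt (H.isOpen_regular.mem_nhds ⟨hxV, hx0⟩)).differentiableAt one_ne_zero
  have hs : 0 < ‖σ x‖ := norm_pos_iff.2 hx0
  have h1 := (hasDerivAt_truncPow (r := r) (ε := ε) hs).comp_hasFDerivAt x
    (hasFDerivAt_norm_comp hσd hx0)
  have h2 : HasFDerivAt (fun y => inner ℝ (b i) (σ y)) ((innerSL ℝ (b i)).comp (fderiv ℝ σ x)) x :=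
    (innerSL ℝ (b i)).hasFDerivAt.comp x hσd.hasFDerivAt
  have h3 := ((hψ.contDiff.differentiable one_ne_zero x).hasFDerivAt.mul h1).mul h2
  have h4 := congrArg (fun L => L w) h3.fderiv
  simp only [Function.comp_def] at h4
  refine h4.trans ?_
  have h5 : inner ℝ (b i) (σ x) = ‖σ x‖ * inner ℝ (b i) (unitDir σ x) := by
    conv_lhs => rw [← norm_smul_unitDir hx0]
    rw [inner_smul_right]
  simp only [Pi.mul_apply, add_apply, smul_apply, ContinuousLinearMap.comp_apply, innerSL_apply_apply,
    smul_eq_mul, h5]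
  field_simp
  ring

-- Turns the sum of the componentwise test identities into expressions without coordinates.
omit [FiniteDimensional ℝ E] [MeasurableSpace E] [BorelSpace E] in
theorem sum_inner_mul_apply (b : OrthonormalBasis ι ℝ E) (L : E →L[ℝ] ℝ) (x : E) :
    ∑ i, L (b i) * inner ℝ (b i) x = L x := by
  conv_rhs => rw [← b.sum_repr' x]
  rw [map_sum]
  exact Finset.sum_congr rfl fun i _ => by rw [map_smul, smul_eq_mul, mul_comm]

theorem truncPow_mul_le {r ε s m : ℝ} (hr1 : r < 1) (hε : 0 < ε) (hs : 0 ≤ s) (hm : s ≤ m) :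
    truncPow r ε s * s ≤ m ^ (1 - r) := by
  rcases hs.eq_or_lt with h0 | h0
  · rw [← h0, mul_zero]; exact Real.rpow_nonneg (by linarith) _
  · have h1 : truncPow r ε s ≤ s ^ (-r) :=
      mul_le_of_le_one_right (by positivity)
        (pow_le_one₀ (truncRatio_nonneg hs) (truncRatio_le_one hε hs))
    calc truncPow r ε s * s ≤ s ^ (-r) * s := by gcongr
      _ = s ^ (1 - r) := by rw [sub_eq_neg_add, Real.rpow_add_one h0.ne']
      _ ≤ m ^ (1 - r) := Real.rpow_le_rpow hs hm (by linarith)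

/-- The constant in the second order estimate. -/
noncomputable def secondOrderConst (n r c₀ b₀ m K : ℝ) : ℝ :=
  m ^ (2 - r) * (1 / c₀ + 1) + b₀ ^ 2 * m ^ (2 - r) * ((n + 1) ^ 2 / c₀ + 1 / 1 + 1)
    + n * K * m ^ (1 - r)

/-- The weighted second order estimate. -/
theorem second_order_estimate (H : IsStressField V b r c₀ b₀ m c K σ B h) (hψ : IsCutoff V ψ Θ)
    (hr0 : 0 < r) (hr1 : r < 1) (hc₀ : 0 < c₀) (hm : 0 ≤ m) (hK : 0 ≤ K)
    {ε : ℝ} (hε : 0 < ε) :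
    Integrable (fun x => ψ x * truncPow r ε ‖σ x‖ * ‖fderiv ℝ σ x‖ ^ 2) ∧
    c₀ / 2 * ∫ x, ψ x * truncPow r ε ‖σ x‖ * ‖fderiv ℝ σ x‖ ^ 2 ≤
      secondOrderConst (Fintype.card ι) r c₀ b₀ m K * ∫ x, (ψ x + Θ x) := by
  have hS := H.isCompact_support hψ ε
  have hSU := support_subset_regular (σ := σ) hψ hε
  have hU := H.isOpen_regular
  have hUV : {x ∈ V | σ x ≠ 0} ⊆ V := sep_subset _ _
  have hDσ : ContinuousOn (fderiv ℝ σ) {x ∈ V | σ x ≠ 0} :=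
    H.contDiffOn.continuousOn_fderiv_of_isOpen hU le_rfl
  set Φ : ι → E → ℝ := fun i x => ψ x * truncPow r ε ‖σ x‖ * inner ℝ (b i) (σ x) with hΦ
  have hΦ1 : ∀ i, ContDiff ℝ 1 (Φ i) := fun i => (H.contDiff_component hψ hε i).1
  have hΦS : ∀ i, tsupport (Φ i) ⊆ {x ∈ tsupport ψ | ε ≤ ‖σ x‖} :=
    fun i => (H.contDiff_component hψ hε i).2
  have hΦc : ∀ i, HasCompactSupport (Φ i) := fun i =>
    hS.of_isClosed_subset (isClosed_tsupport _) (hΦS i)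
  have hDΦ : ∀ i, ContinuousOn (fderiv ℝ (Φ i)) {x ∈ V | σ x ≠ 0} := fun i =>
    ((hΦ1 i).continuous_fderiv one_ne_zero).continuousOn
  have hoff : ∀ i, ∀ x ∉ {x ∈ tsupport ψ | ε ≤ ‖σ x‖}, fderiv ℝ (Φ i) x = 0 := fun i x hx =>
    fderiv_eq_zero_of_notMem_tsupport fun h' => hx (hΦS i h')
  -- integrability
  have intJ : Integrable (fun x => ψ x * truncPow r ε ‖σ x‖ * ‖fderiv ℝ σ x‖ ^ 2) := by
    refine integrable_of_eq_zero_off hU ?_ hS hSU fun x hx => ?_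
    · exact (H.contDiffOn_truncPow hψ ε).continuousOn.mul (hDσ.norm.pow 2)
    · rw [truncPow_eq_zero_off hx, zero_mul]
  have intT : ∀ i, Integrable (fun x => fderiv ℝ (Φ i) x (fderiv ℝ σ x (b i))) := fun i => by
    refine integrable_of_eq_zero_off hU ?_ hS hSU fun x hx => ?_
    · exact (hDΦ i).clm_apply (hDσ.clm_apply continuousOn_const)
    · simp [hoff i x hx]
  have intB : ∀ i, Integrable (fun x => B x * fderiv ℝ (Φ i) x (b i)) := fun i => by
    refine integrable_of_eq_zero_off hU ?_ hS hSU fun x hx => ?_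
    · exact (H.continuousOn_B.mono hUV).mul ((hDΦ i).clm_apply continuousOn_const)
    · simp [hoff i x hx]
  have inth : ∀ i, Integrable (fun x => h x * fderiv ℝ (Φ i) x (b i)) := fun i => by
    refine integrable_of_eq_zero_off hU ?_ hS hSU fun x hx => ?_
    · exact (H.continuousOn_h.mono hUV).mul ((hDΦ i).clm_apply continuousOn_const)
    · simp [hoff i x hx]
  have intD : ∀ i, Integrable (fun x => fderiv ℝ (Φ i) x (fderiv ℝ σ x (b i))
      - B x * fderiv ℝ (Φ i) x (b i)) := fun i => (intT i).sub (intB i)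
  have intψ : Integrable ψ := hψ.contDiff.continuous.integrable_of_hasCompactSupport hψ.compact
  -- the differentiated equation
  have eqn : ∀ i, ∫ x, (fderiv ℝ (Φ i) x (fderiv ℝ σ x (b i)) - B x * fderiv ℝ (Φ i) x (b i))
      = - ∫ x, h x * fderiv ℝ (Φ i) x (b i) := by
    intro i
    have h1 := (H.weak.mono hUV).differentiated hU H.contDiffOn
      ((H.continuousOn_h.sub H.continuousOn_B).mono hUV) (b i) (hΦ1 i) (hΦc i)
      ((hΦS i).trans hSU)
    -- B and h both stay undifferentiated, multiplied by ∂ᵢΦᵢ. The B term is kept on the left for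
    -- pointwise absorption, the h term is estimated through its Lipschitz constant.
    rw [eq_neg_iff_add_eq_zero, ← integral_add (intD i) (inth i), ← h1]
    refine integral_congr_ae (Eventually.of_forall fun x => ?_)
    simp only [map_add, map_smul, smul_eq_mul, Pi.sub_apply]
    ring
  have bound : ∀ i, ∫ x, (fderiv ℝ (Φ i) x (fderiv ℝ σ x (b i)) - B x * fderiv ℝ (Φ i) x (b i))
      ≤ K * (m ^ (1 - r) * ∫ x, ψ x) := by
    intro i
    rw [eqn i]
    refine (neg_le_abs _).trans ((abs_integral_mul_fderiv_le H.h_lipschitz hK (hΦ1 i) (hΦc i)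
      ((hΦS i).trans (hSU.trans hUV)) (b i)).trans ?_)
    rw [b.norm_eq_one, mul_one]
    refine mul_le_mul_of_nonneg_left ?_ hK
    rw [← integral_const_mul]
    refine integral_mono_of_nonneg (Eventually.of_forall fun x => abs_nonneg _)
      (intψ.const_mul _) (Eventually.of_forall fun x => ?_)
    by_cases hx : x ∈ tsupport ψ
    · have h1 : |inner ℝ (b i) (σ x)| ≤ ‖σ x‖ := by
        simpa using abs_real_inner_le_norm (b i) (σ x)
      have h2 := truncPow_mul_le hr1 hε (norm_nonneg (σ x)) (H.norm_le x (hψ.subset hx))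
      have h3 := truncPow_nonneg (r := r) (ε := ε) (norm_nonneg (σ x))
      have h4 := hψ.nonneg x
      simp only [hΦ]
      rw [abs_mul, abs_mul, abs_of_nonneg h4, abs_of_nonneg h3]
      calc ψ x * truncPow r ε ‖σ x‖ * |inner ℝ (b i) (σ x)|
          ≤ ψ x * truncPow r ε ‖σ x‖ * ‖σ x‖ := by gcongr
        _ = (truncPow r ε ‖σ x‖ * ‖σ x‖) * ψ x := by ring
        _ ≤ m ^ (1 - r) * ψ x := by gcongr
    · simp [hΦ, image_eq_zero_of_notMem_tsupport hx]
  -- the pointwise inequality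
  set C := m ^ (2 - r) * (1 / c₀ + 1)
    + b₀ ^ 2 * m ^ (2 - r) * ((Fintype.card ι + 1 : ℝ) ^ 2 / c₀ + 1 / 1 + 1) with hC
  have hC0 : 0 ≤ C := by positivity
  have pw : ∀ x, c₀ / 2 * (ψ x * truncPow r ε ‖σ x‖ * ‖fderiv ℝ σ x‖ ^ 2) - C * (ψ x + Θ x) ≤
      ∑ i, (fderiv ℝ (Φ i) x (fderiv ℝ σ x (b i)) - B x * fderiv ℝ (Φ i) x (b i)) := by
    intro x
    by_cases hx : x ∈ {x ∈ tsupport ψ | ε ≤ ‖σ x‖}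
    swap
    · have h1 := hψ.nonneg x
      have h2 := hψ.nonneg' x
      simp only [hoff _ x hx, zero_apply, mul_zero, sub_zero, Finset.sum_const_zero,
        truncPow_eq_zero_off hx, zero_mul, zero_sub]
      have : 0 ≤ C * (ψ x + Θ x) := by positivity
      linarith
    obtain ⟨hxV, hx0⟩ := hSU hx
    have hs : 0 < ‖σ x‖ := norm_pos_iff.2 hx0
    have hn := norm_unitDir hx0
    set T := fderiv ℝ σ x with hT
    set n := unitDir σ x with hndef
    -- After summation the integrand involves only tr T², n·T²n, tr T, n·Tn and ∇ψ, with T = Dσ: the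
    -- data of the pointwise inequality.
    have e1 : ∑ i, (fderiv ℝ (Φ i) x (T (b i)) - B x * fderiv ℝ (Φ i) x (b i)) =
        (ψ x * (‖σ x‖ ^ (-r) * truncRatio ε ‖σ x‖ ^ 2) * ∑ i, inner ℝ (b i) (T (T (b i)))
          + ψ x * (‖σ x‖ ^ (-r) * (2 * truncRatio ε ‖σ x‖ - (r + 2) * truncRatio ε ‖σ x‖ ^ 2))
            * inner ℝ n (T (T n))
          + ‖σ x‖ ^ (-r) * truncRatio ε ‖σ x‖ ^ 2 * ‖σ x‖ * fderiv ℝ ψ x (T n))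
        - B x * (ψ x * (‖σ x‖ ^ (-r) * truncRatio ε ‖σ x‖ ^ 2) * ∑ i, inner ℝ (b i) (T (b i))
          + ‖σ x‖ ^ (-r) * truncRatio ε ‖σ x‖ ^ 2 * ‖σ x‖ * fderiv ℝ ψ x n
          + ψ x * (‖σ x‖ ^ (-r) * (2 * truncRatio ε ‖σ x‖ - (r + 2) * truncRatio ε ‖σ x‖ ^ 2))
            * inner ℝ n (T n)) := by
      have k1 := sum_inner_mul_apply b ((fderiv ℝ ψ x).comp T) n
      have k2 := sum_inner_mul_apply b (((innerSL ℝ n).comp T).comp T) n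
      have k3 := sum_inner_mul_apply b (fderiv ℝ ψ x) n
      have k4 := sum_inner_mul_apply b ((innerSL ℝ n).comp T) n
      simp only [ContinuousLinearMap.comp_apply, innerSL_apply_apply] at k1 k2 k3 k4
      rw [← k1, ← k2, ← k3, ← k4]
      simp only [Finset.mul_sum, ← Finset.sum_add_distrib, ← Finset.sum_sub_distrib]
      refine Finset.sum_congr rfl fun i _ => ?_
      rw [H.fderiv_component hψ ε i hxV hx0, H.fderiv_component hψ ε i hxV hx0]
      simp only [truncPow, ← hT, ← hndef]
      ring
    rw [e1]
    have hTn : ‖T n‖ ≤ ‖T‖ := by simpa [hn] using T.le_opNorm n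
    have hB := H.B_nonneg x hxV
    have hpow : ‖σ x‖ ^ (-r) * ‖σ x‖ ^ 2 ≤ m ^ (2 - r) := by
      rw [← Real.rpow_natCast, ← Real.rpow_add hs]
      have : -r + ((2 : ℕ) : ℝ) = 2 - r := by push_cast; ring
      rw [this]
      exact Real.rpow_le_rpow hs.le (H.norm_le x hxV) (by linarith)
    -- Here d = |n·Tn| and c₁ = 1, because the normal inequality holds with constant one; M =
    -- m^(2-r) and M' = b₀² m^(2-r).
    refine second_order_pointwise (G := ‖fderiv ℝ ψ x‖) (d := |inner ℝ n (T n)|)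
      hr0 hr1 hc₀ one_pos (Nat.cast_nonneg _) (hψ.nonneg x) (hψ.nonneg' x) (norm_nonneg _)
      (hψ.sq_le x) hs.le (truncRatio_nonneg hs.le) (truncRatio_le_one hε hs.le)
      (by positivity) hB ?_ (H.coercive x hxV hx0) ?_ (abs_sum_inner_le b T) ?_ ?_ le_rfl hpow ?_
    · refine (abs_real_inner_le_norm _ _).trans ?_
      rw [hn, one_mul]; exact hTn
    · rw [one_mul, sq_abs]; exact H.normal x hxV hx0
    · exact ((fderiv ℝ ψ x).le_opNorm _).trans (by gcongr)
    · simpa [hn] using (fderiv ℝ ψ x).le_opNorm n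
    · calc ‖σ x‖ ^ (-r) * B x ^ 2 ≤ ‖σ x‖ ^ (-r) * (b₀ * ‖σ x‖) ^ 2 := by
            gcongr; exact H.B_le x hxV
        _ = b₀ ^ 2 * (‖σ x‖ ^ (-r) * ‖σ x‖ ^ 2) := by ring
        _ ≤ b₀ ^ 2 * m ^ (2 - r) := by gcongr
  refine ⟨intJ, ?_⟩
  have intF : Integrable (fun x => ∑ i, (fderiv ℝ (Φ i) x (fderiv ℝ σ x (b i))
      - B x * fderiv ℝ (Φ i) x (b i))) :=
    integrable_finsetSum _ fun i _ => intD i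
  have intC : Integrable (fun x => C * (ψ x + Θ x)) := (intψ.add hψ.integrable).const_mul C
  have main : ∫ x, (c₀ / 2 * (ψ x * truncPow r ε ‖σ x‖ * ‖fderiv ℝ σ x‖ ^ 2)
      - C * (ψ x + Θ x)) ≤ _ := integral_mono ((intJ.const_mul (c₀ / 2)).sub intC) intF pw
  rw [integral_sub (intJ.const_mul (c₀ / 2)) intC, integral_const_mul, integral_const_mul,
    integral_finsetSum _ (fun i _ => intD i)] at main
  have sumbound := Finset.sum_le_sum (fun i (_ : i ∈ Finset.univ) => bound i)
  rw [Finset.sum_const, nsmul_eq_mul, Finset.card_univ] at sumbound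
  have hψΘ : ∫ x, ψ x ≤ ∫ x, (ψ x + Θ x) :=
    integral_mono intψ (intψ.add hψ.integrable) fun x => by
      have := hψ.nonneg' x
      simp only; linarith
  have last : (Fintype.card ι : ℝ) * (K * (m ^ (1 - r) * ∫ x, ψ x)) ≤
      (Fintype.card ι : ℝ) * (K * (m ^ (1 - r) * ∫ x, (ψ x + Θ x))) := by gcongr
  have e3 : secondOrderConst (Fintype.card ι) r c₀ b₀ m K =
    C + Fintype.card ι * K * m ^ (1 - r) := rfl
  rw [e3, add_mul]
  linarith

/-- The constant in the estimate of negative powers of the stress field. -/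
noncomputable def negPowConst (n r c₀ b₀ m c K : ℝ) : ℝ :=
  2 / c * (16 / c * (2 / c₀ * secondOrderConst n r c₀ b₀ m K) + 2 * m ^ (1 - r) * (b₀ + 1))

/-- The estimate of a regularization of `|σ| ^ (-r)`. -/
theorem neg_power_estimate (H : IsStressField V b r c₀ b₀ m c K σ B h) (hψ : IsCutoff V ψ Θ)
    (hr0 : 0 < r) (hr1 : r < 1) (hc₀ : 0 < c₀) (hb₀ : 0 ≤ b₀) (hm : 0 ≤ m) (hc : 0 < c)
    (hK : 0 ≤ K) {ε : ℝ} (hε : 0 < ε) :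
    Continuous (fun x => ψ x * regAbs ε ‖σ x‖ ^ (-r)) ∧
    ∫ x, ψ x * regAbs ε ‖σ x‖ ^ (-r) ≤
      negPowConst (Fintype.card ι) r c₀ b₀ m c K * ∫ x, (ψ x + Θ x) := by
  obtain ⟨intJ, hJ⟩ := H.second_order_estimate hψ hr0 hr1 hc₀ hm hK hε
  have hU := H.isOpen_regular
  set φ : E → ℝ := fun x => ψ x * regAbs ε ‖σ x‖ ^ (-r) with hφ
  have hoff : ∀ x ∉ tsupport ψ, φ x = 0 := fun x hx => by
    simp [hφ, image_eq_zero_of_notMem_tsupport hx]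
  have hφs : tsupport φ ⊆ tsupport ψ := by
    refine closure_minimal (fun x hx => ?_) (isClosed_tsupport _)
    by_contra hn
    exact hx (hoff x hn)
  have hφc : HasCompactSupport φ := HasCompactSupport.intro hψ.compact.isCompact hoff
  -- near the points where `σ` is small
  have hsmall : ∀ x ∈ V, ‖σ x‖ < ε → φ =ᶠ[𝓝 x] fun y => ψ y * ε ^ (-r) := by
    intro x hx hlt
    have : ∀ᶠ y in 𝓝 x, ‖σ y‖ < ε :=
      ((H.continuousOn.continuousAt (H.isOpen.mem_nhds hx)).norm).eventually_lt_const hlt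
    filter_upwards [this] with y hy
    simp only [hφ, regAbs_eq hy.le]
  -- The regularization is constant where |σ| < ε, so differentiability of σ is needed only away
  -- from its zeros.
  have hφ1 : ContDiff ℝ 1 φ := by
    refine contDiff_iff_contDiffAt.2 fun x => ?_
    by_cases hxt : x ∈ tsupport ψ
    · have hxV := hψ.subset hxt
      rcases lt_or_ge ‖σ x‖ ε with hlt | hge
      · exact (hψ.contDiff.contDiffAt.mul contDiffAt_const).congr_of_eventuallyEq
          (hsmall x hxV hlt)
      · have h0 : σ x ≠ 0 := norm_pos_iff.1 (hε.trans_le hge)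
        have h1 : ContDiffAt ℝ 1 (fun y => ‖σ y‖) x :=
          (H.contDiffOn.contDiffAt (hU.mem_nhds ⟨hxV, h0⟩)).norm ℝ h0
        have h2 : ContDiffAt ℝ 1 (regAbs ε ∘ fun y => ‖σ y‖) x :=
          ContDiffAt.comp x (contDiffAt_regAbs (norm_ne_zero_iff.2 h0)) h1
        have h3 : ContDiffAt ℝ 1 (fun y => regAbs ε ‖σ y‖) x := h2
        exact hψ.contDiff.contDiffAt.mul
          (h3.rpow_const_of_ne (hε.trans_le (le_regAbs (norm_nonneg _))).ne')
    · refine (contDiffAt_const (c := (0 : ℝ))).congr_of_eventuallyEq ?_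
      filter_upwards [(isClosed_tsupport ψ).isOpen_compl.mem_nhds hxt] with y hy
      exact hoff y hy
  refine ⟨hφ1.continuous, ?_⟩
  have weak := H.weak.contDiff_one H.isOpen H.continuousOn
    (H.continuousOn_h.sub H.continuousOn_B) hφ1 hφc (hφs.trans hψ.subset)
  have intψ : Integrable ψ := hψ.contDiff.continuous.integrable_of_hasCompactSupport hψ.compact
  have intφ : Integrable φ := hφ1.continuous.integrable_of_hasCompactSupport hφc
  have inthB : Integrable (fun x => (h x - B x) * φ x) := by
    refine integrable_of_eq_zero_off H.isOpen ?_ hψ.compact.isCompact hψ.subset fun x hx => ?_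
    · exact (H.continuousOn_h.sub H.continuousOn_B).mul hφ1.continuous.continuousOn
    · rw [hoff x hx, mul_zero]
  have intD : Integrable (fun x => fderiv ℝ φ x (σ x)) := by
    refine integrable_of_eq_zero_off H.isOpen ?_ hψ.compact.isCompact hψ.subset fun x hx => ?_
    · exact (hφ1.continuous_fderiv one_ne_zero).continuousOn.clm_apply H.continuousOn
    · rw [fderiv_eq_zero_of_notMem_tsupport fun h' => hx (hφs h'), zero_apply]
  have hmr : 0 ≤ m ^ (1 - r) := Real.rpow_nonneg hm _
  -- The terms Dφ(σ) and (h - B)φ have the same integral by the weak equation, so integration leaves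
  -- (c/2)∫φ below the second order integral and a multiple of ∫(ψ+Θ).
  have pw : ∀ x, c / 2 * φ x + fderiv ℝ φ x (σ x) ≤ (h x - B x) * φ x
      + (16 / c * (ψ x * truncPow r ε ‖σ x‖ * ‖fderiv ℝ σ x‖ ^ 2)
        + 2 * m ^ (1 - r) * (b₀ + 1) * (ψ x + Θ x)) := by
    intro x
    have hψ0 := hψ.nonneg x
    have hΘ0 := hψ.nonneg' x
    have hJ0 : 0 ≤ 16 / c * (ψ x * truncPow r ε ‖σ x‖ * ‖fderiv ℝ σ x‖ ^ 2) := by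
      have := truncPow_nonneg (r := r) (ε := ε) (norm_nonneg (σ x))
      positivity
    have hR0 : 0 ≤ 2 * m ^ (1 - r) * (b₀ + 1) * (ψ x + Θ x) := by positivity
    by_cases hxt : x ∈ tsupport ψ
    swap
    · rw [hoff x hxt, fderiv_eq_zero_of_notMem_tsupport fun h' => hxt (hφs h'), zero_apply]
      linarith
    have hxV := hψ.subset hxt
    have hle := H.le_h x hxV
    have hP0 : 0 ≤ regAbs ε ‖σ x‖ ^ (-r) :=
      Real.rpow_nonneg (hε.le.trans (le_regAbs (norm_nonneg _))) _
    have hφ0 : 0 ≤ φ x := mul_nonneg hψ0 hP0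
    rcases eq_or_ne (σ x) 0 with h0 | h0
    · have hB : B x = 0 := le_antisymm (by simpa [h0] using H.B_le x hxV) (H.B_nonneg x hxV)
      rw [h0, map_zero, hB]
      rw [h0] at hJ0
      have : c * φ x ≤ h x * φ x := by gcongr
      have : 0 ≤ c * φ x := by positivity
      linarith
    have hs : 0 < ‖σ x‖ := norm_pos_iff.2 h0
    have hσd : DifferentiableAt ℝ σ x :=
      (H.contDiffOn.contDiffAt (hU.mem_nhds ⟨hxV, h0⟩)).differentiableAt one_ne_zero
    have hn := norm_unitDir h0
    set T := fderiv ℝ σ x with hT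
    set n := unitDir σ x with hndef
    set S := regAbs ε ‖σ x‖ with hSdef
    set v := truncRatio ε ‖σ x‖ with hv
    have hS0 : 0 < S := hε.trans_le (le_regAbs hs.le)
    have hv0 : 0 ≤ v := truncRatio_nonneg hs.le
    have hv1 : v ≤ 1 := truncRatio_le_one hε hs.le
    have hPs : S ^ (-r) ≤ 2 * ‖σ x‖ ^ (-r) := regAbs_rpow_le hr0 hr1 hε hs
    have hPs' : S ^ (-r) * ‖σ x‖ ≤ 2 * m ^ (1 - r) := by
      calc S ^ (-r) * ‖σ x‖ ≤ 2 * ‖σ x‖ ^ (-r) * ‖σ x‖ := by gcongr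
        _ = 2 * ‖σ x‖ ^ (1 - r) := by
          rw [mul_assoc, sub_eq_neg_add, Real.rpow_add_one hs.ne']
        _ ≤ 2 * m ^ (1 - r) := mul_le_mul_of_nonneg_left
          (Real.rpow_le_rpow hs.le (H.norm_le x hxV) (by linarith)) two_pos.le
    have hder : fderiv ℝ φ x (σ x) = ψ x * (-r * S ^ (-r) * (2 * v - v ^ 2) / S
        * (‖σ x‖ * inner ℝ n (T n))) + S ^ (-r) * fderiv ℝ ψ x (σ x) := by
      have h1 := (hasDerivAt_regAbs_rpow (r := r) hε hs).comp_hasFDerivAt x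
        (hasFDerivAt_norm_comp hσd h0)
      have h3 := (hψ.contDiff.differentiable one_ne_zero x).hasFDerivAt.mul h1
      have h4 := congrArg (fun L => L (σ x)) h3.fderiv
      simp only [Function.comp_def] at h4
      refine h4.trans ?_
      have h5 : T (σ x) = ‖σ x‖ • T n := by
        conv_lhs => rw [← norm_smul_unitDir h0]
        rw [map_smul]
      simp only [add_apply, smul_apply, ContinuousLinearMap.comp_apply, innerSL_apply_apply,
        smul_eq_mul, ← hT, h5, inner_smul_right, ← hndef]
      rfl
    have hz : |inner ℝ n (T n)| ≤ ‖T‖ := by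
      refine (abs_real_inner_le_norm _ _).trans ?_
      simpa [hn] using T.le_opNorm n
    have hsS : ‖σ x‖ / S ≤ 2 := by
      rw [div_le_iff₀ hS0]
      have := half_le_regAbs (s := ‖σ x‖) hε
      linarith
    have t1 : ψ x * (-r * S ^ (-r) * (2 * v - v ^ 2) / S * (‖σ x‖ * inner ℝ n (T n))) ≤
        c / 2 * φ x + 16 / c * (ψ x * truncPow r ε ‖σ x‖ * ‖T‖ ^ 2) := by
      have hv2 : 2 * v - v ^ 2 ≤ 2 * v := by nlinarith only [sq_nonneg v]
      have hv3 : 0 ≤ 2 * v - v ^ 2 := by nlinarith only [hv0, hv1]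
      have k1 : ψ x * (-r * S ^ (-r) * (2 * v - v ^ 2) / S * (‖σ x‖ * inner ℝ n (T n))) ≤
          ψ x * (S ^ (-r) * (4 * v * ‖T‖)) := by
        calc _ = ψ x * (S ^ (-r) * (r * (2 * v - v ^ 2) * (‖σ x‖ / S) * -inner ℝ n (T n))) := by
              ring
          _ ≤ ψ x * (S ^ (-r) * (r * (2 * v - v ^ 2) * (‖σ x‖ / S) * ‖T‖)) := by
              have : -inner ℝ n (T n) ≤ ‖T‖ := (neg_le_abs _).trans hz
              have h' : 0 ≤ r * (2 * v - v ^ 2) * (‖σ x‖ / S) := by positivity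
              exact mul_le_mul_of_nonneg_left (mul_le_mul_of_nonneg_left
                (mul_le_mul_of_nonneg_left this h') hP0) hψ0
          _ ≤ ψ x * (S ^ (-r) * (1 * (2 * v) * 2 * ‖T‖)) := by gcongr
          _ = _ := by ring
      -- Young's inequality balanced so that c/2 is absorbed by c. The remaining 8/c becomes 16/c
      -- because S^(-r) ≤ 2|σ|^(-r).
      have k2 : 4 * v * ‖T‖ ≤ c / 2 + 8 / c * (v ^ 2 * ‖T‖ ^ 2) := by
        have : c / 2 + 8 / c * (v ^ 2 * ‖T‖ ^ 2) - 4 * v * ‖T‖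
            = (c - 4 * v * ‖T‖) ^ 2 / (2 * c) := by
          field_simp; ring
        have h' : 0 ≤ (c - 4 * v * ‖T‖) ^ 2 / (2 * c) := by positivity
        linarith
      calc _ ≤ _ := k1
        _ ≤ ψ x * (S ^ (-r) * (c / 2 + 8 / c * (v ^ 2 * ‖T‖ ^ 2))) := by gcongr
        _ = c / 2 * (ψ x * S ^ (-r)) + 8 / c * ψ x * v ^ 2 * ‖T‖ ^ 2 * S ^ (-r) := by ring
        _ ≤ c / 2 * (ψ x * S ^ (-r)) + 8 / c * ψ x * v ^ 2 * ‖T‖ ^ 2 * (2 * ‖σ x‖ ^ (-r)) := by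
            gcongr
        _ = _ := by simp only [hφ, truncPow, ← hv, ← hSdef]; ring
    have t2 : S ^ (-r) * fderiv ℝ ψ x (σ x) ≤ 2 * m ^ (1 - r) * (ψ x + Θ x) := by
      have hG : ‖fderiv ℝ ψ x‖ ≤ ψ x + Θ x := by
        refine (abs_le_of_sq_le_sq' ?_ (by positivity)).2
        have : 0 ≤ ψ x * Θ x := by positivity
        nlinarith only [hψ.sq_le x, this, sq_nonneg (ψ x), sq_nonneg (Θ x)]
      calc S ^ (-r) * fderiv ℝ ψ x (σ x) ≤ S ^ (-r) * (‖fderiv ℝ ψ x‖ * ‖σ x‖) := by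
            gcongr
            exact (le_abs_self _).trans ((fderiv ℝ ψ x).le_opNorm _)
        _ = S ^ (-r) * ‖σ x‖ * ‖fderiv ℝ ψ x‖ := by ring
        _ ≤ 2 * m ^ (1 - r) * (ψ x + Θ x) := by gcongr
    have t3 : B x * φ x ≤ 2 * m ^ (1 - r) * b₀ * (ψ x + Θ x) := by
      calc B x * φ x ≤ b₀ * ‖σ x‖ * φ x := by gcongr; exact H.B_le x hxV
        _ = b₀ * (S ^ (-r) * ‖σ x‖) * ψ x := by simp only [hφ, ← hSdef]; ring
        _ ≤ b₀ * (2 * m ^ (1 - r)) * (ψ x + Θ x) := by gcongr; linarith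
        _ = _ := by ring
    have t4 : c * φ x ≤ h x * φ x := by gcongr
    rw [hder]
    linarith
  have intC : Integrable (fun x => 2 * m ^ (1 - r) * (b₀ + 1) * (ψ x + Θ x)) :=
    (intψ.add hψ.integrable).const_mul _
  have main : ∫ x, (c / 2 * φ x + fderiv ℝ φ x (σ x)) ≤ ∫ x, ((h x - B x) * φ x
      + (16 / c * (ψ x * truncPow r ε ‖σ x‖ * ‖fderiv ℝ σ x‖ ^ 2)
        + 2 * m ^ (1 - r) * (b₀ + 1) * (ψ x + Θ x))) :=
    integral_mono ((intφ.const_mul _).add intD) (inthB.add ((intJ.const_mul _).add intC)) pw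
  have e1 : ∫ x, (16 / c * (ψ x * truncPow r ε ‖σ x‖ * ‖fderiv ℝ σ x‖ ^ 2)
        + 2 * m ^ (1 - r) * (b₀ + 1) * (ψ x + Θ x)) = _ :=
    integral_add (intJ.const_mul _) intC
  have e2 : ∫ x, ((h x - B x) * φ x
      + (16 / c * (ψ x * truncPow r ε ‖σ x‖ * ‖fderiv ℝ σ x‖ ^ 2)
        + 2 * m ^ (1 - r) * (b₀ + 1) * (ψ x + Θ x))) = _ :=
    integral_add inthB ((intJ.const_mul _).add intC)
  rw [e2, integral_add (intφ.const_mul _) intD, integral_const_mul, weak, e1, integral_const_mul, integral_const_mul] at main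
  have hJ' : ∫ x, ψ x * truncPow r ε ‖σ x‖ * ‖fderiv ℝ σ x‖ ^ 2 ≤
      2 / c₀ * (secondOrderConst (Fintype.card ι) r c₀ b₀ m K * ∫ x, (ψ x + Θ x)) := by
    rw [div_mul_eq_mul_div, le_div_iff₀ hc₀]
    linarith
  have hJ2 : 16 / c * ∫ x, ψ x * truncPow r ε ‖σ x‖ * ‖fderiv ℝ σ x‖ ^ 2 ≤ 16 / c *
      (2 / c₀ * (secondOrderConst (Fintype.card ι) r c₀ b₀ m K * ∫ x, (ψ x + Θ x))) := by gcongr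
  have fin : c / 2 * ∫ x, φ x ≤ (16 / c * (2 / c₀ * secondOrderConst (Fintype.card ι) r c₀ b₀ m K)
      + 2 * m ^ (1 - r) * (b₀ + 1)) * ∫ x, (ψ x + Θ x) := by
    simp only [Pi.sub_apply] at main
    linarith
  unfold negPowConst
  rw [mul_assoc, div_mul_eq_mul_div, le_div_iff₀ hc]
  linarith

end IsStressField

end StressField

/-! ### Cutoffs carrying the singular weight |x-y|^(-γ). -/

section SingularWeights

variable {E : Type*} [NormedAddCommGroup E] [InnerProductSpace ℝ E] [FiniteDimensional ℝ E]
  [MeasurableSpace E] [BorelSpace E]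

omit [MeasurableSpace E] [BorelSpace E] in
theorem IsCompact.exists_contDiff_cutoff {S V : Set E} (hS : IsCompact S) (hV : IsOpen V)
    (hSV : S ⊆ V) : ∃ η : E → ℝ, ContDiff ℝ 1 η ∧ HasCompactSupport η ∧ tsupport η ⊆ V ∧
      (∀ x, 0 ≤ η x) ∧ (∀ x, η x ≤ 1) ∧ ∀ x ∈ S, η x = 1 := by
  obtain ⟨δ, hδ, hδV⟩ := hS.exists_cthickening_subset_open hV hSV
  obtain ⟨η, h1, h2, h3, h4⟩ := exists_contMDiff_support_eq_eq_one_iff (n := 1)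
    (modelWithCornersSelf ℝ E) (Metric.isOpen_thickening (δ := δ) (E := S)) hS.isClosed
    (Metric.self_subset_thickening hδ S)
  have hts : tsupport η ⊆ Metric.cthickening δ S := by
    rw [tsupport, h3]; exact Metric.closure_thickening_subset_cthickening _ _
  exact ⟨η, h1.contDiff, hS.cthickening.of_isClosed_subset (isClosed_tsupport _) hts,
    hts.trans hδV, fun x => (h2 (mem_range_self x)).1, fun x => (h2 (mem_range_self x)).2,
    fun x hx => (h4 x).1 hx⟩

theorem integrableOn_norm_rpow_ball [Nontrivial E] {s : ℝ} (hs : s < Module.finrank ℝ E) {D : ℝ}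
    (hD : 0 < D) : IntegrableOn (fun x : E => ‖x‖ ^ (-s)) (Metric.ball 0 D) := by
  rw [integrableOn_fun_norm_addHaar volume (f := fun t : ℝ => t ^ (-s))]
  have hN : 1 ≤ Module.finrank ℝ E := Module.finrank_pos
  refine ((intervalIntegral.integrableOn_Ioo_rpow_iff (s := Module.finrank ℝ E - 1 - s) hD).2
    (by linarith)).congr_fun ?_ measurableSet_Ioo
  intro t ht
  have : ((Module.finrank ℝ E : ℝ) - 1 - s) = ((Module.finrank ℝ E - 1 : ℕ) : ℝ) + -s := by
    rw [Nat.cast_sub hN]; push_cast; ring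
  simp only [this, Real.rpow_add ht.1, Real.rpow_natCast, smul_eq_mul]

/-- The regularization `(|x - y|² + δ²) ^ (-γ/2)` of the weight `|x - y| ^ (-γ)`. -/
noncomputable def regWeight (γ δ : ℝ) (y x : E) : ℝ := (‖x - y‖ ^ 2 + δ ^ 2) ^ (-(γ / 2))

omit [InnerProductSpace ℝ E] [FiniteDimensional ℝ E] [MeasurableSpace E] [BorelSpace E] in
theorem regWeight_pos {γ δ : ℝ} (hδ : 0 < δ) (y x : E) : 0 < regWeight γ δ y x := by
  unfold regWeight; positivity

omit [FiniteDimensional ℝ E] [MeasurableSpace E] [BorelSpace E] in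
theorem contDiff_regWeight {γ δ : ℝ} (hδ : 0 < δ) (y : E) : ContDiff ℝ 1 (regWeight γ δ y) := by
  have h1 : ContDiff ℝ 1 (fun x : E => ‖x - y‖ ^ 2 + δ ^ 2) :=
    ((contDiff_id.sub contDiff_const).norm_sq ℝ).add contDiff_const
  exact h1.rpow_const_of_ne fun x => by positivity

-- With ρ = |x-y|² + δ², the gradient of ρ^(-γ/2) has norm |γ| ρ^(-γ/2-1)|x-y|, and |x-y|² ≤ ρ. Thus
-- the admissible Θ costs two further powers of the distance.
omit [FiniteDimensional ℝ E] [MeasurableSpace E] [BorelSpace E] in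
theorem norm_fderiv_regWeight_sq_le {γ δ : ℝ} (hδ : 0 < δ) (y x : E) :
    ‖fderiv ℝ (regWeight γ δ y) x‖ ^ 2 ≤
      regWeight γ δ y x * (γ ^ 2 * regWeight (γ + 2) δ y x) := by
  set ρ := ‖x - y‖ ^ 2 + δ ^ 2 with hρ
  have hρ0 : 0 < ρ := by positivity
  have h1 : HasFDerivAt (fun x : E => ‖x - y‖ ^ 2 + δ ^ 2)
      ((2 : ℝ) • (innerSL ℝ (x - y)).comp (ContinuousLinearMap.id ℝ E)) x :=
    ((((hasFDerivAt_id x).sub_const y).norm_sq).add_const (δ ^ 2)).congr_fderiv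
      (by ext; simp [two_smul])
  have h2 := h1.rpow_const (p := -(γ / 2)) (Or.inl hρ0.ne')
  have h3 : fderiv ℝ (regWeight γ δ y) x = _ := h2.fderiv
  rw [h3, norm_smul, norm_smul, ContinuousLinearMap.comp_id, innerSL_apply_norm, mul_pow, mul_pow,
    ← hρ]
  have h4 : ‖x - y‖ ^ 2 ≤ ρ := by rw [hρ]; nlinarith [sq_nonneg δ]
  have h5 : regWeight γ δ y x = ρ ^ (-(γ / 2)) := rfl
  have h6 : regWeight (γ + 2) δ y x = ρ ^ (-(γ / 2)) * ρ⁻¹ := by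
    rw [← Real.rpow_neg_one ρ, ← Real.rpow_add hρ0]
    unfold regWeight
    rw [← hρ]; congr 1; ring
  rw [h5, h6, Real.rpow_sub_one hρ0.ne', Real.norm_eq_abs, sq_abs, Real.norm_eq_abs, sq_abs]
  calc (-(γ / 2) * (ρ ^ (-(γ / 2)) / ρ)) ^ 2 * (2 ^ 2 * ‖x - y‖ ^ 2)
      ≤ (-(γ / 2) * (ρ ^ (-(γ / 2)) / ρ)) ^ 2 * (2 ^ 2 * ρ) := by gcongr
    _ = _ := by field_simp

/-- Cutoffs with the regularized weight `|x - y| ^ (-γ)`, uniformly in the pole `y` and in the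
regularization. -/
theorem exists_weighted_cutoffs [Nontrivial E] {S V : Set E} (hS : IsCompact S) (hV : IsOpen V)
    (hSV : S ⊆ V) {γ : ℝ} (hγ0 : 0 ≤ γ) (hγ : γ = 0 ∨ γ + 2 < Module.finrank ℝ E) :
    ∃ C : ℝ, 0 ≤ C ∧ ∀ y ∈ S, ∀ δ : ℝ, 0 < δ → δ ≤ 1 → ∃ ψ Θ : E → ℝ, IsCutoff V ψ Θ ∧
      (∀ x ∈ S, ψ x = regWeight γ δ y x) ∧ ∫ x, (ψ x + Θ x) ≤ C := by
  obtain ⟨η, hη, hηc, hηV, hη0, hη1, hηS⟩ := hS.exists_contDiff_cutoff hV hSV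
  have hηD : Continuous (fderiv ℝ η) := hη.continuous_fderiv one_ne_zero
  obtain ⟨G, hG⟩ := (hηc.fderiv ℝ).exists_bound_of_continuous hηD
  obtain ⟨D₁, hD₁⟩ := hηc.isCompact.isBounded.exists_norm_le
  obtain ⟨D₂, hD₂⟩ := hS.isBounded.exists_norm_le
  set D := |D₁| + |D₂| + 1 with hD
  have hD0 : 0 < D := by positivity
  -- the cutoffs
  have main : ∀ y ∈ S, ∀ δ : ℝ, 0 < δ → δ ≤ 1 → ∃ ψ Θ : E → ℝ, IsCutoff V ψ Θ ∧
      (∀ x ∈ S, ψ x = regWeight γ δ y x) ∧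
      ∀ x, ψ x + Θ x ≤ (tsupport η).indicator (fun x => (1 + 8 * G ^ 2) * regWeight γ δ y x
        + 2 * (γ ^ 2 * regWeight (γ + 2) δ y x)) x := by
    intro y hy δ hδ hδ1
    have hw := contDiff_regWeight (γ := γ) hδ y
    have hw2 := contDiff_regWeight (γ := γ + 2) hδ y
    have hψs : ∀ x ∉ tsupport η, η x ^ 2 * regWeight γ δ y x = 0 := fun x hx => by
      simp [image_eq_zero_of_notMem_tsupport hx]
    have hΘs : ∀ x ∉ tsupport η, 8 * regWeight γ δ y x * ‖fderiv ℝ η x‖ ^ 2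
        + 2 * η x ^ 2 * (γ ^ 2 * regWeight (γ + 2) δ y x) = 0 := fun x hx => by
      simp [image_eq_zero_of_notMem_tsupport hx, fderiv_eq_zero_of_notMem_tsupport hx]
    -- The cutoff is squared so that both terms of |∇ψ|² ≤ 2η⁴|∇w|² + 8η²w²|∇η|² contain the factor
    -- ψ = η²w; Θ is the remaining factor.
    refine ⟨fun x => η x ^ 2 * regWeight γ δ y x, fun x => 8 * regWeight γ δ y x * ‖fderiv ℝ η x‖ ^ 2
      + 2 * η x ^ 2 * (γ ^ 2 * regWeight (γ + 2) δ y x), ⟨(hη.pow 2).mul hw, ?_, ?_, ?_, ?_, ?_, ?_⟩,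
      ?_, ?_⟩
    · exact HasCompactSupport.intro hηc.isCompact hψs
    · refine subset_trans (closure_minimal (fun x hx => ?_) (isClosed_tsupport η)) hηV
      by_contra hn
      exact hx (hψs x hn)
    · intro x
      have := regWeight_pos (γ := γ) hδ y x
      positivity
    · intro x
      have := regWeight_pos (γ := γ) hδ y x
      have := regWeight_pos (γ := γ + 2) hδ y x
      positivity
    · refine Continuous.integrable_of_hasCompactSupport ?_ (HasCompactSupport.intro hηc.isCompact hΘs)
      have h1 := hw.continuous
      have h2 := hw2.continuous
      have h3 := hη.continuous
      fun_prop
    · intro x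
      have hw0 := regWeight_pos (γ := γ) hδ y x
      have hd := ((hη.differentiable one_ne_zero x).hasFDerivAt.pow 2).mul
        (hw.differentiable one_ne_zero x).hasFDerivAt
      have h1 : fderiv ℝ (fun x => η x ^ 2 * regWeight γ δ y x) x = _ := hd.fderiv
      have h2 := norm_fderiv_regWeight_sq_le (γ := γ) hδ y x
      have h3 : ‖fderiv ℝ (fun x => η x ^ 2 * regWeight γ δ y x) x‖ ≤
          η x ^ 2 * ‖fderiv ℝ (regWeight γ δ y) x‖
          + regWeight γ δ y x * (2 * η x * ‖fderiv ℝ η x‖) := by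
        rw [h1]
        refine (norm_add_le _ _).trans (le_of_eq ?_)
        have h0 := hη0 x
        simp [norm_smul, abs_of_nonneg hw0.le, abs_of_nonneg h0]
      have h4 : ‖fderiv ℝ (fun x => η x ^ 2 * regWeight γ δ y x) x‖ ^ 2 ≤
          2 * (η x ^ 2 * ‖fderiv ℝ (regWeight γ δ y) x‖) ^ 2
          + 2 * (regWeight γ δ y x * (2 * η x * ‖fderiv ℝ η x‖)) ^ 2 := by
        refine (pow_le_pow_left₀ (norm_nonneg _) h3 2).trans ?_
        nlinarith only [sq_nonneg (η x ^ 2 * ‖fderiv ℝ (regWeight γ δ y) x‖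
          - regWeight γ δ y x * (2 * η x * ‖fderiv ℝ η x‖))]
      refine h4.trans ?_
      calc _ = 2 * η x ^ 4 * ‖fderiv ℝ (regWeight γ δ y) x‖ ^ 2
            + 8 * η x ^ 2 * regWeight γ δ y x ^ 2 * ‖fderiv ℝ η x‖ ^ 2 := by ring
        _ ≤ 2 * η x ^ 4 * (regWeight γ δ y x * (γ ^ 2 * regWeight (γ + 2) δ y x))
            + 8 * η x ^ 2 * regWeight γ δ y x ^ 2 * ‖fderiv ℝ η x‖ ^ 2 := by gcongr
        _ = _ := by ring
    · intro x hx
      simp [hηS x hx]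
    · intro x
      by_cases hx : x ∈ tsupport η
      · rw [indicator_of_mem hx]
        have hw0 := regWeight_pos (γ := γ) hδ y x
        have hw1 := regWeight_pos (γ := γ + 2) hδ y x
        have h2 : η x ^ 2 ≤ 1 := pow_le_one₀ (hη0 x) (hη1 x)
        have h3 := hG x
        calc _ = η x ^ 2 * regWeight γ δ y x + (8 * regWeight γ δ y x * ‖fderiv ℝ η x‖ ^ 2
              + 2 * η x ^ 2 * (γ ^ 2 * regWeight (γ + 2) δ y x)) := rfl
          _ ≤ 1 * regWeight γ δ y x + (8 * regWeight γ δ y x * G ^ 2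
              + 2 * 1 * (γ ^ 2 * regWeight (γ + 2) δ y x)) := by gcongr
          _ = _ := by ring
      · simp only [indicator_of_notMem hx, hψs x hx, hΘs x hx, add_zero, le_refl]
  -- For γ = 0 the factor γ² removes the weight of exponent γ + 2, whose integrability would require
  -- dimension above two.
  rcases hγ with rfl | hγ
  · -- no singular weight
    refine ⟨(1 + 8 * G ^ 2) * volume.real (tsupport η), by positivity, fun y hy δ hδ hδ1 => ?_⟩
    obtain ⟨ψ, Θ, h1, h2, h3⟩ := main y hy δ hδ hδ1
    refine ⟨ψ, Θ, h1, h2, ?_⟩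
    have h4 : ∀ x, ψ x + Θ x ≤ (tsupport η).indicator (fun _ => 1 + 8 * G ^ 2) x := by
      intro x
      refine (h3 x).trans (le_of_eq ?_)
      congr 1
      funext z
      simp [regWeight]
    have h5 : Integrable ((tsupport η).indicator (fun _ : E => 1 + 8 * G ^ 2)) :=
      (integrableOn_const (hηc.isCompact.measure_lt_top.ne)).integrable_indicator
        (isClosed_tsupport η).measurableSet
    refine (integral_mono_of_nonneg (Eventually.of_forall fun x =>
      add_nonneg (h1.nonneg x) (h1.nonneg' x)) h5 (Eventually.of_forall h4)).trans ?_
    rw [integral_indicator (isClosed_tsupport η).measurableSet, setIntegral_const, smul_eq_mul,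
      mul_comm]
  -- On the bounded support ρ ≤ D² + 1, so the weight of exponent γ is at most (D² + 1) times that
  -- of exponent γ + 2. The majorant depends only on x - y, and translation makes its integral
  -- independent of the pole.
  · set M := (1 + 8 * G ^ 2) * (D ^ 2 + 1) + 2 * γ ^ 2 with hM
    have hM0 : 0 ≤ M := by positivity
    have hint := integrableOn_norm_rpow_ball (E := E) hγ hD0
    refine ⟨M * ∫ z in Metric.ball (0 : E) D, ‖z‖ ^ (-(γ + 2)), ?_, fun y hy δ hδ hδ1 => ?_⟩
    · exact mul_nonneg hM0 (integral_nonneg fun z => by positivity)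
    obtain ⟨ψ, Θ, h1, h2, h3⟩ := main y hy δ hδ hδ1
    refine ⟨ψ, Θ, h1, h2, ?_⟩
    set F : E → ℝ := (Metric.ball (0 : E) D).indicator (fun z => M * ‖z‖ ^ (-(γ + 2))) with hF
    have hFi : Integrable F := IntegrableOn.integrable_indicator (Integrable.const_mul hint M)
      measurableSet_ball
    have h4 : ∀ x, x ≠ y → ψ x + Θ x ≤ F (x - y) := by
      intro x hxy
      refine (h3 x).trans ?_
      have hpos : 0 < ‖x - y‖ := norm_pos_iff.2 (sub_ne_zero.2 hxy)
      by_cases hx : x ∈ tsupport η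
      · have hlt : ‖x - y‖ < D := by
          have a1 := (hD₁ x hx).trans (le_abs_self _)
          have a2 := (hD₂ y hy).trans (le_abs_self _)
          have a3 := norm_sub_le x y
          rw [hD]; linarith
        have hmem : x - y ∈ Metric.ball (0 : E) D := by simpa using hlt
        rw [indicator_of_mem hx, hF, indicator_of_mem hmem]
        set ρ := ‖x - y‖ ^ 2 + δ ^ 2 with hρ
        have hρ0 : 0 < ρ := by positivity
        have e1 : regWeight γ δ y x = ρ * regWeight (γ + 2) δ y x := by
          unfold regWeight
          have := Real.rpow_add hρ0 1 (-((γ + 2) / 2))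
          rw [Real.rpow_one] at this
          rw [← hρ, ← this]
          congr 1; ring
        have hρD : ρ ≤ D ^ 2 + 1 := by
          have a1 : ‖x - y‖ ^ 2 ≤ D ^ 2 := by gcongr
          have a2 : δ ^ 2 ≤ 1 := pow_le_one₀ hδ.le hδ1
          rw [hρ]; linarith
        have e2 : regWeight (γ + 2) δ y x ≤ ‖x - y‖ ^ (-(γ + 2)) := by
          unfold regWeight
          rw [← hρ]
          calc ρ ^ (-((γ + 2) / 2)) ≤ (‖x - y‖ ^ 2) ^ (-((γ + 2) / 2)) :=
                Real.rpow_le_rpow_of_nonpos (by positivity) (by rw [hρ]; nlinarith [sq_nonneg δ])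
                  (by linarith)
            _ = _ := by
                rw [← Real.rpow_natCast, ← Real.rpow_mul hpos.le]
                congr 1; push_cast; ring
        have hw1 := regWeight_pos (γ := γ + 2) hδ y x
        calc _ = ((1 + 8 * G ^ 2) * ρ + 2 * γ ^ 2) * regWeight (γ + 2) δ y x := by rw [e1]; ring
          _ ≤ M * ‖x - y‖ ^ (-(γ + 2)) := by rw [hM]; gcongr
      · rw [indicator_of_notMem hx]
        refine indicator_nonneg (fun z _ => ?_) _
        positivity
    -- A real power of 0 with negative exponent evaluates to 0, so the majorant can fail at x = y, a
    -- null set.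
    have hae : ∀ᵐ x : E, x ≠ y := by
      simp [ae_iff]
    refine (integral_mono_of_nonneg (Eventually.of_forall fun x =>
      add_nonneg (h1.nonneg x) (h1.nonneg' x)) (hFi.comp_sub_right y)
      (hae.mono h4)).trans (le_of_eq ?_)
    rw [integral_sub_right_eq_self F y, hF, integral_indicator measurableSet_ball,
      integral_const_mul]

end SingularWeights

/-! ### Passage to the limit in the regularizations. -/

section Limit

variable {E : Type*} [NormedAddCommGroup E] [InnerProductSpace ℝ E] [FiniteDimensional ℝ E]
  [MeasurableSpace E] [BorelSpace E] {ι : Type*} [Fintype ι]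

open Classical in
/-- `|σ| ^ (-r) |x - y| ^ (-γ)`, with the value `∞` where `σ = 0`. -/
noncomputable def singularDensity (r γ : ℝ) (σ : E → E) (y x : E) : ℝ≥0∞ :=
  if σ x = 0 then ⊤ else ENNReal.ofReal (‖σ x‖ ^ (-r) * (1 / ‖x - y‖ ^ γ))

theorem tendsto_regAbs {s : ℝ} (hs : 0 < s) {ε : ℕ → ℝ} (hε : Tendsto ε atTop (𝓝 0)) :
    Tendsto (fun n => regAbs (ε n) s) atTop (𝓝 s) := by
  have h1 : Continuous fun e : ℝ => regAbs e s := by unfold regAbs truncRatio; fun_prop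
  have h2 := (h1.tendsto 0).comp hε
  have h3 : regAbs 0 s = s := by
    unfold regAbs truncRatio
    rw [sub_zero, max_eq_left hs.le, div_self hs.ne']; ring
  rwa [h3] at h2

/-- The integral estimate for negative powers of the stress field. -/
theorem exists_lintegral_singularDensity_le [Nontrivial E] {S V : Set E} (hS : IsCompact S)
    (hV : IsOpen V) (hSV : S ⊆ V) {r γ : ℝ} (hr0 : 0 < r) (hr1 : r < 1) (hγ0 : 0 ≤ γ)
    (hγ : γ = 0 ∨ γ + 2 < Module.finrank ℝ E) {c₀ b₀ m c K : ℝ} (hc₀ : 0 < c₀) (hb₀ : 0 ≤ b₀)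
    (hm : 0 ≤ m) (hc : 0 < c) (hK : 0 ≤ K) (b : OrthonormalBasis ι ℝ E) :
    ∃ C : ℝ, ∀ (σ : E → E) (B h : E → ℝ), IsStressField V b r c₀ b₀ m c K σ B h →
      ∀ y ∈ S, ∫⁻ x in S, singularDensity r γ σ y x ≤ ENNReal.ofReal C := by
  obtain ⟨C, hC0, hC⟩ := exists_weighted_cutoffs hS hV hSV hγ0 hγ
  refine ⟨IsStressField.negPowConst (Fintype.card ι) r c₀ b₀ m c K * C, fun σ B h H y hy => ?_⟩
  set ε : ℕ → ℝ := fun n => 1 / ((n : ℝ) + 1) with hεdef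
  have hε0 : ∀ n, 0 < ε n := fun n => by positivity
  have hε1 : ∀ n, ε n ≤ 1 := fun n => by
    rw [hεdef]; simp only; rw [div_le_one (by positivity)]
    have : (0 : ℝ) ≤ n := Nat.cast_nonneg n
    linarith
  have hεt : Tendsto ε atTop (𝓝 0) := tendsto_one_div_add_atTop_nhds_zero_nat
  set f : ℕ → E → ℝ≥0∞ := fun n x =>
    ENNReal.ofReal (regWeight γ (ε n) y x * regAbs (ε n) ‖σ x‖ ^ (-r)) with hf
  have hk0 : 0 ≤ IsStressField.negPowConst (Fintype.card ι) r c₀ b₀ m c K := by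
    unfold IsStressField.negPowConst IsStressField.secondOrderConst; positivity
  have hreg : ∀ n x, 0 < regAbs (ε n) ‖σ x‖ := fun n x =>
    (hε0 n).trans_le (le_regAbs (norm_nonneg _))
  have bound : ∀ n, ∫⁻ x in S, f n x ≤
      ENNReal.ofReal (IsStressField.negPowConst (Fintype.card ι) r c₀ b₀ m c K * C) ∧
      AEMeasurable (f n) (volume.restrict S) := by
    intro n
    obtain ⟨ψ, Θ, h1, h2, h3⟩ := hC y hy (ε n) (hε0 n) (hε1 n)
    obtain ⟨hcont, hle⟩ := H.neg_power_estimate h1 hr0 hr1 hc₀ hb₀ hm hc hK (hε0 n)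
    have hfe : ∀ x ∈ S, f n x = ENNReal.ofReal (ψ x * regAbs (ε n) ‖σ x‖ ^ (-r)) := fun x hx => by
      simp only [hf, h2 x hx]
    have hnn : ∀ x, 0 ≤ ψ x * regAbs (ε n) ‖σ x‖ ^ (-r) := fun x =>
      mul_nonneg (h1.nonneg x) (Real.rpow_nonneg (hreg n x).le _)
    have hint : Integrable (fun x => ψ x * regAbs (ε n) ‖σ x‖ ^ (-r)) :=
      hcont.integrable_of_hasCompactSupport
        (HasCompactSupport.intro h1.compact.isCompact fun x hx => by
          rw [image_eq_zero_of_notMem_tsupport hx, zero_mul])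
    constructor
    · rw [setLIntegral_congr_fun hS.measurableSet hfe]
      refine (setLIntegral_le_lintegral _ _).trans ?_
      rw [← ofReal_integral_eq_lintegral_ofReal hint (Eventually.of_forall hnn)]
      exact ENNReal.ofReal_le_ofReal (hle.trans (mul_le_mul_of_nonneg_left h3 hk0))
    · refine AEMeasurable.congr (f := fun x => ENNReal.ofReal (ψ x * regAbs (ε n) ‖σ x‖ ^ (-r)))
        (hcont.measurable.ennreal_ofReal.aemeasurable) ?_
      filter_upwards [ae_restrict_mem hS.measurableSet] with x hx
      exact (hfe x hx).symm
  have fatou := lintegral_liminf_le' (u := atTop) (fun n => (bound n).2)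
  refine le_trans ?_ (fatou.trans (Filter.liminf_le_of_frequently_le'
    (Eventually.of_forall fun n => (bound n).1).frequently))
  refine lintegral_mono_ae ?_
  have hae : ∀ᵐ x ∂(volume.restrict S), x ≠ y := ae_restrict_of_ae (by simp [ae_iff])
  filter_upwards [hae] with x hxy
  have hpos : 0 < ‖x - y‖ := norm_pos_iff.2 (sub_ne_zero.2 hxy)
  have tw : Tendsto (fun n => regWeight γ (ε n) y x) atTop (𝓝 (‖x - y‖ ^ (-γ))) := by
    have t1 : Tendsto (fun n => ‖x - y‖ ^ 2 + ε n ^ 2) atTop (𝓝 (‖x - y‖ ^ 2)) := by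
      simpa using (hεt.pow 2).const_add (‖x - y‖ ^ 2)
    have t2 := t1.rpow_const (p := -(γ / 2)) (Or.inl (by positivity))
    have e : (‖x - y‖ ^ 2) ^ (-(γ / 2)) = ‖x - y‖ ^ (-γ) := by
      rw [← Real.rpow_natCast, ← Real.rpow_mul hpos.le]
      congr 1; push_cast; ring
    rwa [e] at t2
  unfold singularDensity
  split_ifs with h0
  -- At a zero of σ the regularized modulus equals `ε n`, whose negative powers diverge. The limit
  -- thus keeps the value ∞ on the zero set, which later forces that set to be null.
  · have t1 : Tendsto (fun n => regAbs (ε n) ‖σ x‖ ^ (-r)) atTop atTop := by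
      have : ∀ n, regAbs (ε n) ‖σ x‖ = ε n := fun n => regAbs_eq (by simp [h0, (hε0 n).le])
      simp_rw [this]
      refine (tendsto_rpow_neg_nhdsGT_zero (by linarith)).comp
        (tendsto_nhdsWithin_iff.2 ⟨hεt, Eventually.of_forall hε0⟩)
    have t2 := tw.pos_mul_atTop (by positivity) t1
    have t3 := ENNReal.tendsto_ofReal_atTop.comp t2
    exact (t3.liminf_eq).ge
  · have hs : 0 < ‖σ x‖ := norm_pos_iff.2 h0
    have t1 : Tendsto (fun n => regAbs (ε n) ‖σ x‖ ^ (-r)) atTop (𝓝 (‖σ x‖ ^ (-r))) :=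
      (tendsto_regAbs hs hεt).rpow_const (Or.inl hs.ne')
    have t2 := ENNReal.tendsto_ofReal (tw.mul t1)
    refine le_of_eq_of_le ?_ (t2.liminf_eq).ge
    rw [Real.rpow_neg hpos.le, mul_comm, one_div]

end Limit

/-! ### Linear algebra of the derivative of the stress field. -/

section LinearAlgebra

variable {E : Type*} [NormedAddCommGroup E] [InnerProductSpace ℝ E] {ι : Type*} [Fintype ι]

/-- The operator norm is dominated by the Hilbert–Schmidt norm, by expansion in the basis and
Cauchy–Schwarz. -/
theorem norm_sq_le_sum_norm_sq (b : OrthonormalBasis ι ℝ E) (X : E →L[ℝ] E) :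
    ‖X‖ ^ 2 ≤ ∑ i, ‖X (b i)‖ ^ 2 := by
  have h0 : 0 ≤ ∑ i, ‖X (b i)‖ ^ 2 := Finset.sum_nonneg fun i _ => sq_nonneg _
  rw [← Real.sqrt_le_sqrt_iff h0, Real.sqrt_sq (norm_nonneg _)]
  refine X.opNorm_le_bound (Real.sqrt_nonneg _) fun v => ?_
  refine (abs_le_of_sq_le_sq' ?_ (by positivity)).2
  rw [mul_pow, Real.sq_sqrt h0]
  have h1 : ‖X v‖ ≤ ∑ i, ‖X (b i)‖ * |inner ℝ (b i) v| := by
    conv_lhs => rw [← b.sum_repr' v, map_sum]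
    refine (norm_sum_le _ _).trans (Finset.sum_le_sum fun i _ => ?_)
    rw [map_smul, norm_smul, mul_comm, Real.norm_eq_abs]
  have h2 : ∑ i, |inner ℝ (b i) v| ^ 2 = ‖v‖ ^ 2 := by
    rw [← b.sum_sq_norm_inner_right v]
    exact Finset.sum_congr rfl fun i _ => by rw [Real.norm_eq_abs]
  calc ‖X v‖ ^ 2 ≤ (∑ i, ‖X (b i)‖ * |inner ℝ (b i) v|) ^ 2 := by gcongr
    _ ≤ (∑ i, ‖X (b i)‖ ^ 2) * ∑ i, |inner ℝ (b i) v| ^ 2 := Finset.sum_mul_sq_le_sq_mul_sq _ _ _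
    _ = _ := by rw [h2]

theorem sum_inner_mul_inner_left (b : OrthonormalBasis ι ℝ E) (x y : E) :
    ∑ i, inner ℝ x (b i) * inner ℝ y (b i) = inner ℝ x y := by
  rw [← b.sum_inner_mul_inner x y]
  exact Finset.sum_congr rfl fun i _ => by rw [real_inner_comm y (b i)]

/-- For a symmetric operator, the part orthogonal to a unit vector has nonnegative square norm. -/
theorem two_mul_norm_sq_sub_le_sum_norm_sq (b : OrthonormalBasis ι ℝ E) {X : E →L[ℝ] E}
    (hX : ∀ v w, inner ℝ (X v) w = inner ℝ v (X w)) {n : E} (hn : ‖n‖ = 1) :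
    2 * ‖X n‖ ^ 2 - inner ℝ n (X n) ^ 2 ≤ ∑ i, ‖X (b i)‖ ^ 2 := by
  set y := X n with hy
  set s := inner ℝ n y with hs
  have hnn : inner ℝ n n = (1 : ℝ) := by rw [real_inner_self_eq_norm_sq, hn, one_pow]
  -- The vector inside the norm is PXP b i, with P the orthogonal projection onto the complement of
  -- n. Its square norms sum to the left-over ‖X‖²_HS - 2|Xn|² + (n·Xn)².
  have key : ∀ i, ‖X (b i) - inner ℝ n (b i) • y
      - (inner ℝ y (b i) - s * inner ℝ n (b i)) • n‖ ^ 2 =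
      ‖X (b i)‖ ^ 2 + (‖y‖ ^ 2 - s ^ 2) * (inner ℝ n (b i) * inner ℝ n (b i))
        - inner ℝ y (b i) * inner ℝ y (b i) + 2 * s * (inner ℝ n (b i) * inner ℝ y (b i))
        - 2 * (inner ℝ n (b i) * inner ℝ (X y) (b i)) := by
    intro i
    have e1 : inner ℝ (X (b i)) y = inner ℝ (X y) (b i) := by
      rw [hX, real_inner_comm]
    have e2 : inner ℝ (X (b i)) n = inner ℝ y (b i) := by
      rw [hX, real_inner_comm]
    have e3 : inner ℝ y n = s := real_inner_comm _ _
    have e4 : inner ℝ y y = ‖y‖ ^ 2 := real_inner_self_eq_norm_sq y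
    have e5 : inner ℝ (X (b i)) (X (b i)) = ‖X (b i)‖ ^ 2 := real_inner_self_eq_norm_sq _
    rw [← real_inner_self_eq_norm_sq]
    simp only [inner_sub_left, inner_sub_right, real_inner_smul_left, real_inner_smul_right,
      real_inner_comm (X (b i)) y, real_inner_comm (X (b i)) n]
    simp only [e1, e2, e3, e4, e5, hnn, ← hs]
    ring
  have hsum : 0 ≤ ∑ i, ‖X (b i) - inner ℝ n (b i) • y
      - (inner ℝ y (b i) - s * inner ℝ n (b i)) • n‖ ^ 2 :=
    Finset.sum_nonneg fun i _ => sq_nonneg _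
  simp only [key, Finset.sum_sub_distrib, Finset.sum_add_distrib, ← Finset.mul_sum,
    sum_inner_mul_inner_left, hnn] at hsum
  have e6 : inner ℝ n (X y) = ‖y‖ ^ 2 := by rw [← hX, real_inner_self_eq_norm_sq]
  rw [e6, real_inner_self_eq_norm_sq y, ← hs] at hsum
  linarith

/-- Coercivity of the derivative of the stress field, which is of the form
`a (X + κ n ⊗ X n)` with `X` the Hessian and `n` the direction of the gradient. -/
theorem stress_derivative_coercive (b : OrthonormalBasis ι ℝ E) {X T : E →L[ℝ] E}
    (hX : ∀ v w, inner ℝ (X v) w = inner ℝ v (X w)) {n : E} (hn : ‖n‖ = 1) {a κ k₀ k₁ r : ℝ}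
    (hT : ∀ v, T v = a • (X v + (κ * inner ℝ n (X v)) • n)) (hk₀ : -1 < k₀) (hκ₀ : k₀ ≤ κ)
    (hκ₁ : κ ≤ k₁) (hr0 : 0 < r) (hr1 : r < 1) :
    (1 - r) * min 1 ((1 + k₀) ^ 2) / (2 + |k₁|) ^ 2 * ‖T‖ ^ 2 ≤
      ∑ i, inner ℝ (b i) (T (T (b i))) - r * inner ℝ n (T (T n)) ∧
    inner ℝ n (T n) ^ 2 ≤ inner ℝ n (T (T n)) := by
  have hQ := two_mul_norm_sq_sub_le_sum_norm_sq b hX hn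
  have hHS := norm_sq_le_sum_norm_sq b X
  have hCS : inner ℝ n (X n) ^ 2 ≤ ‖X n‖ ^ 2 := by
    have := abs_real_inner_le_norm n (X n)
    rw [hn, one_mul] at this
    exact sq_le_sq' (abs_le.1 this).1 (abs_le.1 this).2
  have hnn : inner ℝ n n = (1 : ℝ) := by rw [real_inner_self_eq_norm_sq, hn, one_pow]
  set y := X n with hy
  set s := inner ℝ n y with hs
  set H := ∑ i, ‖X (b i)‖ ^ 2 with hH
  have hys : inner ℝ y n = s := real_inner_comm _ _
  have inT : ∀ w v, inner ℝ w (T v) = a * (inner ℝ (X w) v + κ * inner ℝ y v * inner ℝ w n) := by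
    intro w v
    rw [hT, real_inner_smul_right, inner_add_right, real_inner_smul_right, ← hX, ← hX n v]
  have nT : ∀ v, inner ℝ n (T v) = a * (1 + κ) * inner ℝ y v := by
    intro v
    rw [inT, hnn]; ring
  have e1 : inner ℝ n (T n) = a * (1 + κ) * s := by rw [nT, hys]
  have e2 : inner ℝ n (T (T n)) = a ^ 2 * (1 + κ) * (‖y‖ ^ 2 + κ * s ^ 2) := by
    rw [nT, inT, hys, hX, ← hy, real_inner_self_eq_norm_sq]; ring
  have e3 : ∑ i, inner ℝ (b i) (T (T (b i))) = a ^ 2 * (H + 2 * κ * ‖y‖ ^ 2 + κ ^ 2 * s ^ 2) := by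
    have key : ∀ i, inner ℝ (b i) (T (T (b i))) = a ^ 2 * (‖X (b i)‖ ^ 2
        + κ * (inner ℝ y (b i) * inner ℝ y (b i)) + κ * (inner ℝ n (b i) * inner ℝ (X y) (b i))
        + κ ^ 2 * s * (inner ℝ n (b i) * inner ℝ y (b i))) := by
      intro i
      have f1 : inner ℝ (X (b i)) n = inner ℝ y (b i) := by rw [hX, real_inner_comm]
      have f2 : inner ℝ (b i) n = inner ℝ n (b i) := real_inner_comm _ _
      rw [inT, inT, inT, f1, f2, real_inner_comm, hys, ← hX, real_inner_self_eq_norm_sq]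
      ring
    simp only [key, ← Finset.mul_sum, Finset.sum_add_distrib, sum_inner_mul_inner_left]
    have f3 : inner ℝ n (X y) = ‖y‖ ^ 2 := by rw [← hX, real_inner_self_eq_norm_sq]
    rw [f3, real_inner_self_eq_norm_sq y, ← hs, ← hH]
    ring
  have hκ : 0 < 1 + κ := by linarith
  have ha : 0 ≤ a ^ 2 := sq_nonneg a
  have hs2 : 0 ≤ s ^ 2 := sq_nonneg s
  set μ := min 1 ((1 + k₀) ^ 2) with hμ
  have hμ0 : 0 ≤ μ := le_min zero_le_one (sq_nonneg _)
  have hμ1 : μ ≤ 1 := min_le_left _ _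
  have hμ2 : μ ≤ (1 + κ) ^ 2 := (min_le_right _ _).trans (by gcongr; linarith)
  -- If 1 + κ ≤ 1 then (1 + κ)² ≤ 1 + κ; otherwise μ ≤ 1 suffices.
  have hμ3 : μ ≤ 1 + κ := by
    rcases le_total 1 (1 + κ) with h | h
    · linarith
    · nlinarith
  constructor
  · rw [e2, e3]
    have hTn : ‖T‖ ≤ |a| * ((2 + |k₁|) * ‖X‖) := by
      refine T.opNorm_le_bound (by positivity) fun v => ?_
      -- Follows from -1 < κ ≤ k₁; it is the source of the denominator (2 + |k₁|)².
      have hκa : |κ| ≤ 1 + |k₁| := by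
        rw [abs_le]
        have h1 := neg_abs_le k₁
        have h2 := le_abs_self k₁
        constructor <;> linarith
      have h1 := X.le_opNorm v
      have h2 : |inner ℝ n (X v)| ≤ ‖X v‖ := by
        have := abs_real_inner_le_norm n (X v)
        rwa [hn, one_mul] at this
      rw [hT, norm_smul, Real.norm_eq_abs, mul_assoc]
      gcongr
      calc ‖X v + (κ * inner ℝ n (X v)) • n‖ ≤ ‖X v‖ + |κ| * |inner ℝ n (X v)| := by
            refine (norm_add_le _ _).trans ?_
            rw [norm_smul, hn, mul_one, Real.norm_eq_abs, abs_mul]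
        _ ≤ ‖X v‖ + (1 + |k₁|) * ‖X v‖ := by gcongr
        _ = (2 + |k₁|) * ‖X v‖ := by ring
        _ ≤ (2 + |k₁|) * (‖X‖ * ‖v‖) := by gcongr
        _ = _ := by ring
    have hT2 : ‖T‖ ^ 2 ≤ a ^ 2 * ((2 + |k₁|) ^ 2 * H) := by
      calc ‖T‖ ^ 2 ≤ (|a| * ((2 + |k₁|) * ‖X‖)) ^ 2 := by gcongr
        _ = a ^ 2 * ((2 + |k₁|) ^ 2 * ‖X‖ ^ 2) := by rw [mul_pow, sq_abs, mul_pow]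
        _ ≤ _ := by gcongr
    have h1r : 0 ≤ 1 - r := by linarith
    have step1 : (1 - r) * μ / (2 + |k₁|) ^ 2 * ‖T‖ ^ 2 ≤ a ^ 2 * ((1 - r) * (μ * H)) := by
      calc _ ≤ (1 - r) * μ / (2 + |k₁|) ^ 2 * (a ^ 2 * ((2 + |k₁|) ^ 2 * H)) := by gcongr
        _ = _ := by
          have : 0 < 2 + |k₁| := by positivity
          field_simp
    -- The three groups are the tangential block, the mixed block and the normal entry of X. In tr
    -- T² they carry the weights 1, 2(1+κ), (1+κ)²; in n·T²n only (1+κ) and (1+κ)² occur, on the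
    -- last two. Hence subtracting r times the latter loses at most the factor 1 - r.
    have step2 : μ * H ≤ (H - 2 * ‖y‖ ^ 2 + s ^ 2) + 2 * (1 + κ) * (‖y‖ ^ 2 - s ^ 2)
        + (1 + κ) ^ 2 * s ^ 2 := by
      have g1 : μ * (H - 2 * ‖y‖ ^ 2 + s ^ 2) ≤ 1 * (H - 2 * ‖y‖ ^ 2 + s ^ 2) :=
        mul_le_mul_of_nonneg_right hμ1 (by linarith)
      have g2 : μ * (‖y‖ ^ 2 - s ^ 2) ≤ (1 + κ) * (‖y‖ ^ 2 - s ^ 2) :=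
        mul_le_mul_of_nonneg_right hμ3 (by linarith)
      have g3 : μ * s ^ 2 ≤ (1 + κ) ^ 2 * s ^ 2 := mul_le_mul_of_nonneg_right hμ2 hs2
      linarith
    have step3 : (1 - r) * ((H - 2 * ‖y‖ ^ 2 + s ^ 2) + 2 * (1 + κ) * (‖y‖ ^ 2 - s ^ 2)
        + (1 + κ) ^ 2 * s ^ 2) ≤ (H + 2 * κ * ‖y‖ ^ 2 + κ ^ 2 * s ^ 2)
          - r * ((1 + κ) * (‖y‖ ^ 2 + κ * s ^ 2)) := by
      have g1 : 0 ≤ r * (H - 2 * ‖y‖ ^ 2 + s ^ 2) := mul_nonneg hr0.le (by linarith)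
      have g2 : 0 ≤ r * ((1 + κ) * (‖y‖ ^ 2 - s ^ 2)) :=
        mul_nonneg hr0.le (mul_nonneg hκ.le (by linarith))
      linarith
    calc _ ≤ _ := step1
      _ ≤ a ^ 2 * ((H + 2 * κ * ‖y‖ ^ 2 + κ ^ 2 * s ^ 2)
          - r * ((1 + κ) * (‖y‖ ^ 2 + κ * s ^ 2))) := by
        gcongr
        exact (mul_le_mul_of_nonneg_left step2 h1r).trans step3
      _ = _ := by ring
  · rw [e1, e2]
    have : 0 ≤ a ^ 2 * (1 + κ) * (‖y‖ ^ 2 - s ^ 2) :=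
      mul_nonneg (mul_nonneg ha hκ.le) (by linarith)
    linarith

end LinearAlgebra

/-! ### Growth of A and B from the structural assumptions. -/

namespace AdmissibleA

variable {N : ℕ} {p c₂ mA MA : ℝ} {A : ℝ → ℝ}

theorem hasDerivAt (hA : AdmissibleA N p c₂ mA MA A) {t : ℝ} (ht : 0 < t) :
    HasDerivAt A (deriv A t) t :=
  ((hA.contDiffOn.contDiffAt (Ioi_mem_nhds ht)).differentiableAt one_ne_zero).hasDerivAt

theorem le_logDeriv (hA : AdmissibleA N p c₂ mA MA A) {t : ℝ} (ht : 0 < t) :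
    mA ≤ t * deriv A t / A t :=
  hA.isGLB.1 ⟨t, ht, rfl⟩

theorem logDeriv_le (hA : AdmissibleA N p c₂ mA MA A) {t : ℝ} (ht : 0 < t) :
    t * deriv A t / A t ≤ MA :=
  hA.isLUB.1 ⟨t, ht, rfl⟩

/-- The sign of this derivative is that of tA'/A - k. The choices k = m_A and k = M_A give power
bounds for A on either side of t = 1. -/
theorem hasDerivAt_mul_rpow (hA : AdmissibleA N p c₂ mA MA A) (k : ℝ) {t : ℝ} (ht : 0 < t) :
    HasDerivAt (fun t => A t * t ^ (-k)) (A t * t ^ (-k) / t * (t * deriv A t / A t - k)) t := by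
  refine ((hA.hasDerivAt ht).mul (Real.hasDerivAt_rpow_const (p := -k)
    (Or.inl ht.ne'))).congr_deriv ?_
  have := (hA.pos t ht).ne'
  rw [Real.rpow_sub_one ht.ne']
  field_simp
  ring

theorem monotoneOn_mul_rpow (hA : AdmissibleA N p c₂ mA MA A) :
    MonotoneOn (fun t => A t * t ^ (-mA)) (Ioi 0) := by
  refine monotoneOn_of_deriv_nonneg (convex_Ioi 0)
    (fun t ht => (hA.hasDerivAt_mul_rpow mA ht).continuousAt.continuousWithinAt)
    (fun t ht => ?_) (fun t ht => ?_)
  · rw [interior_Ioi] at ht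
    exact (hA.hasDerivAt_mul_rpow mA ht).differentiableAt.differentiableWithinAt
  · rw [interior_Ioi] at ht
    rw [(hA.hasDerivAt_mul_rpow mA ht).deriv]
    have h1 : 0 < t := ht
    have h2 := hA.pos t ht
    have h3 := hA.le_logDeriv ht
    exact mul_nonneg (by positivity) (by linarith)

theorem antitoneOn_mul_rpow (hA : AdmissibleA N p c₂ mA MA A) :
    AntitoneOn (fun t => A t * t ^ (-MA)) (Ioi 0) := by
  refine antitoneOn_of_deriv_nonpos (convex_Ioi 0)
    (fun t ht => (hA.hasDerivAt_mul_rpow MA ht).continuousAt.continuousWithinAt)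
    (fun t ht => ?_) (fun t ht => ?_)
  · rw [interior_Ioi] at ht
    exact (hA.hasDerivAt_mul_rpow MA ht).differentiableAt.differentiableWithinAt
  · rw [interior_Ioi] at ht
    rw [(hA.hasDerivAt_mul_rpow MA ht).deriv]
    have h1 : 0 < t := ht
    have h2 := hA.pos t ht
    have h3 := hA.logDeriv_le ht
    exact mul_nonpos_of_nonneg_of_nonpos (by positivity) (by linarith)

theorem le_mul_rpow_of_le_one (hA : AdmissibleA N p c₂ mA MA A) {t : ℝ} (ht : 0 < t)
    (h1 : t ≤ 1) : A t ≤ A 1 * t ^ mA := by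
  have := hA.monotoneOn_mul_rpow ht (mem_Ioi.2 one_pos) h1
  simp only [Real.one_rpow, mul_one, Real.rpow_neg ht.le] at this
  rwa [← div_eq_mul_inv, div_le_iff₀ (Real.rpow_pos_of_pos ht _)] at this

theorem le_mul_rpow_of_one_le (hA : AdmissibleA N p c₂ mA MA A) {t : ℝ} (h1 : 1 ≤ t) :
    A t ≤ A 1 * t ^ MA := by
  have ht : 0 < t := one_pos.trans_le h1
  have := hA.antitoneOn_mul_rpow (mem_Ioi.2 one_pos) ht h1
  simp only [Real.one_rpow, mul_one, Real.rpow_neg ht.le] at this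
  rwa [← div_eq_mul_inv, div_le_iff₀ (Real.rpow_pos_of_pos ht _)] at this

/-- Monotonicity of tA(t) reduces to t = L, where the upper power bound needs L ≥ 1; hence the later
use of `max L 1`. -/
theorem mul_le (hA : AdmissibleA N p c₂ mA MA A) {t L : ℝ} (ht : 0 < t) (hL : 1 ≤ L)
    (htL : t ≤ L) : t * A t ≤ A 1 * L ^ (1 + MA) := by
  have hL0 : 0 < L := one_pos.trans_le hL
  calc t * A t ≤ L * A L := hA.mono ht hL0 htL
    _ ≤ L * (A 1 * L ^ MA) := by gcongr; exact hA.le_mul_rpow_of_one_le hL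
    _ = _ := by rw [Real.rpow_add hL0, Real.rpow_one]; ring

/-- Vector monotonicity against ξ' = 0. -/
theorem rpow_le (hA : AdmissibleA N p c₂ mA MA A) (hN : 0 < N) {t : ℝ} (ht : 0 < t) :
    c₂ * t ^ (p - 2) ≤ A t := by
  have : Nonempty (Fin N) := ⟨⟨0, hN⟩⟩
  set e : EuclideanSpace ℝ (Fin N) := EuclideanSpace.single ⟨0, hN⟩ t with he
  have hne : ‖e‖ = t := by simp [he, abs_of_pos ht]
  have := hA.monotone_vec e 0
  simp only [smul_zero, sub_zero, norm_zero, add_zero, real_inner_smul_left,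
    real_inner_self_eq_norm_sq, hne] at this
  exact le_of_mul_le_mul_right this (by positivity)

/-- Otherwise c₂ ≤ A(1)t^(m_A-(p-2)) → 0 as t → 0. For p < 2 it yields m_A < 0, so the exponent α is
meaningful and negative. -/
theorem lower_exponent_le (hA : AdmissibleA N p c₂ mA MA A) (hN : 0 < N) : mA ≤ p - 2 := by
  by_contra! hlt
  have h1 : ∀ t ∈ Ioc (0 : ℝ) 1, c₂ ≤ A 1 * t ^ (mA - (p - 2)) := by
    intro t ht
    have h2 := (hA.rpow_le hN ht.1).trans (hA.le_mul_rpow_of_le_one ht.1 ht.2)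
    rw [Real.rpow_sub ht.1, mul_div_assoc', le_div_iff₀ (Real.rpow_pos_of_pos ht.1 _)]
    exact h2
  have h3 : Tendsto (fun t : ℝ => A 1 * t ^ (mA - (p - 2))) (𝓝[>] 0) (𝓝 0) := by
    have h4 : ContinuousAt (fun t : ℝ => A 1 * t ^ (mA - (p - 2))) 0 :=
      continuousAt_const.mul (Real.continuousAt_rpow_const 0 _ (Or.inr (by linarith)))
    have h5 := h4.tendsto
    rw [Real.zero_rpow (by linarith), mul_zero] at h5
    exact h5.mono_left nhdsWithin_le_nhds
  have h6 : c₂ ≤ 0 := by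
    refine ge_of_tendsto h3 ?_
    filter_upwards [Ioc_mem_nhdsGT one_pos] with t ht using h1 t ht
  exact absurd hA.c₂_pos (not_lt.2 h6)

/-- Comparison of the weight `A ^ (-α r)` with a negative power of `t A(t)`. -/
theorem exists_weight_le (hN : 0 < N) (hp2 : p ≠ 2) (a₁ : ℝ) {r L : ℝ} (hr0 : 0 < r) (hL : 1 ≤ L) :
    ∃ C : ℝ, 0 ≤ C ∧ ∀ A : ℝ → ℝ, AdmissibleA N p c₂ mA MA A → A 1 = a₁ → ∀ t, 0 < t → t ≤ L →
      1 / A t ^ (weightExp p mA * r) ≤ C * (t * A t) ^ (-r) := by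
  -- it suffices to bound `t A(t)` by a multiple of `A(t) ^ α`
  have red : ∀ A : ℝ → ℝ, AdmissibleA N p c₂ mA MA A → ∀ t D, 0 < t → 0 ≤ D →
      t * A t ≤ D * A t ^ weightExp p mA →
      1 / A t ^ (weightExp p mA * r) ≤ D ^ r * (t * A t) ^ (-r) := by
    intro A hA t D ht hD h
    have hAt := hA.pos t ht
    have h1 : (t * A t) ^ r ≤ D ^ r * A t ^ (weightExp p mA * r) := by
      rw [Real.rpow_mul hAt.le, ← Real.mul_rpow hD (by positivity)]
      exact Real.rpow_le_rpow (by positivity) h hr0.le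
    rw [Real.rpow_neg (by positivity), div_le_iff₀ (by positivity)]
    rw [mul_assoc, mul_comm _ (A t ^ _), ← mul_assoc, ← div_eq_mul_inv, le_div_iff₀ (by positivity),
      one_mul]
    exact h1
  rcases lt_or_gt_of_ne hp2 with hp | hp
  · -- singular case
    -- The two summands of D serve t ≤ 1, where A ≤ a₁t^(m_A) is inverted with m_A < 0, and t ≥ 1,
    -- where tA and A are at most m and α < 0. Absolute values keep D nonnegative before the signs
    -- of a₁ and m are known.
    set m := a₁ * L ^ (1 + MA) with hm
    set D := |a₁| ^ (-(1 / mA)) + |m| * |m| ^ (-weightExp p mA) with hD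
    have hD0 : 0 ≤ D := by positivity
    refine ⟨D ^ r, by positivity, fun A hA h1 t ht htL => red A hA t D ht hD0 ?_⟩
    have hAt := hA.pos t ht
    have ha : 0 < a₁ := h1 ▸ hA.pos 1 one_pos
    have hmA : mA < 0 := (hA.lower_exponent_le hN).trans_lt (by linarith)
    have hα : weightExp p mA = 1 + 1 / mA := by
      unfold weightExp
      rw [if_neg (by linarith), add_div, div_self hmA.ne]
    have hα0 : weightExp p mA < 0 := by
      unfold weightExp
      rw [if_neg (by linarith)]
      exact div_neg_of_pos_of_neg (by linarith [hA.neg_one_lt]) hmA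
    rcases le_total t 1 with h | h
    · have h2 := hA.le_mul_rpow_of_le_one ht h
      rw [h1] at h2
      have h3 : t ≤ a₁ ^ (-(1 / mA)) * A t ^ (1 / mA) := by
        have h4 : A t / a₁ ≤ t ^ mA := by rw [div_le_iff₀ ha]; linarith
        have h5 := Real.rpow_le_rpow_of_nonpos (div_pos hAt ha) h4
          (le_of_lt (one_div_neg.2 hmA))
        rw [← Real.rpow_mul ht.le, mul_one_div_cancel hmA.ne, Real.rpow_one,
          Real.div_rpow hAt.le ha.le] at h5
        rw [Real.rpow_neg ha.le]
        calc t ≤ _ := h5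
          _ = _ := by ring
      calc t * A t ≤ a₁ ^ (-(1 / mA)) * A t ^ (1 / mA) * A t := by gcongr
        _ = a₁ ^ (-(1 / mA)) * A t ^ weightExp p mA := by
          rw [hα, Real.rpow_add hAt, Real.rpow_one]; ring
        _ ≤ D * A t ^ weightExp p mA := by
          gcongr
          rw [hD, abs_of_pos ha]
          have : 0 ≤ |m| * |m| ^ (-weightExp p mA) := by positivity
          linarith
    · have h2 := hA.mul_le ht hL htL
      rw [h1, ← hm] at h2
      have hm0 : 0 < m := (by positivity : 0 < t * A t).trans_le h2
      have h3 : A t ≤ m := le_trans (by nlinarith) h2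
      have h4 : m ^ weightExp p mA ≤ A t ^ weightExp p mA :=
        Real.rpow_le_rpow_of_nonpos hAt h3 hα0.le
      calc t * A t ≤ m := h2
        _ = m * m ^ (-weightExp p mA) * m ^ weightExp p mA := by
          rw [mul_assoc, ← Real.rpow_add hm0]; simp
        _ ≤ m * m ^ (-weightExp p mA) * A t ^ weightExp p mA := by gcongr
        _ ≤ D * A t ^ weightExp p mA := by
          gcongr
          rw [hD, abs_of_pos hm0]
          have : 0 ≤ |a₁| ^ (-(1 / mA)) := by positivity
          linarith
  · -- degenerate case
    refine ⟨(|c₂| ^ (-(1 / (p - 2)))) ^ r, by positivity, fun A hA h1 t ht htL =>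
      red A hA t _ ht (by positivity) ?_⟩
    have hAt := hA.pos t ht
    have hc := hA.c₂_pos
    have hp' : 0 < p - 2 := by linarith
    rw [abs_of_pos hc]
    have hα : weightExp p mA = 1 + 1 / (p - 2) := by
      unfold weightExp
      rw [if_pos (by linarith)]
      field_simp
      ring
    have h3 : t ≤ c₂ ^ (-(1 / (p - 2))) * A t ^ (1 / (p - 2)) := by
      have h4 : t ^ (p - 2) ≤ A t / c₂ := by
        rw [le_div_iff₀ hc]; linarith [hA.rpow_le hN ht]
      have h5 := Real.rpow_le_rpow (by positivity) h4 (one_div_pos.2 hp').le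
      rw [← Real.rpow_mul ht.le, mul_one_div_cancel hp'.ne', Real.rpow_one,
        Real.div_rpow hAt.le hc.le] at h5
      rw [Real.rpow_neg hc.le]
      calc t ≤ _ := h5
        _ = _ := by ring
    calc t * A t ≤ c₂ ^ (-(1 / (p - 2))) * A t ^ (1 / (p - 2)) * A t := by gcongr
      _ = _ := by rw [hα, Real.rpow_add hAt, Real.rpow_one]; ring

/-- The map `ξ ↦ A(|ξ|) ξ` is continuous. -/
theorem continuous_vec (hA : AdmissibleA N p c₂ mA MA A) :
    Continuous fun ξ : EuclideanSpace ℝ (Fin N) => A ‖ξ‖ • ξ := by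
  refine continuous_iff_continuousAt.2 fun ξ => ?_
  rcases eq_or_ne ξ 0 with rfl | h0
  · have h1 : Tendsto (fun ξ : EuclideanSpace ℝ (Fin N) => A 1 * ‖ξ‖ ^ (1 + mA)) (𝓝 0) (𝓝 0) := by
      have h2 : Continuous fun ξ : EuclideanSpace ℝ (Fin N) => A 1 * ‖ξ‖ ^ (1 + mA) :=
        continuous_const.mul (continuous_norm.rpow_const
          fun _ => Or.inr (by linarith [hA.neg_one_lt]))
      have h3 := h2.tendsto 0
      rwa [norm_zero, Real.zero_rpow (by linarith [hA.neg_one_lt]), mul_zero] at h3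
    rw [ContinuousAt, smul_zero]
    refine squeeze_zero_norm' ?_ h1
    filter_upwards [Metric.ball_mem_nhds (0 : EuclideanSpace ℝ (Fin N)) one_pos] with ξ hξ
    have hξ1 : ‖ξ‖ < 1 := by simpa using hξ
    rcases (norm_nonneg ξ).eq_or_lt with h | h
    · have : ξ = 0 := norm_eq_zero.1 h.symm
      subst this
      rw [smul_zero, norm_zero]
      have := hA.pos 1 one_pos
      have : (0 : ℝ) ≤ 0 ^ (1 + mA) := Real.rpow_nonneg le_rfl _
      positivity
    · rw [norm_smul, Real.norm_eq_abs, abs_of_pos (hA.pos _ h), Real.rpow_add h, Real.rpow_one]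
      have := hA.le_mul_rpow_of_le_one h hξ1.le
      nlinarith
  · exact ((hA.hasDerivAt (norm_pos_iff.2 h0)).continuousAt.comp
      continuous_norm.continuousAt).smul continuousAt_id

end AdmissibleA

/-- Mean value theorem from B(0) = 0, with ξA(ξ) ≤ tA(t). This makes B at most a multiple of |σ|
where |∇u| is bounded. -/
theorem AdmissibleB.le_mul {N : ℕ} {p c₂ mA MA Chat : ℝ} {A B : ℝ → ℝ}
    (hA : AdmissibleA N p c₂ mA MA A) (hB : AdmissibleB p Chat A B) {t : ℝ} (ht : 0 < t) :
    B t ≤ Chat * t * (t * A t) := by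
  have hcont : ContinuousOn B (Icc 0 t) := hB.contDiffOn.continuousOn.mono Icc_subset_Ici_self
  have hdiff : DifferentiableOn ℝ B (Ioo 0 t) :=
    (hB.contDiffOn.differentiableOn one_ne_zero).mono fun x hx => hx.1.le
  obtain ⟨ξ, hξ, h⟩ := exists_deriv_eq_slope B ht hcont hdiff
  rw [hB.zero, sub_zero, sub_zero, eq_div_iff ht.ne'] at h
  have h1 := hB.deriv_le ξ hξ.1
  have h2 : ξ * A ξ ≤ t * A t := hA.mono hξ.1 ht hξ.2.le
  have h3 := hB.Chat_pos
  calc B t = deriv B ξ * t := h.symm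
    _ ≤ Chat * (ξ * A ξ) * t := by gcongr; linarith
    _ ≤ Chat * (t * A t) * t := by gcongr
    _ = _ := by ring

/-! ### The Hessian as derivative of the gradient. -/

section Gradient

variable {E : Type*} [NormedAddCommGroup E] [InnerProductSpace ℝ E] [CompleteSpace E]

theorem gradient_eq_toDual_symm_comp (u : E → ℝ) :
    gradient u = fun x => (InnerProductSpace.toDual ℝ E).symm (fderiv ℝ u x) := rfl

theorem ContDiffAt.gradient {u : E → ℝ} {x : E} (hu : ContDiffAt ℝ 2 u x) :
    ContDiffAt ℝ 1 (gradient u) x := by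
  rw [gradient_eq_toDual_symm_comp]
  exact (InnerProductSpace.toDual ℝ E).symm.contDiff.contDiffAt.comp x
    (hu.fderiv_right (m := 1) le_rfl)

theorem ContDiffOn.continuousOn_gradient {u : E → ℝ} {V : Set E} (hV : IsOpen V)
    (hu : ContDiffOn ℝ 1 u V) : ContinuousOn (gradient u) V := by
  rw [gradient_eq_toDual_symm_comp]
  exact (InnerProductSpace.toDual ℝ E).symm.continuous.comp_continuousOn
    (hu.continuousOn_fderiv_of_isOpen hV le_rfl)

theorem inner_fderiv_gradient {u : E → ℝ} {x : E} (hu : ContDiffAt ℝ 2 u x) (v w : E) :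
    inner ℝ (fderiv ℝ (gradient u) x v) w = fderiv ℝ (fderiv ℝ u) x v w := by
  have h1 : DifferentiableAt ℝ (fderiv ℝ u) x :=
    (hu.fderiv_right (m := 1) le_rfl).differentiableAt one_ne_zero
  have h2 : DifferentiableAt ℝ (gradient u) x := hu.gradient.differentiableAt one_ne_zero
  have h3 : HasFDerivAt (fun y => innerSL ℝ w (gradient u y))
      ((innerSL ℝ w).comp (fderiv ℝ (gradient u) x)) x :=
    (innerSL ℝ w).hasFDerivAt.comp x h2.hasFDerivAt
  have h4 : HasFDerivAt (fun y => fderiv ℝ u y w)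
      ((fderiv ℝ (fderiv ℝ u) x).flip w) x := by
    simpa using h1.hasFDerivAt.clm_apply (hasFDerivAt_const w x)
  have h5 : (fun y => innerSL ℝ w (gradient u y)) = fun y => fderiv ℝ u y w := by
    ext y
    rw [innerSL_apply_apply, real_inner_comm, gradient_eq_toDual_symm_comp,
      InnerProductSpace.toDual_symm_apply]
  have h6 := DFunLike.congr_fun ((h5 ▸ h3).unique h4) v
  simpa [real_inner_comm] using h6

theorem inner_fderiv_gradient_symm {u : E → ℝ} {x : E} (hu : ContDiffAt ℝ 2 u x) (v w : E) :
    inner ℝ (fderiv ℝ (gradient u) x v) w = inner ℝ v (fderiv ℝ (gradient u) x w) := by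
  have hs : IsSymmSndFDerivAt ℝ u x := hu.isSymmSndFDerivAt (by
    rw [minSmoothness_of_isRCLikeNormedField])
  rw [inner_fderiv_gradient hu, real_inner_comm, inner_fderiv_gradient hu, hs.eq]

end Gradient

/-! ### The stress field of u and its derivative. -/

/-- The stress field `A(|∇u|) ∇u`. -/
noncomputable def stressOf {N : ℕ} (A : ℝ → ℝ) (u : EuclideanSpace ℝ (Fin N) → ℝ)
    (x : EuclideanSpace ℝ (Fin N)) : EuclideanSpace ℝ (Fin N) :=
  A ‖gradient u x‖ • gradient u x

section StressOf

variable {N : ℕ} {p c₂ mA MA : ℝ} {A : ℝ → ℝ} {u : EuclideanSpace ℝ (Fin N) → ℝ}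
  {x : EuclideanSpace ℝ (Fin N)}

theorem stressOf_eq_zero_iff (hA : AdmissibleA N p c₂ mA MA A) :
    stressOf A u x = 0 ↔ gradient u x = 0 := by
  refine ⟨fun h => ?_, fun h => by simp [stressOf, h]⟩
  by_contra h0
  rcases smul_eq_zero.1 h with h1 | h1
  · exact (hA.pos _ (norm_pos_iff.2 h0)).ne' h1
  · exact h0 h1

theorem norm_stressOf (hA : AdmissibleA N p c₂ mA MA A) (h0 : gradient u x ≠ 0) :
    ‖stressOf A u x‖ = ‖gradient u x‖ * A ‖gradient u x‖ := by
  rw [stressOf, norm_smul, Real.norm_eq_abs, abs_of_pos (hA.pos _ (norm_pos_iff.2 h0)), mul_comm]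

theorem unitDir_stressOf (hA : AdmissibleA N p c₂ mA MA A) (h0 : gradient u x ≠ 0) :
    unitDir (stressOf A u) x = unitDir (gradient u) x := by
  have h1 := (hA.pos _ (norm_pos_iff.2 h0)).ne'
  rw [unitDir, norm_stressOf hA h0, unitDir, stressOf, smul_smul]
  congr 1
  field_simp

theorem contDiffAt_stressOf (hA : AdmissibleA N p c₂ mA MA A) (h0 : gradient u x ≠ 0)
    (hu : ContDiffAt ℝ 2 u x) : ContDiffAt ℝ 1 (stressOf A u) x := by
  have h1 : ContDiffAt ℝ 1 (fun y => ‖gradient u y‖) x := hu.gradient.norm ℝ h0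
  have h2 : ContDiffAt ℝ 1 A ‖gradient u x‖ :=
    hA.contDiffOn.contDiffAt (Ioi_mem_nhds (norm_pos_iff.2 h0))
  have h3 : ContDiffAt ℝ 1 (A ∘ fun y => ‖gradient u y‖) x := ContDiffAt.comp x h2 h1
  exact h3.smul hu.gradient

/-- This is the form a(X + κ n⊗Xn) required for coercivity, with κ = tA'(t)/A(t) at t = |∇u|, so κ
lies between m_A and M_A. -/
theorem fderiv_stressOf (hA : AdmissibleA N p c₂ mA MA A) (h0 : gradient u x ≠ 0)
    (hu : ContDiffAt ℝ 2 u x) (v : EuclideanSpace ℝ (Fin N)) :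
    fderiv ℝ (stressOf A u) x v = A ‖gradient u x‖ • (fderiv ℝ (gradient u) x v +
      (‖gradient u x‖ * deriv A ‖gradient u x‖ / A ‖gradient u x‖ *
        inner ℝ (unitDir (gradient u) x) (fderiv ℝ (gradient u) x v)) •
          unitDir (gradient u) x) := by
  have hd : DifferentiableAt ℝ (gradient u) x := hu.gradient.differentiableAt one_ne_zero
  have hpos := norm_pos_iff.2 h0
  have h1 := (hA.hasDerivAt hpos).comp_hasFDerivAt x (hasFDerivAt_norm_comp hd h0)
  have h2 := h1.smul hd.hasFDerivAt
  have h3 : fderiv ℝ (stressOf A u) x = _ := h2.fderiv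
  have h4 := (hA.pos _ hpos).ne'
  rw [h3]
  simp only [add_apply, smul_apply, ContinuousLinearMap.smulRight_apply,
    ContinuousLinearMap.comp_apply, innerSL_apply_apply, Function.comp_apply, smul_eq_mul]
  rw [smul_add, smul_smul]
  congr 1
  have h5 : ‖gradient u x‖ • unitDir (gradient u) x = gradient u x := norm_smul_unitDir h0
  generalize ‖gradient u x‖ = t at *
  rw [← h5, smul_smul]
  congr 1
  field_simp

end StressOf

/-! ### Regular solutions yield abstract stress fields. -/

section RegularSolution

variable {N : ℕ} {p c₂ Chat mA MA a₁ : ℝ} {A B : ℝ → ℝ} {q ϑ : ℝ}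
  {Ω : Set (EuclideanSpace ℝ (Fin N))} {f u : EuclideanSpace ℝ (Fin N) → ℝ}

theorem IsTestFunction.memW0 {Ω : Set (EuclideanSpace ℝ (Fin N))}
    {φ : EuclideanSpace ℝ (Fin N) → ℝ} (hφ : IsTestFunction Ω φ) (p : ℝ) :
    MemW0 Ω p φ (gradient φ) := by
  have hc : Continuous (gradient φ) := by
    rw [gradient_eq_toDual_symm_comp]
    exact (InnerProductSpace.toDual ℝ _).symm.continuous.comp
      (hφ.1.continuous_fderiv (by simp))
  have hcs : HasCompactSupport (gradient φ) := by
    refine HasCompactSupport.intro hφ.2.1.isCompact fun x hx => ?_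
    rw [gradient_eq_toDual_symm_comp]
    simp [fderiv_eq_zero_of_notMem_tsupport hx]
  refine ⟨(hφ.1.continuous.memLp_of_hasCompactSupport hφ.2.1).restrict _,
    (hc.memLp_of_hasCompactSupport hcs).restrict _, fun _ => φ, fun _ => hφ, ?_, ?_⟩ <;>
  simp

theorem IsRegularSolution.isOpen_punctured
    (H : IsRegularSolution N p c₂ Chat mA MA a₁ A B q ϑ Ω f u) : IsOpen (Ω \ {0}) :=
  H.domain.1.sdiff isClosed_singleton

theorem IsRegularSolution.continuousOn_gradient
    (H : IsRegularSolution N p c₂ Chat mA MA a₁ A B q ϑ Ω f u) :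
    ContinuousOn (gradient u) (Ω \ {0}) :=
  H.regular.1.continuousOn_gradient H.isOpen_punctured

theorem IsRegularSolution.continuousOn_singular_term
    (H : IsRegularSolution N p c₂ Chat mA MA a₁ A B q ϑ Ω f u) :
    ContinuousOn (fun x => u x ^ q / ‖x‖ ^ p) (Ω \ {0}) := by
  refine (H.regular.1.continuousOn.rpow_const fun x hx =>
    Or.inl (H.solution.pos x hx).ne').div (continuousOn_id.norm.rpow_const fun x hx =>
      Or.inl (norm_ne_zero_iff.2 hx.2)) fun x hx => ?_
  exact (Real.rpow_pos_of_pos (norm_pos_iff.2 hx.2) _).ne'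

theorem IsRegularSolution.continuousOn_rhs
    (H : IsRegularSolution N p c₂ Chat mA MA a₁ A B q ϑ Ω f u) :
    ContinuousOn (fun x => rhs p q ϑ f x (u x)) (Ω \ {0}) :=
  (continuousOn_const.mul H.continuousOn_singular_term).add
    (H.memW1Infty.1.mono sdiff_subset)

theorem IsRegularSolution.continuousOn_B
    (H : IsRegularSolution N p c₂ Chat mA MA a₁ A B q ϑ Ω f u) :
    ContinuousOn (fun x => B ‖gradient u x‖) (Ω \ {0}) :=
  H.admissibleB.contDiffOn.continuousOn.comp H.continuousOn_gradient.norm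
    fun _ _ => mem_Ici.2 (norm_nonneg _)

theorem IsRegularSolution.continuousOn_stressOf
    (H : IsRegularSolution N p c₂ Chat mA MA a₁ A B q ϑ Ω f u) :
    ContinuousOn (stressOf A u) (Ω \ {0}) :=
  H.admissibleA.continuous_vec.comp_continuousOn H.continuousOn_gradient

theorem IsRegularSolution.contDiffAt_two
    (H : IsRegularSolution N p c₂ Chat mA MA a₁ A B q ϑ Ω f u) {x : EuclideanSpace ℝ (Fin N)}
    (hx : x ∈ Ω \ {0}) (h0 : gradient u x ≠ 0) : ContDiffAt ℝ 2 u x := by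
  have hopen : IsOpen {x ∈ Ω \ {0} | gradient u x ≠ 0} :=
    H.continuousOn_gradient.isOpen_inter_preimage H.isOpen_punctured isOpen_ne
  have heq : {x ∈ Ω \ {0} | gradient u x ≠ 0} = Ω \ (critSet Ω u ∪ {0}) := by
    ext z
    simp only [critSet, Set.mem_ofPred_eq, Set.mem_sdiff, mem_union, mem_singleton_iff, ne_eq]
    tauto
  exact (H.regular.2.2.mono heq.le).contDiffAt (hopen.mem_nhds ⟨hx, h0⟩)

/-- Test functions supported off the origin meet only continuous coefficients, so each integral of
the weak formulation converges separately and they can be recombined. -/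
theorem IsRegularSolution.isWeakDivEq
    (H : IsRegularSolution N p c₂ Chat mA MA a₁ A B q ϑ Ω f u) :
    IsWeakDivEq (Ω \ {0}) (stressOf A u)
      (fun x => rhs p q ϑ f x (u x) - B ‖gradient u x‖) := by
  intro φ hφ hc hs
  have hO := H.isOpen_punctured
  have htest : IsTestFunction Ω φ := ⟨hφ, hc, hs.trans sdiff_subset⟩
  have hw := H.solution.weak φ (gradient φ) (htest.memW0 p)
    ((hφ.continuous.memLp_of_hasCompactSupport hc).restrict _)
  have hoff : ∀ x ∉ Ω, φ x = 0 := fun x hx =>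
    image_eq_zero_of_notMem_tsupport fun h => hx (hs h).1
  have hoffD : ∀ x ∉ Ω, gradient φ x = 0 := fun x hx => by
    rw [gradient_eq_toDual_symm_comp]
    simp [fderiv_eq_zero_of_notMem_tsupport fun h => hx (hs h).1]
  rw [setIntegral_eq_integral_of_forall_compl_eq_zero (fun x hx => by simp [hoffD x hx]),
    setIntegral_eq_integral_of_forall_compl_eq_zero (fun x hx => by simp [hoff x hx]),
    setIntegral_eq_integral_of_forall_compl_eq_zero (fun x hx => by simp [hoff x hx]),
    setIntegral_eq_integral_of_forall_compl_eq_zero (fun x hx => by simp [hoff x hx])] at hw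
  have hint : ∀ k : EuclideanSpace ℝ (Fin N) → ℝ, ContinuousOn k (Ω \ {0}) →
      Integrable (fun x => k x * φ x) := fun k hk =>
    integrable_of_eq_zero_off hO (hk.mul hφ.continuous.continuousOn) hc.isCompact hs
      fun x hx => by simp [image_eq_zero_of_notMem_tsupport hx]
  have i1 := hint _ H.continuousOn_B
  have i2 := hint _ H.continuousOn_singular_term
  have i3 := hint _ (H.memW1Infty.1.mono sdiff_subset)
  have i4 : Integrable (fun x => ϑ * (u x ^ q / ‖x‖ ^ p * φ x) + f x * φ x) :=
    (i2.const_mul ϑ).add i3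
  have e1 : ∫ x, fderiv ℝ φ x (stressOf A u x) =
      ∫ x, A ‖gradient u x‖ * inner ℝ (gradient u x) (gradient φ x) := by
    refine integral_congr_ae (Eventually.of_forall fun x => ?_)
    simp only [stressOf, map_smul, smul_eq_mul]
    rw [real_inner_comm, gradient_eq_toDual_symm_comp φ, InnerProductSpace.toDual_symm_apply]
  have e2 : ∫ x, (rhs p q ϑ f x (u x) - B ‖gradient u x‖) * φ x =
      ϑ * (∫ x, u x ^ q / ‖x‖ ^ p * φ x) + (∫ x, f x * φ x) - ∫ x, B ‖gradient u x‖ * φ x := by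
    rw [← integral_const_mul, ← integral_add (i2.const_mul ϑ) i3,
      ← integral_sub i4 i1]
    refine integral_congr_ae (Eventually.of_forall fun x => ?_)
    simp only [rhs]
    ring
  rw [e1, e2]
  linarith

/-- The stress field of a regular solution satisfies the hypotheses of the abstract estimate. -/
theorem IsRegularSolution.isStressField
    (H : IsRegularSolution N p c₂ Chat mA MA a₁ A B q ϑ Ω f u)
    {V : Set (EuclideanSpace ℝ (Fin N))} (hV : IsOpen V) (hVΩ : V ⊆ Ω \ {0}) {r L c K : ℝ}
    (hr0 : 0 < r) (hr1 : r < 1) (hb : BoundsOn V p q ϑ f u L c K) :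
    IsStressField V (EuclideanSpace.basisFun (Fin N) ℝ) r
      ((1 - r) * min 1 ((1 + mA) ^ 2) / (2 + |MA|) ^ 2) (Chat * max L 1)
      (a₁ * max L 1 ^ (1 + MA)) c (max K 0) (stressOf A u) (fun x => B ‖gradient u x‖)
      (fun x => rhs p q ϑ f x (u x)) := by
  have hA := H.admissibleA
  have hcoer : ∀ x ∈ V, stressOf A u x ≠ 0 → _ := fun x hx h0 => by
    have h0' : gradient u x ≠ 0 := fun h => h0 ((stressOf_eq_zero_iff hA).2 h)
    have hu := H.contDiffAt_two (hVΩ hx) h0'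
    have hpos := norm_pos_iff.2 h0'
    exact stress_derivative_coercive (EuclideanSpace.basisFun (Fin N) ℝ)
      (inner_fderiv_gradient_symm hu) (norm_unitDir h0') (fderiv_stressOf hA h0' hu)
      hA.neg_one_lt (hA.le_logDeriv hpos) (hA.logDeriv_le hpos) hr0 hr1
  refine ⟨hV, H.continuousOn_stressOf.mono hVΩ, ?_, fun x hx h0 => ?_, fun x hx h0 => ?_,
    fun x hx => ?_, H.continuousOn_B.mono hVΩ, fun x hx => H.admissibleB.nonneg _ (norm_nonneg _),
    fun x hx => ?_, H.continuousOn_rhs.mono hVΩ, hb.2.2.1, fun x hx z hz => ?_,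
    H.isWeakDivEq.mono hVΩ⟩
  · rintro x ⟨hx, h0⟩
    have h0' : gradient u x ≠ 0 := fun h => h0 ((stressOf_eq_zero_iff hA).2 h)
    exact (contDiffAt_stressOf hA h0' (H.contDiffAt_two (hVΩ hx) h0')).contDiffWithinAt
  · rw [unitDir_stressOf hA fun h => h0 ((stressOf_eq_zero_iff hA).2 h)]
    exact (hcoer x hx h0).1
  · rw [unitDir_stressOf hA fun h => h0 ((stressOf_eq_zero_iff hA).2 h)]
    exact (hcoer x hx h0).2
  · rcases eq_or_ne (gradient u x) 0 with h0 | h0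
    · rw [(stressOf_eq_zero_iff hA).2 h0, norm_zero, ← H.normalization]
      have := hA.pos 1 one_pos
      positivity
    · rw [norm_stressOf hA h0, ← H.normalization]
      exact hA.mul_le (norm_pos_iff.2 h0) (le_max_right _ _)
        ((hb.2.1 x hx).trans (le_max_left _ _))
  · rcases eq_or_ne (gradient u x) 0 with h0 | h0
    · simp [h0, H.admissibleB.zero, (stressOf_eq_zero_iff hA).2 h0]
    · have hpos := norm_pos_iff.2 h0
      rw [norm_stressOf hA h0]
      refine (AdmissibleB.le_mul hA H.admissibleB hpos).trans ?_
      have h1 := hA.pos _ hpos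
      have h2 := H.admissibleB.Chat_pos
      gcongr
      exact (hb.2.1 x hx).trans (le_max_left _ _)
  · exact (hb.2.2.2 x hx z hz).trans (by gcongr; exact le_max_left _ _)

end RegularSolution

/-- Negative γ gives a weight bounded by a power of the diameter, so only γ ≥ 0 has to be treated.
-/
theorem exists_one_div_norm_rpow_le {E : Type*} [NormedAddCommGroup E] {S : Set E}
    (hS : Bornology.IsBounded S) (γ : ℝ) :
    ∃ D : ℝ, 0 < D ∧ ∀ x ∈ S, ∀ y ∈ S,
      1 / ‖x - y‖ ^ γ ≤ D * (1 / ‖x - y‖ ^ max γ 0) := by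
  rcases le_or_gt 0 γ with h | h
  · exact ⟨1, one_pos, fun x _ y _ => by rw [max_eq_left h, one_mul]⟩
  · refine ⟨Metric.diam S ^ (-γ) + 1, by have := Metric.diam_nonneg (s := S); positivity,
      fun x hx y hy => ?_⟩
    rw [max_eq_right h.le, Real.rpow_zero, div_one, mul_one, one_div,
      ← Real.rpow_neg (norm_nonneg _), ← dist_eq_norm]
    exact (Real.rpow_le_rpow dist_nonneg (Metric.dist_le_diam_of_mem hS hx hy)
      (by linarith)).trans (by linarith)

/-! ### The weighted estimate with structural constants. -/

section WeightedEstimate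

variable {N : ℕ} {p c₂ Chat mA MA a₁ r γ : ℝ}

/-- At critical points the right side is ∞, so the arbitrary value of A at 0 plays no role. -/
theorem weight_le_singularDensity {A : ℝ → ℝ} {u : EuclideanSpace ℝ (Fin N) → ℝ}
    {x y : EuclideanSpace ℝ (Fin N)} {s γ' M D L : ℝ} (hA : AdmissibleA N p c₂ mA MA A)
    (hM : 0 < M) (hD : 0 < D)
    (hw : ∀ t, 0 < t → t ≤ L → 1 / A t ^ s ≤ M * (t * A t) ^ (-r)) (hL : ‖gradient u x‖ ≤ L)
    (hk : 1 / ‖x - y‖ ^ γ ≤ D * (1 / ‖x - y‖ ^ γ')) :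
    ENNReal.ofReal (1 / A ‖gradient u x‖ ^ s * (1 / ‖x - y‖ ^ γ)) ≤
      ENNReal.ofReal (M * D) * singularDensity r γ' (stressOf A u) y x := by
  have hMD : 0 < M * D := mul_pos hM hD
  rcases eq_or_ne (gradient u x) 0 with h0 | h0
  · rw [singularDensity, if_pos ((stressOf_eq_zero_iff hA).2 h0), ENNReal.mul_top]
    · exact le_top
    · simpa using hMD
  · rw [singularDensity, if_neg fun h => h0 ((stressOf_eq_zero_iff hA).1 h),
      ← ENNReal.ofReal_mul hMD.le, norm_stressOf hA h0]
    have hpos := norm_pos_iff.2 h0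
    have h1 := hw _ hpos hL
    have h2 := hA.pos _ hpos
    refine ENNReal.ofReal_le_ofReal ?_
    calc _ ≤ M * (‖gradient u x‖ * A ‖gradient u x‖) ^ (-r) * (D * (1 / ‖x - y‖ ^ γ')) := by
          gcongr
      _ = _ := by ring

/-- The density is ∞ on the critical set, so a finite integral leaves that set no measure. -/
theorem IsRegularSolution.volume_critSet_inter_eq_zero {A B : ℝ → ℝ} {q ϑ : ℝ}
    {Ω : Set (EuclideanSpace ℝ (Fin N))} {f u : EuclideanSpace ℝ (Fin N) → ℝ}
    (H : IsRegularSolution N p c₂ Chat mA MA a₁ A B q ϑ Ω f u)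
    {S : Set (EuclideanSpace ℝ (Fin N))} (hS : IsCompact S) (hSΩ : S ⊆ Ω \ {0})
    {y : EuclideanSpace ℝ (Fin N)}
    (hfin : ∫⁻ x in S, singularDensity r γ (stressOf A u) y x ≠ ⊤) :
    volume (critSet Ω u ∩ S) = 0 := by
  have hT : critSet Ω u ∩ S = S ∩ gradient u ⁻¹' {0} := by
    ext z
    simp only [critSet, Set.mem_inter_iff, Set.mem_ofPred_eq, mem_preimage, mem_singleton_iff]
    exact ⟨fun h => ⟨h.2, h.1.2⟩, fun h => ⟨⟨hSΩ h.1, h.2⟩, h.1⟩⟩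
  have hmeas : MeasurableSet (S ∩ gradient u ⁻¹' {0}) :=
    ((H.continuousOn_gradient.mono hSΩ).preimage_isClosed_of_isClosed hS.isClosed
      isClosed_singleton).measurableSet
  rw [hT]
  by_contra hne
  refine hfin (top_le_iff.1 ?_)
  calc (⊤ : ℝ≥0∞) = ∫⁻ _ in S ∩ gradient u ⁻¹' {0}, ⊤ := by
        rw [setLIntegral_const, ENNReal.top_mul hne]
    _ ≤ ∫⁻ x in S ∩ gradient u ⁻¹' {0}, singularDensity r γ (stressOf A u) y x := by
        refine setLIntegral_mono' hmeas fun x hx => ?_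
        rw [singularDensity, if_pos ((stressOf_eq_zero_iff H.admissibleA).2 hx.2)]
    _ ≤ _ := lintegral_mono_set inter_subset_left

/-- The weighted estimate with a constant depending only on the structural constants and on
the bounds `L`, `c`, `K`. -/
theorem exists_weightIntegral_le (hp : 1 < p) (hpN : p < N) (hp2 : p ≠ 2) (hr0 : 0 < r)
    (hr1 : r < 1) (hγ : 3 ≤ N → γ < (N : ℝ) - 2) (hγ2 : N = 2 → γ = 0)
    {Ω' V : Set (EuclideanSpace ℝ (Fin N))} (hV : IsOpen V) (hΩ'V : CompactlyIn Ω' V)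
    (L c K : ℝ) :
    ∃ C : ℝ, ∀ (A B : ℝ → ℝ) (q ϑ : ℝ) (Ω : Set (EuclideanSpace ℝ (Fin N)))
      (f u : EuclideanSpace ℝ (Fin N) → ℝ),
      IsRegularSolution N p c₂ Chat mA MA a₁ A B q ϑ Ω f u → V ⊆ Ω \ {0} →
      BoundsOn V p q ϑ f u L c K →
      volume (critSet Ω u ∩ Ω') = 0 ∧
      ∀ y ∈ Ω', weightIntegral Ω' A u (weightExp p mA * r) γ y ≤ ENNReal.ofReal C := by
  -- The constant is chosen before any solution is given. If these signs fail, no solution with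
  -- bounds exists and the claim is vacuous.
  by_cases hdata : -1 < mA ∧ 0 < a₁ ∧ 0 < Chat ∧ 0 < c
  swap
  · refine ⟨0, fun A B q ϑ Ω f u H _ hb => absurd ⟨H.admissibleA.neg_one_lt, ?_,
      H.admissibleB.Chat_pos, hb.1⟩ hdata⟩
    rw [← H.normalization]
    exact H.admissibleA.pos 1 one_pos
  obtain ⟨hmA, ha₁, hChat, hc⟩ := hdata
  have hN2 : 2 ≤ N := by
    have : (1 : ℝ) < N := hp.trans hpN
    exact_mod_cast this
  have : Nonempty (Fin N) := ⟨⟨0, by omega⟩⟩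
  have : Nontrivial (EuclideanSpace ℝ (Fin N)) := inferInstance
  have hγ' : max γ 0 = 0 ∨ max γ 0 + 2 < Module.finrank ℝ (EuclideanSpace ℝ (Fin N)) := by
    rw [finrank_euclideanSpace_fin]
    rcases hN2.eq_or_lt with h | h
    · left; rw [hγ2 h.symm, max_self]
    · rcases le_total γ 0 with h0 | h0
      · left; exact max_eq_right h0
      · right; rw [max_eq_left h0]; linarith [hγ h]
  have hc₀ : 0 < (1 - r) * min 1 ((1 + mA) ^ 2) / (2 + |MA|) ^ 2 := by
    have h1 : 0 < 1 - r := by linarith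
    have h2 : 0 < 1 + mA := by linarith
    have h3 : 0 < min 1 ((1 + mA) ^ 2) := lt_min one_pos (by positivity)
    positivity
  obtain ⟨C, hC⟩ := exists_lintegral_singularDensity_le hΩ'V.1 hV hΩ'V.2 hr0 hr1
    (le_max_right γ 0) hγ' hc₀ (b₀ := Chat * max L 1) (by positivity)
    (m := a₁ * max L 1 ^ (1 + MA)) (by positivity) hc (K := max K 0) (le_max_right _ _)
    (EuclideanSpace.basisFun (Fin N) ℝ)
  obtain ⟨M, hM0, hM⟩ := AdmissibleA.exists_weight_le (c₂ := c₂) (mA := mA) (MA := MA)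
    (by omega : 0 < N) hp2 a₁ hr0 (le_max_right L 1)
  obtain ⟨D, hD0, hD⟩ := exists_one_div_norm_rpow_le hΩ'V.1.isBounded γ
  -- M + 1 makes the factor strictly positive, so that its product with ∞ is ∞ at critical points.
  refine ⟨(M + 1) * D * C, fun A B q ϑ Ω f u H hVΩ hb => ?_⟩
  have hA := H.admissibleA
  have hbound := hC _ _ _ (H.isStressField hV hVΩ hr0 hr1 hb)
  refine ⟨?_, fun y hy => ?_⟩
  · rcases Ω'.eq_empty_or_nonempty with rfl | ⟨y, hy⟩
    · simp
    · refine measure_mono_null (inter_subset_inter_right _ subset_closure)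
        (H.volume_critSet_inter_eq_zero hΩ'V.1 (hΩ'V.2.trans hVΩ) (y := y)
          (ne_top_of_le_ne_top ENNReal.ofReal_ne_top (hbound y (subset_closure hy))))
  · have hMD : 0 < (M + 1) * D := by positivity
    have hw : ∀ t, 0 < t → t ≤ max L 1 →
        1 / A t ^ (weightExp p mA * r) ≤ (M + 1) * (t * A t) ^ (-r) := fun t ht htL => by
      refine (hM A hA H.normalization t ht htL).trans ?_
      have := hA.pos t ht
      gcongr
      linarith
    calc weightIntegral Ω' A u (weightExp p mA * r) γ y
        ≤ ∫⁻ x in closure Ω', ENNReal.ofReal (1 / A ‖gradient u x‖ ^ (weightExp p mA * r) *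
            (1 / ‖x - y‖ ^ γ)) := lintegral_mono_set subset_closure
      _ ≤ ∫⁻ x in closure Ω', ENNReal.ofReal ((M + 1) * D) *
            singularDensity r (max γ 0) (stressOf A u) y x :=
          setLIntegral_mono' isClosed_closure.measurableSet fun x hx =>
            weight_le_singularDensity hA (by positivity) hD0 hw
              ((hb.2.1 x (hΩ'V.2 hx)).trans (le_max_left _ _)) (hD x hx y (subset_closure hy))
      _ = ENNReal.ofReal ((M + 1) * D) *
            ∫⁻ x in closure Ω', singularDensity r (max γ 0) (stressOf A u) y x :=
          lintegral_const_mul' _ _ ENNReal.ofReal_ne_top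
      _ ≤ ENNReal.ofReal ((M + 1) * D) * ENNReal.ofReal C := by
          gcongr
          exact hbound y (subset_closure hy)
      _ = _ := (ENNReal.ofReal_mul hMD.le).symm

end WeightedEstimate

/-! ### Functions in W^{1,∞} are locally Lipschitz. -/

section Mollification

variable {N : ℕ} {Ω : Set (EuclideanSpace ℝ (Fin N))} {f : EuclideanSpace ℝ (Fin N) → ℝ}
  {x : EuclideanSpace ℝ (Fin N)}

theorem isTestFunction_normed_sub (φ : ContDiffBump (0 : EuclideanSpace ℝ (Fin N)))
    (hx : Metric.closedBall x φ.rOut ⊆ Ω) :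
    IsTestFunction Ω fun y => φ.normed volume (x - y) := by
  have hsupp : tsupport (fun y => φ.normed volume (x - y)) ⊆ Metric.closedBall x φ.rOut := by
    refine closure_minimal (fun y hy => ?_) Metric.isClosed_closedBall
    have h1 : x - y ∈ tsupport (φ.normed volume) := subset_tsupport _ hy
    rw [φ.tsupport_normed_eq, mem_closedBall_zero_iff] at h1
    rwa [Metric.mem_closedBall, dist_comm, dist_eq_norm]
  exact ⟨φ.contDiff_normed.comp (contDiff_const.sub contDiff_id),
    (isCompact_closedBall x φ.rOut).of_isClosed_subset (isClosed_tsupport _) hsupp,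
    hsupp.trans hx⟩

/-- Mollifications of a function with weak gradient `G` bounded by `M` have derivative bounded
by `M`. -/
theorem norm_fderiv_mollification_le {G : EuclideanSpace ℝ (Fin N) → EuclideanSpace ℝ (Fin N)}
    {M : ℝ} (hΩ : IsOpen Ω) (hf : LocallyIntegrable (Ω.indicator f))
    (hG : ∀ φ, IsTestFunction Ω φ → ∫ x in Ω, f x • gradient φ x = - ∫ x in Ω, φ x • G x)
    (hM0 : 0 ≤ M) (hM : ∀ᵐ x ∂volume.restrict Ω, ‖G x‖ ≤ M)
    (φ : ContDiffBump (0 : EuclideanSpace ℝ (Fin N))) (hx : Metric.closedBall x φ.rOut ⊆ Ω) :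
    ∃ T : EuclideanSpace ℝ (Fin N) →L[ℝ] ℝ, ‖T‖ ≤ M ∧
      HasFDerivAt (fun z => ∫ y, Ω.indicator f y * φ.normed volume (z - y)) T x := by
  have hφ1 : ContDiff ℝ 1 (φ.normed volume) := φ.contDiff_normed
  have hd := φ.hasCompactSupport_normed.hasFDerivAt_convolution_right
    (ContinuousLinearMap.mul ℝ ℝ) hf hφ1 x
  refine ⟨_, ?_, hd⟩
  set ψ : EuclideanSpace ℝ (Fin N) → ℝ := fun y => φ.normed volume (x - y) with hψ
  have htest : IsTestFunction Ω ψ := isTestFunction_normed_sub φ hx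
  have hgrad : ∀ y, gradient ψ y = - gradient (φ.normed volume) (x - y) := fun y => by
    have h1 : HasFDerivAt ψ (- fderiv ℝ (φ.normed volume) (x - y)) y := by
      have h2 := ((hφ1.differentiable one_ne_zero) (x - y)).hasFDerivAt.comp y
        ((hasFDerivAt_id y).const_sub x)
      have h3 : (fderiv ℝ (φ.normed volume) (x - y)).comp
          (-ContinuousLinearMap.id ℝ (EuclideanSpace ℝ (Fin N))) =
            - fderiv ℝ (φ.normed volume) (x - y) := by
        ext w; simp
      rw [← h3]
      exact h2
    rw [gradient_eq_toDual_symm_comp, gradient_eq_toDual_symm_comp]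
    simp only
    rw [h1.fderiv, map_neg]
  have hψint : Integrable ψ := htest.1.continuous.integrable_of_hasCompactSupport htest.2.1
  have hψ0 : ∀ y, 0 ≤ ψ y := fun y => φ.nonneg_normed _
  have hψ1 : ∫ y, ψ y = 1 := by
    rw [hψ, integral_sub_left_eq_self (fun y => φ.normed volume y) volume x]
    exact φ.integral_normed
  have hGle : ‖∫ y in Ω, ψ y • G y‖ ≤ M := by
    calc ‖∫ y in Ω, ψ y • G y‖ ≤ ∫ y in Ω, ψ y * M := by
          refine norm_integral_le_of_norm_le (hψint.mul_const M).integrableOn ?_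
          filter_upwards [hM] with y hy
          rw [norm_smul, Real.norm_eq_abs, abs_of_nonneg (hψ0 y)]
          exact mul_le_mul_of_nonneg_left hy (hψ0 y)
      _ ≤ ∫ y, ψ y * M :=
          setIntegral_le_integral (hψint.mul_const M)
            (Eventually.of_forall fun y => mul_nonneg (hψ0 y) hM0)
      _ = M := by rw [integral_mul_const, hψ1, one_mul]
  have hvec : Integrable (fun y => Ω.indicator f y • gradient ψ y) := by
    have hc : Continuous (gradient ψ) := by
      rw [gradient_eq_toDual_symm_comp]
      exact (InnerProductSpace.toDual ℝ _).symm.continuous.comp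
        (htest.1.continuous_fderiv (by simp))
    refine hf.integrable_smul_right_of_hasCompactSupport hc
      (HasCompactSupport.intro htest.2.1.isCompact fun z hz => ?_)
    rw [gradient_eq_toDual_symm_comp]
    simp [fderiv_eq_zero_of_notMem_tsupport hz]
  have hset : ∫ y, Ω.indicator f y • gradient ψ y = ∫ y in Ω, f y • gradient ψ y := by
    rw [← integral_indicator hΩ.measurableSet]
    congr 1
    ext1 y
    by_cases hy : y ∈ Ω <;> simp [hy]
  refine ContinuousLinearMap.opNorm_le_bound _ hM0 fun v => ?_
  rw [convolution_precompR_apply _ hf (φ.hasCompactSupport_normed.fderiv ℝ)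
    (hφ1.continuous_fderiv one_ne_zero)]
  -- The reflected kernel ψ is a test function, so the weak gradient identity moves the derivative
  -- onto f: the derivative is an average of G against a probability density.
  have hkey : (MeasureTheory.convolution (Ω.indicator f)
      (fun a => fderiv ℝ (φ.normed volume) a v) (ContinuousLinearMap.mul ℝ ℝ) volume) x =
        inner ℝ (∫ y in Ω, ψ y • G y) v := by
    rw [← neg_neg (∫ y in Ω, ψ y • G y), ← hG ψ htest, ← hset, inner_neg_left,
      real_inner_comm, ← integral_inner hvec, ← integral_neg]
    refine integral_congr_ae (Eventually.of_forall fun y => ?_)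
    simp only [ContinuousLinearMap.mul_apply', hgrad, smul_neg, inner_neg_right, neg_neg,
      inner_smul_right]
    rw [gradient_eq_toDual_symm_comp, real_inner_comm, InnerProductSpace.toDual_symm_apply]
  rw [hkey]
  exact (norm_inner_le_norm _ _).trans (by gcongr)

/-- On a small ball the mollifications have derivative at most the essential bound of G, hence are
Lipschitz there by convexity. They converge pointwise to f because f is continuous. -/
theorem MemW1Infty.locallyLipschitzOn (hΩ : IsOpen Ω) (hf : MemW1Infty Ω f) :
    LocallyLipschitzOn Ω f := by
  obtain ⟨hcont, hmem, G, hGmem, hG⟩ := hf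
  set M : ℝ := (eLpNorm G ⊤ (volume.restrict Ω)).toReal with hMdef
  have hM : ∀ᵐ x ∂volume.restrict Ω, ‖G x‖ ≤ M := by
    filter_upwards [ae_le_eLpNormEssSup (f := G) (μ := volume.restrict Ω)] with y hy
    rw [← eLpNorm_exponent_top] at hy
    rw [← toReal_enorm]
    exact ENNReal.toReal_mono hGmem.2.ne hy
  have hloc : LocallyIntegrable (Ω.indicator f) :=
    ((memLp_indicator_iff_restrict hΩ.measurableSet).2 hmem).locallyIntegrable le_top
  intro x₀ hx₀
  obtain ⟨δ, hδ, hball⟩ := Metric.isOpen_iff.1 hΩ x₀ hx₀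
  have hsub : ∀ x ∈ Metric.ball x₀ (δ / 2), ∀ s < δ / 2, Metric.closedBall x s ⊆ Ω :=
    fun x hx s hs z hz => hball (by
      have h1 := Metric.mem_ball.1 hx
      have h2 := Metric.mem_closedBall.1 hz
      exact Metric.mem_ball.2 ((dist_triangle z x x₀).trans_lt (by linarith)))
  refine ⟨M.toNNReal, Metric.ball x₀ (δ / 2), mem_nhdsWithin_of_mem_nhds
    (Metric.ball_mem_nhds _ (by positivity)), LipschitzOnWith.of_dist_le_mul fun x hx z hz => ?_⟩
  rw [Real.coe_toNNReal _ ENNReal.toReal_nonneg]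
  let φ : ℕ → ContDiffBump (0 : EuclideanSpace ℝ (Fin N)) := fun n =>
    ⟨δ / 8 / (n + 1), δ / 4 / (n + 1), by positivity, by gcongr; norm_num⟩
  have hr : ∀ n, (φ n).rOut < δ / 2 := fun n => by
    have : (1 : ℝ) ≤ n + 1 := by simp
    calc δ / 4 / (n + 1) ≤ δ / 4 := div_le_self (by positivity) this
      _ < δ / 2 := by linarith
  have hlim0 : Tendsto (fun n => (φ n).rOut) atTop (𝓝 0) :=
    tendsto_const_nhds.div_atTop (tendsto_natCast_atTop_atTop.atTop_add tendsto_const_nhds)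
  have hlim : ∀ w ∈ Metric.ball x₀ (δ / 2), Tendsto (fun n : ℕ =>
      ∫ y, Ω.indicator f y * (φ n).normed volume (w - y)) atTop (𝓝 (f w)) := fun w hw => by
    have hwΩ : w ∈ Ω := hsub w hw 0 (by positivity) (by simp)
    have hcw : ContinuousAt (Ω.indicator f) w :=
      (hcont.continuousAt (hΩ.mem_nhds hwΩ)).congr
        (by filter_upwards [hΩ.mem_nhds hwΩ] with z hz using (indicator_of_mem hz f).symm)
    have h1 := ContDiffBump.convolution_tendsto_right (μ := volume) (φ := φ)
      (g := fun _ : ℕ => Ω.indicator f) (k := fun _ => w) (x₀ := w) (z₀ := f w) hlim0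
      (Eventually.of_forall fun _ => hloc.aestronglyMeasurable)
      (by
        have h2 : Tendsto (Ω.indicator f) (𝓝 w) (𝓝 (f w)) := by
          simpa [ContinuousAt, indicator_of_mem hwΩ] using hcw
        exact h2.comp tendsto_snd) tendsto_const_nhds
    refine h1.congr fun n => ?_
    rw [convolution_eq_swap]
    refine integral_congr_ae (Eventually.of_forall fun y => ?_)
    simp [mul_comm]
  rw [dist_eq_norm, dist_eq_norm]
  refine le_of_tendsto ((hlim x hx).sub (hlim z hz)).norm (Eventually.of_forall fun n => ?_)
  choose! T hT1 hT2 using fun w (hw : w ∈ Metric.ball x₀ (δ / 2)) =>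
    norm_fderiv_mollification_le hΩ hloc hG ENNReal.toReal_nonneg hM (φ n)
      (hsub w hw _ (hr n))
  exact (convex_ball x₀ (δ / 2)).norm_image_sub_le_of_norm_hasFDerivWithin_le
    (fun w hw => (hT2 w hw).hasFDerivWithinAt) hT1 hz hx

end Mollification

/-! ### Existence of the bounds L, c, K. -/

section Bounds

variable {N : ℕ} {p c₂ Chat mA MA a₁ q ϑ : ℝ} {A B : ℝ → ℝ}
  {Ω : Set (EuclideanSpace ℝ (Fin N))} {f u : EuclideanSpace ℝ (Fin N) → ℝ}

theorem IsRegularSolution.locallyLipschitzOn_rhs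
    (H : IsRegularSolution N p c₂ Chat mA MA a₁ A B q ϑ Ω f u) :
    LocallyLipschitzOn (Ω \ {0}) (fun x => rhs p q ϑ f x (u x)) := by
  have h1 : LocallyLipschitzOn (Ω \ {0}) (fun x => ϑ * (u x ^ q / ‖x‖ ^ p)) := by
    intro x hx
    have hu : ContDiffAt ℝ 1 u x := H.regular.1.contDiffAt (H.isOpen_punctured.mem_nhds hx)
    have h0 : x ≠ 0 := hx.2
    have hn : ContDiffAt ℝ 1 (fun x : EuclideanSpace ℝ (Fin N) => ‖x‖) x := contDiffAt_norm ℝ h0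
    have h2 : ContDiffAt ℝ 1 (fun x => ϑ * (u x ^ q / ‖x‖ ^ p)) x :=
      contDiffAt_const.mul ((hu.rpow_const_of_ne (H.solution.pos x hx).ne').div
        (hn.rpow_const_of_ne (norm_ne_zero_iff.2 h0))
        (Real.rpow_pos_of_pos (norm_pos_iff.2 h0) _).ne')
    obtain ⟨k, t, ht, hk⟩ := h2.exists_lipschitzOnWith
    exact ⟨k, t, mem_nhdsWithin_of_mem_nhds ht, hk⟩
  exact h1.add ((H.memW1Infty.locallyLipschitzOn H.domain.1).mono sdiff_subset)

/-- Compactness of the closure: ∇u is continuous there, h is continuous and positive because its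
singular term is, and a locally Lipschitz function is Lipschitz on a compact set. -/
theorem IsRegularSolution.exists_boundsOn
    (H : IsRegularSolution N p c₂ Chat mA MA a₁ A B q ϑ Ω f u)
    {V : Set (EuclideanSpace ℝ (Fin N))} (hV : CompactlyIn V (Ω \ {0}))
    (hf : ∀ x ∈ closure V, 0 ≤ f x) :
    ∃ L c K : ℝ, BoundsOn V p q ϑ f u L c K := by
  obtain ⟨L, hL⟩ := hV.1.exists_bound_of_continuousOn (H.continuousOn_gradient.mono hV.2)
  have hpos : ∀ x ∈ closure V, 0 < rhs p q ϑ f x (u x) := fun x hx => by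
    have h1 := Real.rpow_pos_of_pos (H.solution.pos x (hV.2 hx)) q
    have h2 := Real.rpow_pos_of_pos (norm_pos_iff.2 (hV.2 hx).2) p
    exact add_pos_of_pos_of_nonneg (mul_pos H.ϑ_pos (div_pos h1 h2)) (hf x hx)
  obtain ⟨c, hc0, hc⟩ := hV.1.exists_forall_le' (H.continuousOn_rhs.mono hV.2) hpos
  obtain ⟨K, hK⟩ := (H.locallyLipschitzOn_rhs.mono hV.2).exists_lipschitzOnWith_of_compact hV.1
  refine ⟨L, c, K, hc0, fun x hx => hL x (subset_closure hx), fun x hx => hc x (subset_closure hx),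
    fun x hx z hz => ?_⟩
  have h := hK.dist_le_mul x (subset_closure hx) z (subset_closure hz)
  rwa [Real.dist_eq, dist_eq_norm] at h

end Bounds

/-! ### The two estimates. -/

theorem theorem1p4 (N : ℕ) (p c₂ Chat mA MA a₁ r γ : ℝ)
    (hp : 1 < p) (hpN : p < N) (hp2 : p ≠ 2) (hr0 : 0 < r) (hr1 : r < 1)
    (hγ : 3 ≤ N → γ < (N : ℝ) - 2) (hγ2 : N = 2 → γ = 0) :
    -- the local estimate on balls
    (∀ (x₀ : EuclideanSpace ℝ (Fin N)) (ρ R : ℝ), ρ < R → R < 2 * ρ →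
      ∃ C : ℝ → ℝ → ℝ → ℝ,
        ∀ (A B : ℝ → ℝ) (q ϑ : ℝ) (Ω : Set (EuclideanSpace ℝ (Fin N)))
          (f u : EuclideanSpace ℝ (Fin N) → ℝ),
          IsRegularSolution N p c₂ Chat mA MA a₁ A B q ϑ Ω f u →
          Metric.ball x₀ (2 * ρ) ⊆ Ω \ {0} → (∀ x ∈ Metric.ball x₀ (2 * ρ), 0 < f x) →
          volume (critSet Ω u ∩ Metric.ball x₀ ρ) = 0 ∧
          (∃ L c K : ℝ, BoundsOn (Metric.ball x₀ R) p q ϑ f u L c K) ∧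
          ∀ L c K : ℝ, BoundsOn (Metric.ball x₀ R) p q ϑ f u L c K →
            ∀ y ∈ Metric.ball x₀ ρ,
              weightIntegral (Metric.ball x₀ ρ) A u (weightExp p mA * r) γ y
                ≤ ENNReal.ofReal (C L c K)) ∧
    -- the estimate on compactly contained subsets
    (∀ Ω' V : Set (EuclideanSpace ℝ (Fin N)), IsOpen V → CompactlyIn Ω' V →
      ∃ C : ℝ → ℝ → ℝ → ℝ,
        ∀ (A B : ℝ → ℝ) (q ϑ : ℝ) (Ω : Set (EuclideanSpace ℝ (Fin N)))
          (f u : EuclideanSpace ℝ (Fin N) → ℝ),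
          IsRegularSolution N p c₂ Chat mA MA a₁ A B q ϑ Ω f u →
          HasSmoothBoundary Ω → (∀ x ∈ Ω, 0 ≤ f x) → CompactlyIn V (Ω \ {0}) →
          volume (critSet Ω u ∩ Ω') = 0 ∧
          (∃ L c K : ℝ, BoundsOn V p q ϑ f u L c K) ∧
          ∀ L c K : ℝ, BoundsOn V p q ϑ f u L c K →
            ∀ y ∈ Ω', weightIntegral Ω' A u (weightExp p mA * r) γ y
              ≤ ENNReal.ofReal (C L c K)) := by
  refine ⟨fun x₀ ρ R hρR hR => ?_, fun Ω' V hV hΩ'V => ?_⟩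
  · have hin : CompactlyIn (Metric.ball x₀ ρ) (Metric.ball x₀ R) :=
      ⟨(isCompact_closedBall x₀ ρ).closure_of_subset Metric.ball_subset_closedBall,
        Metric.closure_ball_subset_closedBall.trans (Metric.closedBall_subset_ball hρR)⟩
    -- The constant becomes a function of L, c, K alone, fixed before the operator, the domain and
    -- the solution.
    choose C hC using exists_weightIntegral_le (c₂ := c₂) (Chat := Chat) (mA := mA) (MA := MA)
      (a₁ := a₁) hp hpN hp2 hr0 hr1 hγ hγ2 Metric.isOpen_ball hin
    refine ⟨C, fun A B q ϑ Ω f u H hball hf => ?_⟩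
    have hcl : closure (Metric.ball x₀ R) ⊆ Metric.ball x₀ (2 * ρ) :=
      Metric.closure_ball_subset_closedBall.trans (Metric.closedBall_subset_ball hR)
    obtain ⟨L, c, K, hb⟩ := H.exists_boundsOn
      ⟨(isCompact_closedBall x₀ R).closure_of_subset Metric.ball_subset_closedBall,
        hcl.trans hball⟩ fun x hx => (hf x (hcl hx)).le
    have hsub : Metric.ball x₀ R ⊆ Ω \ {0} := subset_closure.trans (hcl.trans hball)
    exact ⟨(hC L c K A B q ϑ Ω f u H hsub hb).1, ⟨L, c, K, hb⟩,
      fun L c K hb => (hC L c K A B q ϑ Ω f u H hsub hb).2⟩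
  · choose C hC using exists_weightIntegral_le (c₂ := c₂) (Chat := Chat) (mA := mA) (MA := MA)
      (a₁ := a₁) hp hpN hp2 hr0 hr1 hγ hγ2 hV hΩ'V
    refine ⟨C, fun A B q ϑ Ω f u H _ hf hVΩ => ?_⟩
    obtain ⟨L, c, K, hb⟩ := H.exists_boundsOn hVΩ fun x hx => hf x (hVΩ.2 hx).1
    have hsub : V ⊆ Ω \ {0} := subset_closure.trans hVΩ.2
    exact ⟨(hC L c K A B q ϑ Ω f u H hsub hb).1, ⟨L, c, K, hb⟩,
      fun L c K hb => (hC L c K A B q ϑ Ω f u H hsub hb).2⟩
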